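/- **Setting.** Let $n,m,r\ge 0$ be integers, $\mathbb T^m=(\mathbb R/\mathbb Z)^m$, $\alpha\in\mathbb R^m$, $U\subset\mathbb R^n$ open, $(\Omega,\mathscr F,\mathbb P)$ a probability space and $\Phi:\Omega\to\Omega$ an invertible, bi-measurable, $\mathbb P$-preserving map (for instance the time-one Wiener shift on Wiener space). A measurable map $F:U\times\mathbb T^m\times\Omega\to\mathbb R^n$ defines the random skew-product $(z,\theta,\omega)\mapsto(F(z,\theta,\omega),\theta+\alpha,\Phi\omega)$. For a finite set $\Sigma\subset\mathbb N^2$, $F\in\mathcal L^\infty(C^\Sigma)$ means that $F$ is measurable, that for a.e. $\omega$ all derivatives $D_\theta^iD_z^jF(\cdot,\cdot,\omega)$, $(i,j)\in\Sigma$, exist and are continuous on $U\times\mathbb T^m$, and that $\|F\|_{\mathcal L^\infty(C^\Sigma)}=\operatorname{ess\,sup}_\omega\sup_{(i,j)\in\Sigma}\sup_{z,\theta}|D_\theta^iD_z^jF|<\infty$. Put $\Sigma_{r,1}=\{i\le r,\ i+j\le r+1\}$ and $\Sigma_r^+=\{i+j\le r\}\cup\{(0,1)\}$; thus for $r\ge1$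 the norm of $\mathcal L^\infty(C^{\Sigma_r^+})$ is the joint $\mathcal L^\infty(C^r)$ norm, while for $r=0$ it also controls $D_z$. For maps $\mathbb T^m\times\Omega\to\mathbb R^n$, $\mathcal L^\infty(C^r)$ and its norm are defined in the same way with the derivatives $D_\theta^i$, $i\le r$. The same classes without $\omega$ are used for deterministic maps. A map $K:\mathbb T^m\times\Omega\to U$ parameterizes a random invariant torus if, for a.e. $\omega$ and all $\theta$, $$F(K(\theta,\omega),\theta,\omega)=K(\theta+\alpha,\Phi\omega).\qquad(1)$$ Put $M(\theta,\omega)=D_zF(K(\theta,\omega),\theta,\omega)$ and let $M(\theta,\omega,N)$, $N\in\mathbb Z$, be the cocycle generated by $M$ over $(\theta,\omega)\mapsto(\theta+\alpha,\Phi\omega)$. The torus is *normally hyperbolic* (with regularity $r$) if there are jointly measurable complementary projections $\Pi^S(\theta,\omega),\Pi^U(\theta,\omega)$ of $\mathbb R^n$ and measurable $C(\omega),\lambda_S(\omega),\lambda_U(\omega)$ such that for a.e. $\omega$: the projections are $C^r$ in $\theta$; $C>0$ and $0<\lambda_S<1<\lambda_U$; and for all $\theta$, $M(\theta,\omega)$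 is invertible and maps the ranges $\mathscr E^S,\mathscr E^U$ of $\Pi^S,\Pi^U$ at $(\theta,\omega)$ into those at $(\theta+\alpha,\Phi\omega)$, $v\in\mathscr E^S(\theta,\omega)$ iff $|M(\theta,\omega,N)v|\le C\lambda_S^N|v|$ for all $N\ge0$, and $v\in\mathscr E^U(\theta,\omega)$ iff $|M(\theta,\omega,N)v|\le C\lambda_U^N|v|$ for all $N\le0$. For a deterministic skew-product the same definition is used with $\Omega$ a single point. **Statement.** Let $F_0:U\times\mathbb T^m\to\mathbb R^n$ be a deterministic map of class $C^{\Sigma_{r,1}}$ with bounded derivatives, and let $K_0\in C^r(\mathbb T^m,U)$ satisfy $F_0(K_0(\theta),\theta)=K_0(\theta+\alpha)$ and parameterize a normally hyperbolic invariant torus $\mathcal K_0$. Let $c>0$. Then there are $\varepsilon_0,C,\rho>0$ such that for every $0<\varepsilon<\varepsilon_0$ and every $F\in\mathcal L^\infty(C^{\Sigma_{r,1}})$ for which $F(\cdot,\theta,\omega)$ is a local diffeomorphism on $U$ for a.e. $\omega$ and all $\theta$, and $$\|F-F_0\|_{\mathcal L^\infty(C^{\Sigma_r^+})}\le c\,\varepsilon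 ,$$ there is a map $K_\varepsilon:\mathbb T^m\times\Omega\to U$ in $\mathcal L^\infty(C^r)$ such that: 1. $K_\varepsilon$ satisfies (1), and $\omega\mapsto\{(K_\varepsilon(\theta,\omega),\theta):\theta\in\mathbb T^m\}$ is a random set (the sets are nonempty and closed, and the distance from any fixed point to them is a random variable); 2. the random torus parameterized by $K_\varepsilon$ is normally hyperbolic (with regularity $r$); 3. $\|K_\varepsilon-K_0\|_{\mathcal L^\infty(C^r)}\le C\varepsilon$ and $\|K_\varepsilon-K_0\|_{\mathcal L^\infty(C^0)}<\rho$; 4. $K_\varepsilon$ is unique: if $K'\in\mathcal L^\infty(C^0)$ takes values in $U$ (for a.e. $\omega$ and all $\theta$), satisfies (1), and $\|K'-K_0\|_{\mathcal L^\infty(C^0)}<\rho$, then for a.e. $\omega$ one has $K'(\theta,\omega)=K_\varepsilon(\theta,\omega)$ for all $\theta$. -/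

import Mathlib

open MeasureTheory Set
open scoped ENNReal Manifold

noncomputable section

/-- The state space `ℝⁿ` with its Euclidean norm. -/
abbrev RVec (n : ℕ) := EuclideanSpace ℝ (Fin n)

/-- The torus `𝕋ᵐ = (ℝ / ℤ)ᵐ`. -/
abbrev Torus (m : ℕ) := Fin m → UnitAddCircle

/-- The covering map `ℝᵐ → 𝕋ᵐ`. Functions on the torus are differentiated through their
`ℤᵐ`-periodic lifts to `ℝᵐ`. -/
def toTorus {m : ℕ} (x : RVec m) : Torus m := fun i => (x i : UnitAddCircle)

/-! ### Maps on `U × 𝕋ᵐ` of class `C^Σ`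

A pair `(i, j)` stands for `i` derivatives in `θ` and `j` derivatives in `z`. -/

/-- `Σ_{r,s} = {(i, j) : i ≤ r, i + j ≤ r + s}`. -/
def sigmaRS (r s : ℕ) : Set (ℕ × ℕ) := {p | p.1 ≤ r ∧ p.1 + p.2 ≤ r + s}

/-- The index set `{(i, j) : i + j ≤ r}` of joint `C^r` regularity. -/
def sigmaJoint (r : ℕ) : Set (ℕ × ℕ) := {p | p.1 + p.2 ≤ r}

/-- The mixed derivative `D_θ^i D_z^j f (z, θ)` at `θ = toTorus x`. -/
def mixedDeriv {n m : ℕ} (i j : ℕ) (f : RVec n → Torus m → RVec n) (z : RVec n) (x : RVec m) :=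
  iteratedFDeriv ℝ i (fun y : RVec m => iteratedFDeriv ℝ j (fun w => f w (toTorus y)) z) x

/-- For every `(i, j) ∈ S`, the derivative `D_θ^i D_z^j f` exists and is continuous on
`U × 𝕋ᵐ`. -/
def IsCSigma {n m : ℕ} (U : Set (RVec n)) (S : Set (ℕ × ℕ)) (f : RVec n → Torus m → RVec n) :
    Prop :=
  ∀ p ∈ S,
    (∀ x : RVec m, ContDiffOn ℝ p.2 (fun w => f w (toTorus x)) U) ∧
    (∀ z ∈ U, ContDiff ℝ p.1
      (fun y : RVec m => iteratedFDeriv ℝ p.2 (fun w => f w (toTorus y)) z)) ∧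
    ContinuousOn (fun q : RVec n × RVec m => mixedDeriv p.1 p.2 f q.1 q.2) (U ×ˢ univ)

/-- The supremum over `U × 𝕋ᵐ` of all derivatives `|D_θ^i D_z^j f|` with `(i, j) ∈ S`. -/
def cSigmaNorm {n m : ℕ} (U : Set (RVec n)) (S : Set (ℕ × ℕ)) (f : RVec n → Torus m → RVec n) :
    ℝ≥0∞ :=
  ⨆ p ∈ S, ⨆ z ∈ U, ⨆ x : RVec m, ‖mixedDeriv p.1 p.2 f z x‖ₑ

/-- The norm of `L^∞(Ω, C^Σ(U × 𝕋ᵐ, ℝⁿ))`, with values in `[0, ∞]`. -/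
def linfCSigmaNorm {n m : ℕ} {Ω : Type*} [MeasurableSpace Ω] (P : Measure Ω) (U : Set (RVec n))
    (S : Set (ℕ × ℕ)) (F : RVec n → Torus m → Ω → RVec n) : ℝ≥0∞ :=
  essSup (fun ω => cSigmaNorm U S (fun z θ => F z θ ω)) P

/-- The space `L^∞(Ω, C^Σ(U × 𝕋ᵐ, ℝⁿ))`. The values of `F` outside `U` are irrelevant. -/
def MemLinfCSigma {n m : ℕ} {Ω : Type*} [MeasurableSpace Ω] (P : Measure Ω) (U : Set (RVec n))
    (S : Set (ℕ × ℕ)) (F : RVec n → Torus m → Ω → RVec n) : Prop :=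
  Measurable (fun q : U × Torus m × Ω => F q.1 q.2.1 q.2.2) ∧
  (∀ᵐ ω ∂P, IsCSigma U S (fun z θ => F z θ ω)) ∧
  linfCSigmaNorm P U S F < ∞

/-! ### Sections over the torus -/

/-- A map on `𝕋ᵐ` is of class `C^r` if its lift to `ℝᵐ` is. -/
def IsCrTorus {m : ℕ} {V : Type*} [NormedAddCommGroup V] [NormedSpace ℝ V] (r : ℕ)
    (κ : Torus m → V) : Prop :=
  ContDiff ℝ r (fun x : RVec m => κ (toTorus x))

/-- The `C^r` norm of a map on `𝕋ᵐ`. -/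
def crTorusNorm {m : ℕ} {V : Type*} [NormedAddCommGroup V] [NormedSpace ℝ V] (r : ℕ)
    (κ : Torus m → V) : ℝ≥0∞ :=
  ⨆ i ∈ Set.Iic r, ⨆ x : RVec m, ‖iteratedFDeriv ℝ i (fun y : RVec m => κ (toTorus y)) x‖ₑ

/-- The norm of `L^∞(Ω, C^r(𝕋ᵐ, ℝⁿ))`, with values in `[0, ∞]`. -/
def linfCrNorm {n m : ℕ} {Ω : Type*} [MeasurableSpace Ω] (P : Measure Ω) (r : ℕ)
    (K : Torus m → Ω → RVec n) : ℝ≥0∞ :=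
  essSup (fun ω => crTorusNorm r (fun θ => K θ ω)) P

/-- The space `L^∞(Ω, C^r(𝕋ᵐ, ℝⁿ))` of random sections. -/
def MemLinfCr {n m : ℕ} {Ω : Type*} [MeasurableSpace Ω] (P : Measure Ω) (r : ℕ)
    (K : Torus m → Ω → RVec n) : Prop :=
  Measurable (fun q : Torus m × Ω => K q.1 q.2) ∧
  (∀ᵐ ω ∂P, IsCrTorus r (fun θ => K θ ω)) ∧
  linfCrNorm P r K < ∞

/-! ### Random skew-products and invariant tori

The base is an automorphism `Φ` of the sample space, the rotation vector is `α`, and the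
skew-product is `(z, θ, ω) ↦ (F z θ ω, θ + α, Φ ω)`. -/

/-- The random invariance equation `F(K(θ,ω),θ,ω) = K(θ+α,Φω)`. -/
def SolvesInvariance {n m : ℕ} {Ω : Type*} [MeasurableSpace Ω] (P : Measure Ω) (Φ : Ω ≃ᵐ Ω)
    (α : RVec m) (F : RVec n → Torus m → Ω → RVec n) (K : Torus m → Ω → RVec n) : Prop :=
  ∀ᵐ ω ∂P, ∀ θ, F (K θ ω) θ ω = K (θ + toTorus α) (Φ ω)

/-- The torus `𝓚(ω) = {(K(θ,ω),θ) : θ ∈ 𝕋ᵐ}` parameterized by `K`. -/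
def torusGraph {n m : ℕ} {Ω : Type*} (K : Torus m → Ω → RVec n) (ω : Ω) :
    Set (RVec n × Torus m) :=
  range (fun θ => (K θ ω, θ))

/-- A random set: nonempty closed sets `S ω` whose distance to every fixed point is a random
variable. -/
def IsRandomSet {X Ω : Type*} [PseudoMetricSpace X] [MeasurableSpace Ω] (S : Ω → Set X) : Prop :=
  (∀ ω, (S ω).Nonempty ∧ IsClosed (S ω)) ∧
  ∀ x, Measurable (fun ω => Metric.infDist x (S ω))

/-- The transfer matrix `M(θ,ω) = D_z F(K(θ,ω),θ,ω)`. -/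
def transferMatrix {n m : ℕ} {Ω : Type*} (F : RVec n → Torus m → Ω → RVec n)
    (K : Torus m → Ω → RVec n) (θ : Torus m) (ω : Ω) : RVec n →L[ℝ] RVec n :=
  fderiv ℝ (fun z => F z θ ω) (K θ ω)

/-- Forward products `M(θ+(N-1)α,Φ_{N-1}ω) ⋯ M(θ,ω)`. -/
def forwardCocycle {n m : ℕ} {Ω : Type*} [MeasurableSpace Ω] (Φ : Ω ≃ᵐ Ω) (α : RVec m)
    (M : Torus m → Ω → RVec n →L[ℝ] RVec n) : ℕ → Torus m → Ω → RVec n →L[ℝ] RVec n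
  | 0, _, _ => 1
  | N + 1, θ, ω => forwardCocycle Φ α M N (θ + toTorus α) (Φ ω) * M θ ω

/-- Backward products `M(θ-Nα,Φ_{-N}ω)⁻¹ ⋯ M(θ-α,Φ_{-1}ω)⁻¹`, that is, the cocycle at
time `-N`. -/
def backwardCocycle {n m : ℕ} {Ω : Type*} [MeasurableSpace Ω] (Φ : Ω ≃ᵐ Ω) (α : RVec m)
    (M : Torus m → Ω → RVec n →L[ℝ] RVec n) : ℕ → Torus m → Ω → RVec n →L[ℝ] RVec n
  | 0, _, _ => 1
  | N + 1, θ, ω =>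
      backwardCocycle Φ α M N (θ - toTorus α) (Φ.symm ω) *
        Ring.inverse (M (θ - toTorus α) (Φ.symm ω))

/-- Normal hyperbolicity of the linear skew-product `(M, α, Φ)`: for almost every `ω` the
matrices are invertible and there is an invariant splitting `ℝⁿ = E^S ⊕ E^U`, of class `C^r` in
`θ` and measurable, where `E^S` and `E^U` are the ranges of the complementary projections `PS`
and `PU` and are characterized by forward and backward exponential decay. -/
def IsNormallyHyperbolic {n m : ℕ} {Ω : Type*} [MeasurableSpace Ω] (P : Measure Ω) (Φ : Ω ≃ᵐ Ω)
    (α : RVec m) (r : ℕ) (M : Torus m → Ω → RVec n →L[ℝ] RVec n) : Prop :=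
  ∃ (PS PU : Torus m → Ω → RVec n →L[ℝ] RVec n) (C lamS lamU : Ω → ℝ),
    Measurable (fun q : Torus m × Ω => PS q.1 q.2) ∧
    Measurable (fun q : Torus m × Ω => PU q.1 q.2) ∧
    Measurable C ∧ Measurable lamS ∧ Measurable lamU ∧
    ∀ᵐ ω ∂P,
      IsCrTorus r (fun θ => PS θ ω) ∧ IsCrTorus r (fun θ => PU θ ω) ∧
      0 < C ω ∧ 0 < lamS ω ∧ lamS ω < 1 ∧ 1 < lamU ω ∧
      ∀ θ,
        IsUnit (M θ ω) ∧
        PS θ ω * PS θ ω = PS θ ω ∧ PU θ ω * PU θ ω = PU θ ω ∧ PS θ ω + PU θ ω = 1 ∧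
        M θ ω * PS θ ω = PS (θ + toTorus α) (Φ ω) * M θ ω ∧
        M θ ω * PU θ ω = PU (θ + toTorus α) (Φ ω) * M θ ω ∧
        (∀ v, v ∈ range (PS θ ω) ↔
          ∀ N : ℕ, ‖forwardCocycle Φ α M N θ ω v‖ ≤ C ω * lamS ω ^ N * ‖v‖) ∧
        (∀ v, v ∈ range (PU θ ω) ↔
          ∀ N : ℕ, ‖backwardCocycle Φ α M N θ ω v‖ ≤ C ω * (lamU ω ^ N)⁻¹ * ‖v‖)

/-- Normal hyperbolicity of the torus parameterized by `K` for the deterministic skew-product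
`(z, θ) ↦ (F₀ z θ, θ + α)`, i.e. for the random skew-product over a one-point sample space. -/
def IsNormallyHyperbolicDet {n m : ℕ} (α : RVec m) (r : ℕ) (F₀ : RVec n → Torus m → RVec n)
    (K₀ : Torus m → RVec n) : Prop :=
  IsNormallyHyperbolic (Measure.dirac ()) (MeasurableEquiv.refl Unit) α r
    (transferMatrix (fun z θ _ => F₀ z θ) (fun θ _ => K₀ θ))

end

/-! The invariance equation is solved along one orbit of the base at a time. Over `(θ + kα, Φ^k ω)`
the values `x_k = K(θ + kα, Φ^k ω)` form a two-sided solution of the nonautonomous equation `x_{k+1}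
= F(x_k, θ + kα, Φ^k ω)` near the reference `K₀(θ + kα)`. Such a solution exists and is unique, so
its value at `k = 0` defines `K`. Equation (1) holds because the shifted solution over `(θ, ω)` and
the solution over `(θ + α, Φω)` solve the same problem. Uniqueness of the torus has the same source.

Hyperbolicity enters only through a Green kernel, an exponentially decaying two-sided inverse of `u
↦ (u_{k+1} - M_k u_k)`. A dichotomy produces such a kernel (`isGreen_of_dichotomy`), and a kernel
gives back the splitting with its decay characterization (`IsGreen.mem_range_stable_iff`,
`IsGreen.mem_range_unstable_iff`). The central estimate is `IsGreen.norm_le_of_weighted`: it bounds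
a bounded approximate solution at one time by its defects, which may grow exponentially away from
that time. It yields uniqueness, `O(ε)` bounds and the decay of perturbed kernels. In the form
`tendsto_zero_of_green` it also allows limits in which the defects tend to zero separately at each
time. This is needed because `F` and its top derivatives have no modulus of continuity uniform in
`ω`.

Existence: with `x = K₀ + v` the equation becomes `v_{k+1} = M_k v_k + N_k(v_k)`, where `N_k` has a
small Lipschitz constant in a tube. Picard iteration converges and preserves measurability in `(θ,
ω)` (`exists_measurable_bounded_solution`). The same result for operator-valued sequences gives
measurable Green kernels of the perturbed cocycle (`exists_green_of_perturbation`).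

Regularity: freeze `ω` and treat `θ` as a parameter. The candidate derivative is the Green sum
solving the linearized equation, and difference quotients converge to it (`hasFDerivAt_of_green`).
Induction on the order gives `exists_hasCkBound_of_linear` and `exists_hasCkBound_of_nonlinear`; in
the latter the difference of the derivatives of `x` and of the reference solves a linear equation
with a source of size `O(ε)`. The class `Σ_{r,1}` makes `F` and `D_z F` jointly `C^r`
(`exists_contDiffAt_uncurry`), and its extra `z`-derivative makes the derivatives of order at most
`r` Lipschitz in `z`, hence the linear rate. The constant of that rate does not involve the bound of
`F` in `Σ_{r,1}`, so it is uniform in `F`.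

Normal hyperbolicity: the stable projection is the kernel entry `H(0, -1)`. It is measurable by
construction, `C^r` because kernel columns solve linear equations, and invariant because kernels are
unique. -/

open Filter Topology

/-! ### Green kernels of linear difference equations -/

section Green

variable {E : Type*} [NormedAddCommGroup E] [NormedSpace ℝ E]

/-- The action of `End(E)` on `Hom(V, E)` by composition. -/
noncomputable def postcompL (V E : Type*) [NormedAddCommGroup V] [NormedSpace ℝ V]
    [NormedAddCommGroup E] [NormedSpace ℝ E] :
    (E →L[ℝ] E) →L[ℝ] (V →L[ℝ] E) →L[ℝ] (V →L[ℝ] E) :=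
  ContinuousLinearMap.compL ℝ V E E

theorem postcompL_apply (V : Type*) [NormedAddCommGroup V] [NormedSpace ℝ V]
    (A : E →L[ℝ] E) (T : V →L[ℝ] E) : postcompL V E A T = A.comp T := rfl

theorem norm_postcompL_apply_le (V : Type*) [NormedAddCommGroup V] [NormedSpace ℝ V]
    (A : E →L[ℝ] E) : ‖postcompL V E A‖ ≤ ‖A‖ :=
  ContinuousLinearMap.opNorm_le_bound _ (norm_nonneg A) fun T =>
    ContinuousLinearMap.opNorm_comp_le A T

/-- The sum `∑ √ν ^ |j|` over the integers. -/
noncomputable def greenSum (ν : ℝ) : ℝ := ∑' j : ℤ, √ν ^ j.natAbs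

/-- `G` is an exponentially decaying two-sided inverse of `u ↦ (u (k + 1) - M k (u k))`. -/
structure IsGreen (M : ℤ → E →L[ℝ] E) (G : ℤ → ℤ → E →L[ℝ] E) (C ν : ℝ) : Prop where
  nu_pos : 0 < ν
  nu_lt : ν < 1
  const_nonneg : 0 ≤ C
  bound : ∀ k l, ‖G k l‖ ≤ C * ν ^ (k - l).natAbs
  -- `left` makes Green sums solutions; `right` recovers a bounded sequence from its defects and so
  -- gives uniqueness. An impulse at time `l` acts from time `l + 1` on, so the diagonal `G k (k -
  -- 1)` will be the stable projection at time `k`.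
  left : ∀ k l, G (k + 1) l - M k * G k l = if k = l then 1 else 0
  right : ∀ k l, G k (l - 1) - G k l * M l = if k = l then 1 else 0

theorem summable_pow_natAbs {q : ℝ} (h0 : 0 ≤ q) (h1 : q < 1) :
    Summable fun j : ℤ => q ^ j.natAbs :=
  Summable.of_nat_of_neg (by simpa using summable_geometric_of_lt_one h0 h1)
    (by simpa using summable_geometric_of_lt_one h0 h1)

theorem hasSum_sqrt_pow {ν : ℝ} (h1 : ν < 1) (k : ℤ) :
    HasSum (fun l : ℤ => √ν ^ (k - l).natAbs) (greenSum ν) := by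
  have h : Summable fun j : ℤ => √ν ^ j.natAbs :=
    summable_pow_natAbs (Real.sqrt_nonneg _) ((Real.sqrt_lt' one_pos).2 (by simpa using h1))
  have h2 := (Equiv.subLeft k).hasSum_iff (f := fun j : ℤ => √ν ^ j.natAbs) (a := greenSum ν)
  exact h2.2 (by rw [greenSum]; exact h.hasSum)

theorem one_le_greenSum {ν : ℝ} (h1 : ν < 1) : 1 ≤ greenSum ν := by
  have := le_hasSum (hasSum_sqrt_pow h1 0) 0 (fun j _ => by positivity)
  simpa using this

namespace IsGreen

variable {M : ℤ → E →L[ℝ] E} {G : ℤ → ℤ → E →L[ℝ] E} {C ν : ℝ}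

theorem sqrt_pos (h : IsGreen M G C ν) : 0 < √ν := Real.sqrt_pos.2 h.nu_pos

theorem sqrt_lt (h : IsGreen M G C ν) : √ν < 1 :=
  (Real.sqrt_lt' one_pos).2 (by simpa using h.nu_lt)

theorem nu_le_sqrt (h : IsGreen M G C ν) : ν ≤ √ν := by
  have h1 := Real.mul_self_sqrt h.nu_pos.le
  nlinarith [h.sqrt_pos, h.sqrt_lt]

theorem bound_sqrt (h : IsGreen M G C ν) (k l : ℤ) : ‖G k l‖ ≤ C * √ν ^ (k - l).natAbs :=
  (h.bound k l).trans (mul_le_mul_of_nonneg_left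
    (pow_le_pow_left₀ h.nu_pos.le h.nu_le_sqrt _) h.const_nonneg)

theorem const_greenSum_nonneg (h : IsGreen M G C ν) : 0 ≤ C * greenSum ν :=
  mul_nonneg h.const_nonneg (zero_le_one.trans (one_le_greenSum h.nu_lt))

theorem bound_const (h : IsGreen M G C ν) (k l : ℤ) : ‖G k l‖ ≤ C :=
  (h.bound k l).trans (mul_le_of_le_one_right h.const_nonneg
    (pow_le_one₀ h.nu_pos.le h.nu_lt.le))

/-- The weighted convolution estimate for the kernel. -/
theorem norm_apply_le (h : IsGreen M G C ν) (k k₀ l : ℤ) {g : E} {η : ℝ} (hη : 0 ≤ η)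
    (hg : ‖g‖ ≤ η * (√ν ^ (l - k₀).natAbs)⁻¹) :
    ‖G k l g‖ ≤ C * η * (√ν ^ (k - k₀).natAbs)⁻¹ * √ν ^ (k - l).natAbs := by
  have hs := h.sqrt_pos
  have hν : ν = √ν * √ν := (Real.mul_self_sqrt h.nu_pos.le).symm
  have hC := h.const_nonneg
  calc ‖G k l g‖ ≤ ‖G k l‖ * ‖g‖ := (G k l).le_opNorm g
    _ ≤ (C * ν ^ (k - l).natAbs) * (η * (√ν ^ (l - k₀).natAbs)⁻¹) := by
        exact mul_le_mul (h.bound k l) hg (norm_nonneg _)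
          (mul_nonneg hC (pow_nonneg h.nu_pos.le _))
    -- Half of the decay, `√ν ^ |k - l|`, moves the weight from `l` to `k` by the triangle
    -- inequality; the other half is kept for summation over `l`.
    _ = C * η * √ν ^ (k - l).natAbs * (√ν ^ (k - l).natAbs * (√ν ^ (l - k₀).natAbs)⁻¹) := by
        rw [hν, Real.sqrt_mul_self hs.le, mul_pow]; ring
    _ ≤ C * η * √ν ^ (k - l).natAbs * (√ν ^ (k - k₀).natAbs)⁻¹ := by
        gcongr
        rw [← div_eq_mul_inv, div_le_iff₀ (by positivity), inv_mul_eq_div,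
          le_div_iff₀ (by positivity), ← pow_add]
        exact pow_le_pow_of_le_one hs.le h.sqrt_lt.le (by omega)
    _ = _ := by ring

theorem summable_apply [CompleteSpace E] (h : IsGreen M G C ν) (k : ℤ) {g : ℤ → E} {η : ℝ}
    (hg : ∀ l, ‖g l‖ ≤ η) : Summable fun l => G k l (g l) := by
  have hη : 0 ≤ η := (norm_nonneg _).trans (hg 0)
  refine Summable.of_norm_bounded ((hasSum_sqrt_pow h.nu_lt k).summable.mul_left (C * η))
    fun l => ?_
  calc ‖G k l (g l)‖ ≤ ‖G k l‖ * ‖g l‖ := (G k l).le_opNorm _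
    _ ≤ (C * √ν ^ (k - l).natAbs) * η :=
      mul_le_mul (h.bound_sqrt k l) (hg l) (norm_nonneg _)
        (mul_nonneg h.const_nonneg (pow_nonneg h.sqrt_pos.le _))
    _ = _ := by ring

theorem norm_tsum_apply_le [CompleteSpace E] (h : IsGreen M G C ν) (k : ℤ) {g : ℤ → E} {η : ℝ}
    (hg : ∀ l, ‖g l‖ ≤ η) : ‖∑' l, G k l (g l)‖ ≤ C * greenSum ν * η := by
  have hη : 0 ≤ η := (norm_nonneg _).trans (hg 0)
  have := tsum_of_norm_bounded ((hasSum_sqrt_pow h.nu_lt k).mul_left (C * η))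
    (f := fun l => G k l (g l)) fun l => by
      calc ‖G k l (g l)‖ ≤ ‖G k l‖ * ‖g l‖ := (G k l).le_opNorm _
        _ ≤ (C * √ν ^ (k - l).natAbs) * η :=
          mul_le_mul (h.bound_sqrt k l) (hg l) (norm_nonneg _)
            (mul_nonneg h.const_nonneg (pow_nonneg h.sqrt_pos.le _))
        _ = _ := by ring
  linarith

/-- The kernel solves the inhomogeneous equation. -/
theorem tsum_solves [CompleteSpace E] (h : IsGreen M G C ν) {g : ℤ → E} {η : ℝ}
    (hg : ∀ l, ‖g l‖ ≤ η) (k : ℤ) :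
    ∑' l, G (k + 1) l (g l) = M k (∑' l, G k l (g l)) + g k := by
  rw [← sub_eq_iff_eq_add', ContinuousLinearMap.map_tsum _ (h.summable_apply k hg),
    ← (h.summable_apply (k + 1) hg).tsum_sub ((M k).summable (h.summable_apply k hg))]
  rw [tsum_eq_single k]
  · simpa using congrArg (fun T => T (g k)) (h.left k k)
  · intro l hl
    simpa [hl.symm] using congrArg (fun T => T (g l)) (h.left k l)

/-- Representation of bounded sequences by the kernel. -/
theorem hasSum_apply_sub [CompleteSpace E] (h : IsGreen M G C ν) {u : ℤ → E} {B : ℝ}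
    (hu : ∀ k, ‖u k‖ ≤ B) (k : ℤ) :
    HasSum (fun l => G k l (u (l + 1) - M l (u l))) (u k) := by
  have h1 : Summable fun l => G k l (u (l + 1)) := h.summable_apply k fun l => hu (l + 1)
  obtain ⟨a, ha⟩ := h1
  -- Summation by parts: after a shift of the index, `right` collapses the difference of the two
  -- series to the single term `l = k`.
  have h2 : HasSum (fun l => G k (l - 1) (u l)) a := by
    rw [← (Equiv.addRight (1 : ℤ)).hasSum_iff]
    simpa [Function.comp_def] using ha
  have h3 : HasSum (fun l => if l = k then u k else 0) (u k) := hasSum_ite_eq k (u k)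
  have h4 := ha.sub (h2.sub h3)
  rw [sub_sub_cancel] at h4
  convert h4 using 2 with l
  have h5 := congrArg (fun T => T (u l)) (h.right k l)
  by_cases hl : l = k
  · subst hl
    simp only [sub_apply, mul_apply_eq_comp, if_true,
      one_apply_eq_self] at h5
    rw [map_sub, if_pos rfl]; nth_rewrite 3 [← h5]; abel
  · rw [if_neg (Ne.symm hl)] at h5
    simp only [sub_apply, mul_apply_eq_comp,
      zero_apply, sub_eq_zero] at h5
    rw [map_sub, if_neg hl, ← h5]; abel

/-- Weighted a priori estimate for approximate solutions. -/
theorem norm_le_of_weighted [CompleteSpace E] (h : IsGreen M G C ν) {δ η B : ℝ} (hδ0 : 0 ≤ δ)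
    (hδ : C * greenSum ν * δ ≤ 1 / 2) (hη : 0 ≤ η) {u : ℤ → E} (hu : ∀ k, ‖u k‖ ≤ B) (k₀ : ℤ)
    (hsol : ∀ k, ‖u (k + 1) - M k (u k)‖ ≤ δ * ‖u k‖ + η * (√ν ^ (k - k₀).natAbs)⁻¹) :
    ‖u k₀‖ ≤ 2 * (C * greenSum ν) * η := by
  have hs := h.sqrt_pos
  have hB : 0 ≤ B := (norm_nonneg _).trans (hu 0)
  have key : ∀ s, 0 ≤ s → (∀ k, ‖u k‖ ≤ s * (√ν ^ (k - k₀).natAbs)⁻¹) →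
      ∀ k, ‖u k‖ ≤ (C * greenSum ν * (δ * s + η)) * (√ν ^ (k - k₀).natAbs)⁻¹ := by
    intro s hs0 hk k
    have h1 := tsum_of_norm_bounded ((hasSum_sqrt_pow h.nu_lt k).mul_left
      (C * (δ * s + η) * (√ν ^ (k - k₀).natAbs)⁻¹))
      (f := fun l => G k l (u (l + 1) - M l (u l))) fun l => by
        refine h.norm_apply_le k k₀ l (by positivity) ((hsol l).trans ?_)
        calc δ * ‖u l‖ + η * (√ν ^ (l - k₀).natAbs)⁻¹
            ≤ δ * (s * (√ν ^ (l - k₀).natAbs)⁻¹) + η * (√ν ^ (l - k₀).natAbs)⁻¹ := by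
              gcongr; exact hk l
          _ = _ := by ring
    rw [(h.hasSum_apply_sub hu k).tsum_eq] at h1
    calc ‖u k‖ ≤ _ := h1
      _ = _ := by ring
  -- The weighted supremum `s` is finite because `u` is bounded. The representation gives `s ≤ C S
  -- (δ s + η)` with `S = greenSum ν`, and the `δ`-term is absorbed. At `k₀` the weight equals one.
  set w : ℤ → ℝ := fun k => ‖u k‖ * √ν ^ (k - k₀).natAbs
  have hwB : ∀ k, w k ≤ B := fun k =>
    (mul_le_of_le_one_right (norm_nonneg _) (pow_le_one₀ hs.le h.sqrt_lt.le)).trans (hu k)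
  have hbdd : BddAbove (range w) := ⟨B, by rintro _ ⟨k, rfl⟩; exact hwB k⟩
  set s := ⨆ k, w k
  have hws : ∀ k, w k ≤ s := fun k => le_ciSup hbdd k
  have hs0 : 0 ≤ s := le_trans (by positivity) (hws k₀)
  have h1 := key s hs0 fun k => by
    rw [← div_eq_mul_inv, le_div_iff₀ (by positivity)]; exact hws k
  have h2 : s ≤ C * greenSum ν * (δ * s + η) := ciSup_le fun k => by
    have := h1 k
    rwa [← div_eq_mul_inv, le_div_iff₀ (by positivity)] at this
  have h3 : ‖u k₀‖ ≤ s := by simpa [w] using hws k₀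
  have h4 := mul_le_mul_of_nonneg_right hδ hs0
  nlinarith

/-- Inverse weights are at least one, so a uniform defect is a weighted defect centred at any chosen
time. -/
theorem norm_le_of_approx [CompleteSpace E] (h : IsGreen M G C ν) {δ η B : ℝ} (hδ0 : 0 ≤ δ)
    (hδ : C * greenSum ν * δ ≤ 1 / 2) (hη : 0 ≤ η) {u : ℤ → E} (hu : ∀ k, ‖u k‖ ≤ B)
    (hsol : ∀ k, ‖u (k + 1) - M k (u k)‖ ≤ δ * ‖u k‖ + η) (k : ℤ) :
    ‖u k‖ ≤ 2 * (C * greenSum ν) * η :=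
  h.norm_le_of_weighted hδ0 hδ hη hu k fun l => (hsol l).trans (by
    gcongr
    exact le_mul_of_one_le_right hη
      ((one_le_inv₀ (pow_pos h.sqrt_pos _)).2 (pow_le_one₀ h.sqrt_pos.le h.sqrt_lt.le)))

/-- The case `η = 0`. Uniqueness for nonlinear equations and for perturbed linear ones reduces to
it, since the difference of two solutions has a defect bounded by a small multiple of itself. -/
theorem eq_zero_of_approx [CompleteSpace E] (h : IsGreen M G C ν) {δ B : ℝ} (hδ0 : 0 ≤ δ)
    (hδ : C * greenSum ν * δ ≤ 1 / 2) {u : ℤ → E} (hu : ∀ k, ‖u k‖ ≤ B)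
    (hsol : ∀ k, ‖u (k + 1) - M k (u k)‖ ≤ δ * ‖u k‖) (k : ℤ) : u k = 0 := by
  have := h.norm_le_of_approx hδ0 hδ le_rfl hu (fun k => by simpa using hsol k) k
  simpa using this

theorem eq_of_solves [CompleteSpace E] (h : IsGreen M G C ν) {B B' : ℝ} {u v : ℤ → E}
    {g : ℤ → E} (hu : ∀ k, ‖u k‖ ≤ B) (hv : ∀ k, ‖v k‖ ≤ B')
    (hus : ∀ k, u (k + 1) = M k (u k) + g k) (hvs : ∀ k, v (k + 1) = M k (v k) + g k) (k : ℤ) :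
    u k = v k := by
  refine sub_eq_zero.1 (h.eq_zero_of_approx le_rfl (by simp) (u := fun k => u k - v k)
    (B := B + B') (fun k => (norm_sub_le _ _).trans (add_le_add (hu k) (hv k))) (fun k => ?_) k)
  simp [hus, hvs]

/-- A Green kernel acts on `Hom(V, E)` by composition. -/
theorem postcomp (h : IsGreen M G C ν) (V : Type*) [NormedAddCommGroup V] [NormedSpace ℝ V] :
    IsGreen (fun k => postcompL V E (M k)) (fun k l => postcompL V E (G k l)) C ν where
  nu_pos := h.nu_pos
  nu_lt := h.nu_lt
  const_nonneg := h.const_nonneg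
  bound k l := (norm_postcompL_apply_le V (G k l)).trans (h.bound k l)
  left k l := by
    refine ContinuousLinearMap.ext fun T => ContinuousLinearMap.ext fun v => ?_
    have h1 := congrArg (fun S => S (T v)) (h.left k l)
    by_cases hk : k = l
    · rw [if_pos hk] at h1 ⊢; exact h1
    · rw [if_neg hk] at h1 ⊢; exact h1
  right k l := by
    refine ContinuousLinearMap.ext fun T => ContinuousLinearMap.ext fun v => ?_
    have h1 := congrArg (fun S => S (T v)) (h.right k l)
    by_cases hk : k = l
    · rw [if_pos hk] at h1 ⊢; exact h1
    · rw [if_neg hk] at h1 ⊢; exact h1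

end IsGreen

/-- Approximate solutions tend to zero if their defects tend to zero termwise and are uniformly
bounded. -/
theorem tendsto_zero_of_green [CompleteSpace E] {ι : Type*} {f : Filter ι} {C ν δ R : ℝ}
    (hδ0 : 0 ≤ δ) (hδ : C * greenSum ν * δ ≤ 1 / 2) {u : ℤ → ι → E} {η : ℤ → ι → ℝ}
    (h : ∀ᶠ a in f, ∃ M G, IsGreen M G C ν ∧ (∃ B, ∀ k, ‖u k a‖ ≤ B) ∧
      ∀ k, ‖u (k + 1) a - M k (u k a)‖ ≤ δ * ‖u k a‖ + η k a ∧ η k a ≤ R)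
    (hη : ∀ k, Tendsto (η k) f (𝓝 0)) (k₀ : ℤ) : Tendsto (u k₀) f (𝓝 0) := by
  rcases f.eq_or_neBot with rfl | hf
  · simp
  obtain ⟨_, _, _, h0, _⟩ := h.exists
  rw [Metric.tendsto_nhds]
  intro ε hε
  have hL := h0.const_greenSum_nonneg
  set ε' := ε / (2 * (C * greenSum ν) + 1)
  have hε' : 0 < ε' := by positivity
  -- Outside a window of radius `N` the uniform bound `R` is at most `ε'` times the inverse weight;
  -- inside there are finitely many times, so termwise convergence is enough.
  obtain ⟨N, hN⟩ : ∃ N : ℕ, √ν ^ N * R ≤ ε' := by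
    have := ((tendsto_pow_atTop_nhds_zero_of_lt_one h0.sqrt_pos.le h0.sqrt_lt).mul_const R)
    rw [zero_mul] at this
    exact (this.eventually (eventually_le_nhds hε')).exists
  have hfin : ∀ᶠ a in f, ∀ k ∈ Finset.Icc (k₀ - N) (k₀ + N), η k a ≤ ε' := by
    rw [eventually_all_finset]
    exact fun k _ => (hη k).eventually (eventually_le_nhds hε')
  filter_upwards [h, hfin] with a ⟨M, G, hG, ⟨B, hB⟩, hs⟩ ha
  have hs0 := hG.sqrt_pos
  have := hG.norm_le_of_weighted hδ0 hδ hε'.le hB k₀ fun k => (hs k).1.trans (by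
    gcongr
    by_cases hk : k ∈ Finset.Icc (k₀ - N) (k₀ + N)
    · exact (ha k hk).trans (le_mul_of_one_le_right hε'.le
        ((one_le_inv₀ (pow_pos hs0 _)).2 (pow_le_one₀ hs0.le hG.sqrt_lt.le)))
    · rw [← div_eq_mul_inv, le_div_iff₀ (by positivity)]
      have hkN : N ≤ (k - k₀).natAbs := by
        rw [Finset.mem_Icc] at hk; omega
      rcases le_or_gt R 0 with hR | hR
      · exact (mul_nonpos_of_nonpos_of_nonneg ((hs k).2.trans hR) (by positivity)).trans hε'.le
      · calc η k a * √ν ^ (k - k₀).natAbs ≤ R * √ν ^ N := by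
              apply mul_le_mul (hs k).2 (pow_le_pow_of_le_one hs0.le hG.sqrt_lt.le hkN)
                (by positivity) hR.le
          _ ≤ ε' := by linarith)
  rw [dist_zero_right]
  calc ‖u k₀ a‖ ≤ 2 * (C * greenSum ν) * ε' := this
    _ < (2 * (C * greenSum ν) + 1) * ε' := by linarith
    _ = ε := mul_div_cancel₀ _ (by positivity)

end Green

/-! ### Picard iteration with measurable parameters, and perturbation of Green kernels -/

section Picard

variable {E : Type*} [NormedAddCommGroup E] [NormedSpace ℝ E]

/-- Picard iterates for `u (k + 1) = M k (u k) + N k (u k)`, where `G` is a Green kernel of `M`. -/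
noncomputable def picard (G : ℤ → ℤ → E →L[ℝ] E) (N : ℤ → E → E) : ℕ → ℤ → E
  | 0 => fun _ => 0
  | j + 1 => fun k => ∑' l, G k l (N l (picard G N j l))

namespace IsGreen

variable [CompleteSpace E] {M : ℤ → E →L[ℝ] E} {G : ℤ → ℤ → E →L[ℝ] E} {C ν δ η R : ℝ}
  {N : ℤ → E → E}

omit [NormedSpace ℝ E] [CompleteSpace E] in
theorem norm_nonlinearity_le (hN0 : ∀ k, ‖N k 0‖ ≤ η)
    (hN : ∀ k u v, ‖u‖ ≤ R → ‖v‖ ≤ R → ‖N k u - N k v‖ ≤ δ * ‖u - v‖) (hδ0 : 0 ≤ δ)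
    (k : ℤ) {u : E} (hu : ‖u‖ ≤ R) : ‖N k u‖ ≤ δ * R + η := by
  have hR : 0 ≤ R := (norm_nonneg _).trans hu
  have h1 := hN k u 0 hu (by simpa using hR)
  calc ‖N k u‖ = ‖(N k u - N k 0) + N k 0‖ := by rw [sub_add_cancel]
    _ ≤ δ * ‖u - 0‖ + η := (norm_add_le _ _).trans (add_le_add h1 (hN0 k))
    _ ≤ δ * R + η := by gcongr; simpa using hu

/-- The ball of radius `R` is invariant: with `S = greenSum ν`, `C S (δ R + η)` is at most `R / 2 +
R / 2`. -/
theorem norm_picard_le (h : IsGreen M G C ν) (hδ0 : 0 ≤ δ)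
    (hδ : C * greenSum ν * δ ≤ 1 / 2) (hR : 2 * (C * greenSum ν) * η ≤ R) (hR0 : 0 ≤ R)
    (hN0 : ∀ k, ‖N k 0‖ ≤ η)
    (hN : ∀ k u v, ‖u‖ ≤ R → ‖v‖ ≤ R → ‖N k u - N k v‖ ≤ δ * ‖u - v‖) (j : ℕ) (k : ℤ) :
    ‖picard G N j k‖ ≤ R := by
  induction j generalizing k with
  | zero => simpa [picard] using hR0
  | succ j ih =>
    have h1 := h.norm_tsum_apply_le k (g := fun l => N l (picard G N j l))
      fun l => norm_nonlinearity_le hN0 hN hδ0 l (ih l)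
    refine h1.trans ?_
    have h2 := mul_le_mul_of_nonneg_right hδ hR0
    nlinarith

theorem norm_picard_succ_sub_le (h : IsGreen M G C ν) (hδ0 : 0 ≤ δ)
    (hδ : C * greenSum ν * δ ≤ 1 / 2) (hR : 2 * (C * greenSum ν) * η ≤ R) (hR0 : 0 ≤ R)
    (hN0 : ∀ k, ‖N k 0‖ ≤ η)
    (hN : ∀ k u v, ‖u‖ ≤ R → ‖v‖ ≤ R → ‖N k u - N k v‖ ≤ δ * ‖u - v‖) (j : ℕ) (k : ℤ) :
    ‖picard G N (j + 1) k - picard G N j k‖ ≤ R * (1 / 2) ^ j := by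
  have hb := h.norm_picard_le hδ0 hδ hR hR0 hN0 hN
  induction j generalizing k with
  | zero => simpa [picard] using hb 1 k
  | succ j ih =>
    have hs : ∀ j l, ‖N l (picard G N j l)‖ ≤ δ * R + η := fun j l =>
      norm_nonlinearity_le hN0 hN hδ0 l (hb j l)
    have h0 : picard G N (j + 1 + 1) k - picard G N (j + 1) k =
        ∑' l, G k l (N l (picard G N (j + 1) l) - N l (picard G N j l)) := by
      simp only [map_sub]
      rw [(h.summable_apply k (hs (j + 1))).tsum_sub (h.summable_apply k (hs j))]
      rfl
    rw [h0]
    refine (h.norm_tsum_apply_le k (η := δ * (R * (1 / 2) ^ j)) fun l =>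
      (hN l _ _ (hb _ _) (hb _ _)).trans (by gcongr; exact ih l)).trans ?_
    calc C * greenSum ν * (δ * (R * (1 / 2) ^ j)) = C * greenSum ν * δ * (R * (1 / 2) ^ j) := by
          ring
      _ ≤ 1 / 2 * (R * (1 / 2) ^ j) := by gcongr
      _ = R * (1 / 2) ^ (j + 1) := by ring

/-- Convergence of the Picard iterates to a bounded solution. -/
theorem exists_tendsto_picard (h : IsGreen M G C ν) (hδ0 : 0 ≤ δ)
    (hδ : C * greenSum ν * δ ≤ 1 / 2) (hR : 2 * (C * greenSum ν) * η ≤ R) (hR0 : 0 ≤ R)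
    (hN0 : ∀ k, ‖N k 0‖ ≤ η)
    (hN : ∀ k u v, ‖u‖ ≤ R → ‖v‖ ≤ R → ‖N k u - N k v‖ ≤ δ * ‖u - v‖) :
    ∃ u : ℤ → E, (∀ k, Tendsto (fun j => picard G N j k) atTop (𝓝 (u k))) ∧
      (∀ k, ‖u k‖ ≤ R) ∧ ∀ k, u (k + 1) = M k (u k) + N k (u k) := by
  have hb := h.norm_picard_le hδ0 hδ hR hR0 hN0 hN
  have hc : ∀ k, ∃ a, Tendsto (fun j => picard G N j k) atTop (𝓝 a) := fun k =>
    cauchySeq_tendsto_of_complete (cauchySeq_of_le_geometric (1 / 2) R (by norm_num) fun j => by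
      rw [dist_eq_norm, norm_sub_rev]
      exact h.norm_picard_succ_sub_le hδ0 hδ hR hR0 hN0 hN j k)
  choose u hu using hc
  have huR : ∀ k, ‖u k‖ ≤ R := fun k =>
    le_of_tendsto (hu k).norm (Eventually.of_forall fun j => hb j k)
  refine ⟨u, hu, huR, fun k => ?_⟩
  have h1 : Tendsto (fun j => picard G N (j + 1) (k + 1)) atTop (𝓝 (u (k + 1))) :=
    (hu (k + 1)).comp (tendsto_add_atTop_nat 1)
  have hNt : Tendsto (fun j => N k (picard G N j k)) atTop (𝓝 (N k (u k))) := by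
    rw [tendsto_iff_norm_sub_tendsto_zero]
    refine squeeze_zero (fun _ => norm_nonneg _) (fun j => hN k _ _ (hb j k) (huR k)) ?_
    simpa using (tendsto_iff_norm_sub_tendsto_zero.1 (hu k)).const_mul δ
  have h2 : Tendsto (fun j => M k (picard G N (j + 1) k) + N k (picard G N j k)) atTop
      (𝓝 (M k (u k) + N k (u k))) :=
    (((M k).continuous.tendsto _).comp ((hu k).comp (tendsto_add_atTop_nat 1))).add hNt
  refine tendsto_nhds_unique h1 (h2.congr fun j => ?_)
  exact (h.tsum_solves (fun l => norm_nonlinearity_le hN0 hN hδ0 l (hb j l)) k).symm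

end IsGreen

/-- Bounded solutions of a measurable family of nonlinear difference equations. -/
theorem exists_measurable_bounded_solution [FiniteDimensional ℝ E] [MeasurableSpace E]
    [BorelSpace E] {ι : Type*} [MeasurableSpace ι]
    {M : ι → ℤ → E →L[ℝ] E} {G : ι → ℤ → ℤ → E →L[ℝ] E} {N : ι → ℤ → E → E} {C ν δ η R : ℝ}
    (h : ∀ p, IsGreen (M p) (G p) C ν) (hG : ∀ k l, Measurable fun p => G p k l) (hδ0 : 0 ≤ δ)
    (hδ : C * greenSum ν * δ ≤ 1 / 2) (hR : 2 * (C * greenSum ν) * η ≤ R) (hR0 : 0 ≤ R)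
    (hN0 : ∀ p k, ‖N p k 0‖ ≤ η)
    (hN : ∀ p k u v, ‖u‖ ≤ R → ‖v‖ ≤ R → ‖N p k u - N p k v‖ ≤ δ * ‖u - v‖)
    (hNm : ∀ k (v : ι → E), Measurable v → (∀ p, ‖v p‖ ≤ R) → Measurable fun p => N p k (v p)) :
    ∃ u : ι → ℤ → E, (∀ k, Measurable fun p => u p k) ∧
      ∀ p, (∀ k, ‖u p k‖ ≤ R) ∧ ∀ k, u p (k + 1) = M p k (u p k) + N p k (u p k) := by
  have : CompleteSpace E := FiniteDimensional.complete ℝ E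
  have : ProperSpace E := FiniteDimensional.proper ℝ E
  have : SecondCountableTopology E := inferInstance
  choose u hu using fun p => (h p).exists_tendsto_picard hδ0 hδ hR hR0 (hN0 p) (hN p)
  -- An iterate is a limit of finite partial sums of measurable terms, so measurability survives
  -- each step of the iteration and then its limit.
  have hm : ∀ j k, Measurable fun p => picard (G p) (N p) j k := by
    intro j
    induction j with
    | zero => exact fun k => measurable_const
    | succ j ih =>
      intro k
      have hb : ∀ p l, ‖picard (G p) (N p) j l‖ ≤ R := fun p l =>
        (h p).norm_picard_le hδ0 hδ hR hR0 (hN0 p) (hN p) j l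
      have hs : ∀ p, HasSum (fun l => G p k l (N p l (picard (G p) (N p) j l)))
          (picard (G p) (N p) (j + 1) k) := fun p =>
        ((h p).summable_apply k fun l =>
          IsGreen.norm_nonlinearity_le (hN0 p) (hN p) hδ0 l (hb p l)).hasSum
      refine measurable_of_tendsto_metrizable' (atTop : Filter (Finset ℤ)) (fun s => ?_)
        (tendsto_pi_nhds.2 hs)
      refine Finset.measurable_sum s fun l _ => ?_
      exact isBoundedBilinearMap_apply.continuous.measurable2 (hG k l)
        (hNm l _ (ih l) fun p => hb p l)
  exact ⟨u, fun k => measurable_of_tendsto_metrizable (fun j => hm j k)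
    (tendsto_pi_nhds.2 fun p => (hu p).1 k), fun p => (hu p).2⟩

/-- Measurable families of Green kernels persist under small perturbations. -/
theorem exists_green_of_perturbation [FiniteDimensional ℝ E]
    {ι : Type*} [MeasurableSpace ι]
    {M A : ι → ℤ → E →L[ℝ] E} {G : ι → ℤ → ℤ → E →L[ℝ] E} {C ν δ : ℝ}
    (h : ∀ p, IsGreen (M p) (G p) C ν) (hG : ∀ k l, Measurable fun p => G p k l)
    (hM : ∀ k, Measurable fun p => M p k) (hA : ∀ k, Measurable fun p => A p k) (hδ0 : 0 ≤ δ)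
    (hδ : C * greenSum ν * δ ≤ 1 / 2) (hAM : ∀ p k, ‖A p k - M p k‖ ≤ δ) :
    ∃ H : ι → ℤ → ℤ → E →L[ℝ] E, (∀ k l, Measurable fun p => H p k l) ∧
      ∀ p, IsGreen (A p) (H p) (2 * (C * greenSum ν)) (√ν) := by
  have : CompleteSpace E := FiniteDimensional.complete ℝ E
  have : ProperSpace E := FiniteDimensional.proper ℝ E
  rcases isEmpty_or_nonempty ι with hι | ⟨⟨p₀⟩⟩
  · exact ⟨fun p => (hι.false p).elim, fun _ _ => measurable_of_empty _, fun p => (hι.false p).elim⟩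
  have hL := (h p₀).const_greenSum_nonneg
  -- Column `l` of the new kernel is the bounded solution of `T (k + 1) = A k ∘ T k` with unit
  -- impulse at `l`; the perturbation `A - M` is treated as the nonlinearity.
  have h1 : ∀ l, ∃ u : ι → ℤ → E →L[ℝ] E, (∀ k, Measurable fun p => u p k) ∧
      ∀ p, (∀ k, ‖u p k‖ ≤ 2 * (C * greenSum ν)) ∧
        ∀ k, u p (k + 1) = postcompL E E (M p k) (u p k) +
          ((A p k - M p k).comp (u p k) + if k = l then 1 else 0) := by
    intro l
    refine exists_measurable_bounded_solution (δ := δ) (η := 1)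
      (N := fun p k T => (A p k - M p k).comp T + if k = l then 1 else 0)
      (fun p => (h p).postcomp E)
      (fun k l => (postcompL E E).continuous.measurable.comp (hG k l)) hδ0 hδ (by simp)
      (by linarith) (fun p k => ?_) (fun p k S T _ _ => ?_) (fun k v hv _ => ?_)
    · have : ‖(1 : E →L[ℝ] E)‖ ≤ 1 := ContinuousLinearMap.norm_id_le
      by_cases hk : k = l
      · simpa [hk] using this
      · simp [hk]
    · rw [add_sub_add_right_eq_sub, ← ContinuousLinearMap.comp_sub]
      exact (ContinuousLinearMap.opNorm_comp_le _ _).trans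
        (mul_le_mul_of_nonneg_right (hAM p k) (norm_nonneg _))
    · have hc : Continuous fun q : (E →L[ℝ] E) × (E →L[ℝ] E) => q.1.comp q.2 :=
        isBoundedBilinearMap_comp.continuous
      exact (hc.measurable2 ((hA k).sub (hM k)) hv).add measurable_const
  choose u hum hu using h1
  have hzero : ∀ p (v : ℤ → E →L[ℝ] E) (B : ℝ), (∀ k, ‖v k‖ ≤ B) →
      (∀ k, v (k + 1) = (A p k).comp (v k)) → ∀ k, v k = 0 := by
    intro p v B hv hs k
    refine ((h p).postcomp E).eq_zero_of_approx hδ0 hδ hv (fun k => ?_) k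
    rw [hs, postcompL_apply, ← ContinuousLinearMap.sub_comp]
    exact (ContinuousLinearMap.opNorm_comp_le _ _).trans
        (mul_le_mul_of_nonneg_right (hAM p k) (norm_nonneg _))
  have hsol : ∀ p l k, u l p (k + 1) = (A p k).comp (u l p k) + if k = l then 1 else 0 := by
    intro p l k
    rw [(hu l p).2 k, postcompL_apply, ContinuousLinearMap.sub_comp]
    abel
  refine ⟨fun p k l => u l p k, fun k l => hum l k, fun p => ?_⟩
  have hs := (h p).sqrt_pos
  have hs1 := (h p).sqrt_lt
  -- As a function of `k`, the defect of the right identity is a bounded solution of the homogeneous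
  -- equation of `A`, hence zero.
  have hright : ∀ k l, u (l - 1) p k - (u l p k).comp (A p l) = if k = l then 1 else 0 := by
    intro k l
    refine sub_eq_zero.1 (hzero p (fun k => u (l - 1) p k - (u l p k).comp (A p l) -
      if k = l then 1 else 0) (2 * (C * greenSum ν) + 2 * (C * greenSum ν) * ‖A p l‖ + 1)
      (fun k => ?_) (fun k => ?_) k)
    · refine (norm_sub_le _ _).trans (add_le_add ((norm_sub_le _ _).trans (add_le_add
        ((hu _ p).1 k) ((ContinuousLinearMap.opNorm_comp_le _ _).trans
          (mul_le_mul_of_nonneg_right ((hu _ p).1 k) (norm_nonneg _))))) ?_)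
      have : ‖(1 : E →L[ℝ] E)‖ ≤ 1 := ContinuousLinearMap.norm_id_le
      by_cases hk : k = l
      · simpa [hk] using this
      · simp [hk]
    · have e1 : (if k + 1 = l then (1 : E →L[ℝ] E) else 0) = if k = l - 1 then 1 else 0 := by
        simp only [eq_sub_iff_add_eq]
      have e2 : (if k = l then (1 : E →L[ℝ] E) else 0) * A p l =
          A p k * if k = l then (1 : E →L[ℝ] E) else 0 := by
        by_cases hk : k = l
        · simp [hk]
        · simp [hk]
      simp only [hsol, e1]
      change A p k * u (l - 1) p k + _ - (A p k * u l p k + _) * A p l - _ =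
        A p k * (u (l - 1) p k - u l p k * A p l - _)
      rw [add_mul, e2]
      noncomm_ring
  refine ⟨hs, hs1, by positivity, fun k l => ?_, fun k l => ?_, hright⟩
  -- The impulse at `l` has norm at most one, which is `√ν ^ |l - k|` times the inverse weight
  -- centred at `k`. The weighted estimate therefore turns it into decay of rate `√ν`.
  · rw [← Int.natAbs_neg, neg_sub]
    refine ((h p).postcomp E).norm_le_of_weighted hδ0 hδ
      (η := √ν ^ (l - k).natAbs) (by positivity) (hu l p).1 k fun j => ?_
    rw [(hu l p).2 j, add_sub_cancel_left]
    refine (norm_add_le _ _).trans (add_le_add ((ContinuousLinearMap.opNorm_comp_le _ _).trans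
      (mul_le_mul_of_nonneg_right (hAM p j) (norm_nonneg _))) ?_)
    have : ‖(1 : E →L[ℝ] E)‖ ≤ 1 := ContinuousLinearMap.norm_id_le
    by_cases hj : j = l
    · subst hj
      rw [if_pos rfl, mul_inv_cancel₀ (by positivity)]
      exact this
    · rw [if_neg hj, norm_zero]
      positivity
  · change u l p (k + 1) - A p k * u l p k = _
    rw [hsol p l k]
    exact add_sub_cancel_left _ _

end Picard

/-! ### Functions with bounded derivatives -/

section CkBound

universe u

variable {Y Z E F G : Type u} [NormedAddCommGroup Y] [NormedSpace ℝ Y]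
  [NormedAddCommGroup Z] [NormedSpace ℝ Z] [NormedAddCommGroup E] [NormedSpace ℝ E]
  [NormedAddCommGroup F] [NormedSpace ℝ F] [NormedAddCommGroup G] [NormedSpace ℝ G]

/-- `f` is of class `C^s` and all its derivatives of order at most `s` are bounded by `b`. -/
def HasCkBound (s : ℕ) (b : ℝ) (f : Y → E) : Prop :=
  ContDiff ℝ s f ∧ ∀ i ≤ s, ∀ y, ‖iteratedFDeriv ℝ i f y‖ ≤ b

namespace HasCkBound

variable {s : ℕ} {b b' : ℝ} {f g : Y → E}

theorem norm_le (h : HasCkBound s b f) (y : Y) : ‖f y‖ ≤ b := by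
  simpa using h.2 0 (Nat.zero_le _) y

theorem nonneg (h : HasCkBound s b f) : 0 ≤ b := (norm_nonneg _).trans (h.norm_le 0)

theorem mono (h : HasCkBound s b f) (hb : b ≤ b') : HasCkBound s b' f :=
  ⟨h.1, fun i hi y => (h.2 i hi y).trans hb⟩

theorem of_le {t : ℕ} (h : HasCkBound s b f) (ht : t ≤ s) : HasCkBound t b f :=
  ⟨h.1.of_le (by exact_mod_cast ht), fun i hi y => h.2 i (hi.trans ht) y⟩

theorem zero_iff : HasCkBound 0 b f ↔ Continuous f ∧ ∀ y, ‖f y‖ ≤ b := by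
  simp [HasCkBound]

/-- Lowers the order by one at the price of a new target space. The inductions on regularity run
through this equivalence, which is why they quantify over the spaces. -/
theorem succ_iff : HasCkBound (s + 1) b f ↔
    Differentiable ℝ f ∧ (∀ y, ‖f y‖ ≤ b) ∧ HasCkBound s b (fderiv ℝ f) := by
  constructor
  · intro h
    refine ⟨h.1.differentiable (by simp), h.norm_le, h.1.fderiv_right (by norm_cast), ?_⟩
    intro i hi y
    rw [norm_iteratedFDeriv_fderiv]
    exact h.2 (i + 1) (by omega) y
  · rintro ⟨h1, h2, h3⟩
    refine ⟨?_, ?_⟩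
    · push_cast
      exact contDiff_succ_iff_fderiv.2 ⟨h1, by simp, h3.1⟩
    · rintro (_ | i) hi y
      · simpa using h2 y
      · rw [← norm_iteratedFDeriv_fderiv]
        exact h3.2 i (by omega) y

theorem const (s : ℕ) {b : ℝ} {c : E} (hc : ‖c‖ ≤ b) : HasCkBound s b fun _ : Y => c := by
  refine ⟨contDiff_const, fun i _ y => ?_⟩
  rcases eq_or_ne i 0 with rfl | hi
  · simpa using hc
  · rw [iteratedFDeriv_const_of_ne hi]
    simpa using (norm_nonneg _).trans hc

theorem add (hf : HasCkBound s b f) (hg : HasCkBound s b' g) :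
    HasCkBound s (b + b') fun y => f y + g y := by
  refine ⟨hf.1.add hg.1, fun i hi y => ?_⟩
  have h : (i : WithTop ℕ∞) ≤ s := by exact_mod_cast hi
  rw [fun_iteratedFDeriv_add_apply (hf.1.of_le h).contDiffAt (hg.1.of_le h).contDiffAt]
  exact (norm_add_le _ _).trans (add_le_add (hf.2 i hi y) (hg.2 i hi y))

theorem clm_comp (L : E →L[ℝ] F) (hL : ‖L‖ ≤ 1) (hf : HasCkBound s b f) :
    HasCkBound s b fun y => L (f y) := by
  refine ⟨L.contDiff.comp hf.1, fun i hi y => ?_⟩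
  have h : (i : WithTop ℕ∞) ≤ s := by exact_mod_cast hi
  exact (L.norm_iteratedFDeriv_comp_left hf.1.contDiffAt h).trans
    ((mul_le_mul hL (hf.2 i hi y) (norm_nonneg _) zero_le_one).trans (one_mul b).le)

/-- Leibniz rule; the binomial coefficients of order `i ≤ s` add up to `2 ^ i ≤ 2 ^ s`. -/
theorem bilin (B : E →L[ℝ] F →L[ℝ] G) (hB : ‖B‖ ≤ 1) {g : Y → F} (hf : HasCkBound s b f)
    (hg : HasCkBound s b' g) : HasCkBound s (2 ^ s * b * b') fun y => B (f y) (g y) := by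
  refine ⟨(B.contDiff.comp hf.1).clm_apply hg.1, fun i hi y => ?_⟩
  have h : (i : WithTop ℕ∞) ≤ s := by exact_mod_cast hi
  have hb := hf.nonneg
  have hb' := hg.nonneg
  refine (B.norm_iteratedFDeriv_le_of_bilinear_of_le_one hf.1 hg.1 y h hB).trans ?_
  calc _ ≤ ∑ j ∈ Finset.range (i + 1), (i.choose j : ℝ) * b * b' := by
        refine Finset.sum_le_sum fun j hj => ?_
        rw [Finset.mem_range] at hj
        gcongr
        · exact hf.2 j (by omega) y
        · exact hg.2 (i - j) (by omega) y
    _ = 2 ^ i * b * b' := by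
        rw [← Finset.sum_mul, ← Finset.sum_mul]
        congr 2
        exact_mod_cast Nat.sum_range_choose i
    _ ≤ 2 ^ s * b * b' := by
        gcongr
        norm_num

theorem comp_add_right (hf : HasCkBound s b f) (a : Y) : HasCkBound s b fun y => f (y + a) :=
  ⟨hf.1.comp (contDiff_id.add contDiff_const), fun i hi y => by
    rw [iteratedFDeriv_comp_add_right]; exact hf.2 i hi _⟩

theorem clm_clm_comp {A : Y → F →L[ℝ] G} {T : Y → E →L[ℝ] F} (hA : HasCkBound s b A)
    (hT : HasCkBound s b' T) : HasCkBound s (2 ^ s * b * b') fun y => (A y).comp (T y) :=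
  hA.bilin (ContinuousLinearMap.compL ℝ E F G) (ContinuousLinearMap.norm_compL_le ℝ E F G) hT

end HasCkBound

theorem norm_iteratedFDeriv_fderiv_sub (i : ℕ) (g g₀ : Z → E) (p p₀ : Z) :
    ‖iteratedFDeriv ℝ i (fderiv ℝ g) p - iteratedFDeriv ℝ i (fderiv ℝ g₀) p₀‖ =
      ‖iteratedFDeriv ℝ (i + 1) g p - iteratedFDeriv ℝ (i + 1) g₀ p₀‖ := by
  rw [iteratedFDeriv_succ_eq_comp_right, iteratedFDeriv_succ_eq_comp_right, Function.comp_apply,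
    Function.comp_apply, ← dist_eq_norm, ← dist_eq_norm]
  exact ((continuousMultilinearCurryRightEquiv' ℝ i Z E).symm.dist_map _ _).symm

theorem fderiv_comp_eq {g : Z → E} {γ : Y → Z} (hγ : Differentiable ℝ γ)
    (hg : ∀ y, DifferentiableAt ℝ g (γ y)) :
    fderiv ℝ (fun y => g (γ y)) = fun y => (fderiv ℝ g (γ y)).comp (fderiv ℝ γ y) := by
  funext y
  exact fderiv_comp y (hg y) (hγ y)

/-- Composition with a map whose derivatives are bounded along a curve. -/
theorem exists_hasCkBound_comp (s : ℕ) {B : ℝ} (hB : 0 ≤ B) : ∃ K : ℝ, 0 ≤ K ∧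
    ∀ (Y Z E : Type u)
    [NormedAddCommGroup Y] [NormedSpace ℝ Y] [NormedAddCommGroup Z] [NormedSpace ℝ Z]
    [NormedAddCommGroup E] [NormedSpace ℝ E] (g : Z → E) (γ : Y → Z) (e : ℝ),
    (∀ y, ContDiffAt ℝ s g (γ y)) → (∀ i ≤ s, ∀ y, ‖iteratedFDeriv ℝ i g (γ y)‖ ≤ e) →
    ContDiff ℝ s γ → (∀ i < s, ∀ y, ‖iteratedFDeriv ℝ i (fderiv ℝ γ) y‖ ≤ B) →
    HasCkBound s (K * e) fun y => g (γ y) := by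
  -- By the chain rule the derivative is `(Dg ∘ γ) Dγ`, and the induction hypothesis applies to
  -- `Dg`. Only `Dγ` is assumed bounded: the curves used later are graphs `(x y, y + a)`, which are
  -- themselves unbounded.
  induction s with
  | zero =>
    refine ⟨1, zero_le_one, fun Y Z E _ _ _ _ _ _ g γ e hg hge hγ _ => ?_⟩
    rw [HasCkBound.zero_iff, one_mul]
    exact ⟨continuous_iff_continuousAt.2 fun y =>
      (hg y).continuousAt.comp hγ.continuous.continuousAt, fun y => by simpa using hge 0 le_rfl y⟩
  | succ s ih =>
    obtain ⟨K, hK, ih⟩ := ih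
    refine ⟨2 ^ s * K * B + 1, by positivity, fun Y Z E _ _ _ _ _ _ g γ e hg hge hγ hγB => ?_⟩
    have he : 0 ≤ e := (norm_nonneg _).trans (hge 0 (Nat.zero_le _) 0)
    have hγ1 : Differentiable ℝ γ := hγ.differentiable (by simp)
    have hg1 : ∀ y, DifferentiableAt ℝ g (γ y) := fun y => (hg y).differentiableAt (by simp)
    have h1 := ih Y Z (Z →L[ℝ] E) (fderiv ℝ g) γ e
      (fun y => (hg y).fderiv_right (by norm_cast))
      (fun i hi y => by rw [norm_iteratedFDeriv_fderiv]; exact hge (i + 1) (by omega) y)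
      (hγ.of_le (by norm_cast; omega)) (fun i hi y => hγB i (by omega) y)
    have h2 : HasCkBound s B (fderiv ℝ γ) :=
      ⟨hγ.fderiv_right (by norm_cast), fun i hi y => hγB i (by omega) y⟩
    rw [HasCkBound.succ_iff]
    refine ⟨fun y => (hg1 y).comp y (hγ1 y), fun y => ?_, ?_⟩
    · have := hge 0 (Nat.zero_le _) y
      rw [norm_iteratedFDeriv_zero] at this
      exact this.trans (le_mul_of_one_le_left he (le_add_of_nonneg_left (by positivity)))
    · rw [fderiv_comp_eq hγ1 hg1]
      exact (h1.clm_clm_comp h2).mono (by nlinarith)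

/-- Lipschitz type estimate for compositions. -/
theorem exists_hasCkBound_comp_sub (s : ℕ) {B : ℝ} (hB : 0 ≤ B) : ∃ K : ℝ, 0 ≤ K ∧
    ∀ (Y Z E : Type u)
    [NormedAddCommGroup Y] [NormedSpace ℝ Y] [NormedAddCommGroup Z] [NormedSpace ℝ Z]
    [NormedAddCommGroup E] [NormedSpace ℝ E] (g g₀ : Z → E) (γ γ₀ : Y → Z) (e : ℝ),
    (∀ y, ContDiffAt ℝ s g (γ y)) → (∀ y, ContDiffAt ℝ s g₀ (γ₀ y)) →
    (∀ i ≤ s, ∀ y, ‖iteratedFDeriv ℝ i g (γ y) - iteratedFDeriv ℝ i g₀ (γ₀ y)‖ ≤ e) →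
    (∀ i ≤ s, ∀ y, ‖iteratedFDeriv ℝ i g₀ (γ₀ y)‖ ≤ B) →
    ContDiff ℝ s γ → (∀ i < s, ∀ y, ‖iteratedFDeriv ℝ i (fderiv ℝ γ) y‖ ≤ B) →
    ContDiff ℝ s γ₀ → (∀ i < s, ∀ y, ‖iteratedFDeriv ℝ i (fderiv ℝ γ₀) y‖ ≤ B) →
    (∀ i < s, ∀ y, ‖iteratedFDeriv ℝ i (fun y => fderiv ℝ γ y - fderiv ℝ γ₀ y) y‖ ≤ e) →
    HasCkBound s (K * e) fun y => g (γ y) - g₀ (γ₀ y) := by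
  induction s with
  | zero =>
    refine ⟨1, zero_le_one, fun Y Z E _ _ _ _ _ _ g g₀ γ γ₀ e hg hg₀ hge _ hγ _ hγ₀ _ _ => ?_⟩
    rw [HasCkBound.zero_iff, one_mul]
    refine ⟨continuous_iff_continuousAt.2 fun y =>
      ((hg y).continuousAt.comp hγ.continuous.continuousAt).sub
        ((hg₀ y).continuousAt.comp hγ₀.continuous.continuousAt), fun y => ?_⟩
    have := hge 0 le_rfl y
    rw [iteratedFDeriv_zero_eq_comp, iteratedFDeriv_zero_eq_comp, Function.comp_apply,
      Function.comp_apply, ← dist_eq_norm, LinearIsometryEquiv.dist_map] at this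
    rwa [← dist_eq_norm]
  | succ s ih =>
    obtain ⟨K, hK, ih⟩ := ih
    obtain ⟨K', hK', hc⟩ := exists_hasCkBound_comp.{u} s hB
    refine ⟨2 ^ s * K * B + 2 ^ s * K' * B + 1, by positivity,
      fun Y Z E _ _ _ _ _ _ g g₀ γ γ₀ e hg hg₀ hge hgB hγ hγB hγ₀ hγB₀ hγe => ?_⟩
    have he : 0 ≤ e := (norm_nonneg _).trans (hge 0 (Nat.zero_le _) 0)
    have hγ1 : Differentiable ℝ γ := hγ.differentiable (by simp)
    have hγ1' : Differentiable ℝ γ₀ := hγ₀.differentiable (by simp)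
    have hg1 : ∀ y, DifferentiableAt ℝ g (γ y) := fun y => (hg y).differentiableAt (by simp)
    have hg1' : ∀ y, DifferentiableAt ℝ g₀ (γ₀ y) := fun y =>
      (hg₀ y).differentiableAt (by simp)
    have h1 := ih Y Z (Z →L[ℝ] E) (fderiv ℝ g) (fderiv ℝ g₀) γ γ₀ e
      (fun y => (hg y).fderiv_right (by norm_cast)) (fun y => (hg₀ y).fderiv_right (by norm_cast))
      (fun i hi y => by rw [norm_iteratedFDeriv_fderiv_sub]; exact hge (i + 1) (by omega) y)
      (fun i hi y => by rw [norm_iteratedFDeriv_fderiv]; exact hgB (i + 1) (by omega) y)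
      (hγ.of_le (by norm_cast; omega)) (fun i hi y => hγB i (by omega) y)
      (hγ₀.of_le (by norm_cast; omega)) (fun i hi y => hγB₀ i (by omega) y)
      (fun i hi y => hγe i (by omega) y)
    have h0 := hc Y Z (Z →L[ℝ] E) (fderiv ℝ g₀) γ₀ B
      (fun y => (hg₀ y).fderiv_right (by norm_cast))
      (fun i hi y => by rw [norm_iteratedFDeriv_fderiv]; exact hgB (i + 1) (by omega) y)
      (hγ₀.of_le (by norm_cast; omega)) (fun i hi y => hγB₀ i (by omega) y)
    have h2 : HasCkBound s B (fderiv ℝ γ) :=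
      ⟨hγ.fderiv_right (by norm_cast), fun i hi y => hγB i (by omega) y⟩
    have h3 : HasCkBound s e (fun y => fderiv ℝ γ y - fderiv ℝ γ₀ y) :=
      ⟨(hγ.fderiv_right (by norm_cast)).sub (hγ₀.fderiv_right (by norm_cast)),
        fun i hi y => hγe i (by omega) y⟩
    rw [HasCkBound.succ_iff]
    have hd : Differentiable ℝ fun y => g (γ y) := fun y => (hg1 y).comp y (hγ1 y)
    have hd' : Differentiable ℝ fun y => g₀ (γ₀ y) := fun y => (hg1' y).comp y (hγ1' y)
    refine ⟨hd.sub hd', fun y => ?_, ?_⟩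
    · have := hge 0 (Nat.zero_le _) y
      rw [iteratedFDeriv_zero_eq_comp, iteratedFDeriv_zero_eq_comp, Function.comp_apply,
        Function.comp_apply, ← dist_eq_norm, LinearIsometryEquiv.dist_map, dist_eq_norm] at this
      exact this.trans (le_mul_of_one_le_left he (le_add_of_nonneg_left (by positivity)))
    · have h4 := (h1.clm_clm_comp h2).add (h0.clm_clm_comp h3)
      -- The usual splitting of a difference of products, in which each summand carries exactly one
      -- factor of size `e`.
      have h5 : fderiv ℝ (fun y => g (γ y) - g₀ (γ₀ y)) = fun y =>
          (fderiv ℝ g (γ y) - fderiv ℝ g₀ (γ₀ y)).comp (fderiv ℝ γ y) +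
            (fderiv ℝ g₀ (γ₀ y)).comp (fderiv ℝ γ y - fderiv ℝ γ₀ y) := by
        funext y
        rw [fderiv_fun_sub (hd y) (hd' y), fderiv_comp_eq hγ1 hg1, fderiv_comp_eq hγ1' hg1',
          ContinuousLinearMap.sub_comp, ContinuousLinearMap.comp_sub]
        abel
      rw [h5]
      exact h4.mono (by nlinarith)

end CkBound

/-! ### Smooth dependence of bounded solutions on parameters -/

section LinearRegularity

universe u

/-- Exchange of the two arguments of a bilinear map. -/
noncomputable def flipCLM (Y E F : Type*) [NormedAddCommGroup Y] [NormedSpace ℝ Y]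
    [NormedAddCommGroup E] [NormedSpace ℝ E] [NormedAddCommGroup F] [NormedSpace ℝ F] :
    (Y →L[ℝ] E →L[ℝ] F) →L[ℝ] (E →L[ℝ] Y →L[ℝ] F) :=
  (ContinuousLinearMap.flipₗᵢ ℝ Y E F).toLinearIsometry.toContinuousLinearMap

set_option maxSynthPendingDepth 2 in
theorem norm_flipCLM_le (Y E F : Type*) [NormedAddCommGroup Y] [NormedSpace ℝ Y]
    [NormedAddCommGroup E] [NormedSpace ℝ E] [NormedAddCommGroup F] [NormedSpace ℝ F] :
    ‖flipCLM Y E F‖ ≤ 1 :=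
  ContinuousLinearMap.opNorm_le_bound _ zero_le_one fun S => by
    rw [one_mul]; exact (ContinuousLinearMap.opNorm_flip S).le

set_option maxSynthPendingDepth 2 in
theorem HasCkBound.flip_clm_apply {Y E F : Type u} [NormedAddCommGroup Y] [NormedSpace ℝ Y]
    [NormedAddCommGroup E] [NormedSpace ℝ E] [NormedAddCommGroup F] [NormedSpace ℝ F] {s : ℕ}
    {b b' : ℝ} {S : Y → Y →L[ℝ] E →L[ℝ] F} {a : Y → E} (hS : HasCkBound s b S)
    (ha : HasCkBound s b' a) : HasCkBound s (2 ^ s * b * b') fun y => (S y).flip (a y) :=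
  hS.bilin (flipCLM Y E F) (norm_flipCLM_le Y E F) ha

theorem isBigO_clm_apply {α E F : Type*} [NormedAddCommGroup E] [NormedSpace ℝ E]
    [NormedAddCommGroup F] [NormedSpace ℝ F] (l : Filter α) (S : α → E →L[ℝ] F) (a : α → E) :
    (fun x => S x (a x)) =O[l] fun x => ‖S x‖ * ‖a x‖ :=
  Asymptotics.isBigO_of_le _ fun x => by
    rw [norm_mul, norm_norm, norm_norm]
    exact (S x).le_opNorm (a x)

theorem isLittleO_clm_apply_of_left {α E F G : Type*} [NormedAddCommGroup E] [NormedSpace ℝ E]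
    [NormedAddCommGroup F] [NormedSpace ℝ F] [NormedAddCommGroup G] {l : Filter α}
    {S : α → E →L[ℝ] F} {a : α → E} {k : α → G} (hS : S =o[l] k)
    (ha : a =O[l] fun _ => (1 : ℝ)) : (fun x => S x (a x)) =o[l] k := by
  have h := hS.norm_norm.mul_isBigO ha.norm_left
  simp only [mul_one] at h
  exact (isBigO_clm_apply l S a).trans_isLittleO h.of_norm_right

theorem isLittleO_clm_apply_of_right {α E F G : Type*} [NormedAddCommGroup E] [NormedSpace ℝ E]
    [NormedAddCommGroup F] [NormedSpace ℝ F] [NormedAddCommGroup G] {l : Filter α}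
    {S : α → E →L[ℝ] F} {a : α → E} {k : α → G} (hS : S =O[l] k)
    (ha : a =o[l] fun _ => (1 : ℝ)) : (fun x => S x (a x)) =o[l] k := by
  have h := hS.norm_norm.mul_isLittleO ha.norm_left
  simp only [mul_one] at h
  exact (isBigO_clm_apply l S a).trans_isLittleO h.of_norm_right

set_option maxSynthPendingDepth 2 in
theorem HasCkBound.postcompL {Y E : Type u} (V : Type u) [NormedAddCommGroup Y] [NormedSpace ℝ Y]
    [NormedAddCommGroup E] [NormedSpace ℝ E] [NormedAddCommGroup V] [NormedSpace ℝ V] {s : ℕ}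
    {b : ℝ} {A : Y → E →L[ℝ] E} (hA : HasCkBound s b A) :
    HasCkBound s b fun y => postcompL V E (A y) :=
  hA.clm_comp (_root_.postcompL V E) (ContinuousLinearMap.norm_compL_le ℝ V E E)

theorem HasCkBound.norm_sub_le {Y E : Type u} [NormedAddCommGroup Y] [NormedSpace ℝ Y]
    [NormedAddCommGroup E] [NormedSpace ℝ E] {s : ℕ} {b : ℝ} {f : Y → E}
    (h : HasCkBound (s + 1) b f) (y y' : Y) : ‖f y' - f y‖ ≤ b * ‖y' - y‖ := by
  obtain ⟨h1, -, h2⟩ := HasCkBound.succ_iff.1 h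
  exact convex_univ.norm_image_sub_le_of_norm_fderiv_le (fun x _ => h1 x)
    (fun x _ => h2.norm_le x) (mem_univ y) (mem_univ y')

/-- A bounded solution of the linearized equation is the derivative of a family of bounded
solutions. -/
theorem hasFDerivAt_of_green {Y E : Type*} [NormedAddCommGroup Y] [NormedSpace ℝ Y]
    [NormedAddCommGroup E] [NormedSpace ℝ E] [CompleteSpace E]
    {A : ℤ → E →L[ℝ] E} {H : ℤ → ℤ → E →L[ℝ] E} {C ν : ℝ} (h : IsGreen A H C ν)
    {x : ℤ → Y → E} {b ξ : ℤ → Y →L[ℝ] E} {B B' c : ℝ} {y : Y}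
    (hξ : ∀ k, ‖ξ k‖ ≤ B) (hξs : ∀ k, ξ (k + 1) = (A k).comp (ξ k) + b k)
    (hx : ∀ k y', ‖x k y' - x k y‖ ≤ B')
    (hR : ∀ᶠ y' in 𝓝 y, ∀ k,
      ‖x (k + 1) y' - x (k + 1) y - A k (x k y' - x k y) - b k (y' - y)‖ ≤ c * ‖y' - y‖)
    (ho : ∀ k, (fun y' => x (k + 1) y' - x (k + 1) y - A k (x k y' - x k y) - b k (y' - y))
      =o[𝓝 y] fun y' => y' - y) (k : ℤ) : HasFDerivAt (x k) (ξ k) y := by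
  set R : ℤ → Y → E := fun k y' =>
    x (k + 1) y' - x (k + 1) y - A k (x k y' - x k y) - b k (y' - y)
  -- The normalized Taylor remainders of `x` solve the linear equation up to `‖y' - y‖⁻¹ ‖R k y'‖`.
  -- These defects vanish in the limit for each `k` and are bounded by `|c|` uniformly in `k`.
  have key := tendsto_zero_of_green (f := 𝓝 y) (C := C) (ν := ν) (δ := 0) (R := |c|) le_rfl
    (by simp) (u := fun k y' => ‖y' - y‖⁻¹ • (x k y' - x k y - ξ k (y' - y)))
    (η := fun k y' => ‖y' - y‖⁻¹ * ‖R k y'‖) ?_ (fun k => ?_) k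
  · rw [hasFDerivAt_iff_tendsto]
    simpa [norm_smul] using key.norm
  · filter_upwards [hR] with y' hy'
    refine ⟨A, H, h, ⟨‖y' - y‖⁻¹ * (B' + B * ‖y' - y‖), fun k => ?_⟩, fun k => ⟨?_, ?_⟩⟩
    · rw [norm_smul, norm_inv, norm_norm]
      gcongr
      exact (norm_sub_le _ _).trans (add_le_add (hx k y') ((ξ k).le_of_opNorm_le (hξ k) _))
    · rw [map_smul, ← smul_sub, norm_smul, norm_inv, norm_norm, zero_mul, zero_add]
      refine le_of_eq ?_
      congr 2
      simp only [R, hξs, map_sub, add_apply, ContinuousLinearMap.comp_apply]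
      abel
    · rcases eq_or_ne y' y with rfl | hne
      · simp
      · rw [inv_mul_le_iff₀ (norm_pos_iff.2 (sub_ne_zero.2 hne)), mul_comm]
        exact (hy' k).trans (by gcongr; exact le_abs_self c)
  · have h1 := (Asymptotics.isLittleO_iff_tendsto' (Eventually.of_forall fun y' hy' => by
      have : y' = y := sub_eq_zero.1 (norm_eq_zero.1 hy')
      subst this
      simp)).1 (ho k).norm_norm
    simpa only [div_eq_inv_mul] using h1

/-- Smooth dependence on parameters for bounded solutions of linear difference equations. -/
theorem exists_hasCkBound_of_linear (s : ℕ) {B : ℝ} (hB : 0 ≤ B) (C ν : ℝ) : ∃ K : ℝ, 0 ≤ K ∧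
    ∀ (Y E : Type u) [NormedAddCommGroup Y] [NormedSpace ℝ Y]
    [NormedAddCommGroup E] [NormedSpace ℝ E] [CompleteSpace E]
    (A : ℤ → Y → E →L[ℝ] E) (H : Y → ℤ → ℤ → E →L[ℝ] E) (g w : ℤ → Y → E) (e : ℝ),
    (∀ y, IsGreen (fun k => A k y) (H y) C ν) → (∀ k, HasCkBound s B (A k)) →
    (∀ k, HasCkBound s e (g k)) → (∀ y, ∃ b, ∀ k, ‖w k y‖ ≤ b) →
    (∀ k y, w (k + 1) y = A k y (w k y) + g k y) → ∀ k, HasCkBound s (K * e) (w k) := by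
  induction s with
  | zero =>
    -- The absolute value is needed since `C` and `ν` are arbitrary reals until a kernel is given.
    refine ⟨|2 * (C * greenSum ν)|, abs_nonneg _,
      fun Y E _ _ _ _ _ A H g w e hG hA hg hw hs k => ?_⟩
    have he := (hg 0).nonneg
    have hb : ∀ k y, ‖w k y‖ ≤ |2 * (C * greenSum ν)| * e := fun k y => by
      obtain ⟨b, hb⟩ := hw y
      refine ((hG y).norm_le_of_approx le_rfl (by simp) he (u := fun k => w k y) hb
        (fun k => ?_) k).trans (by gcongr; exact le_abs_self _)
      rw [hs, add_sub_cancel_left, zero_mul, zero_add]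
      exact (hg k).norm_le y
    refine HasCkBound.zero_iff.2 ⟨continuous_iff_continuousAt.2 fun y => ?_, hb k⟩
    set W := |2 * (C * greenSum ν)| * e
    have hW : 0 ≤ W := (norm_nonneg _).trans (hb 0 y)
    -- Continuity: the increment of `w` solves the equation frozen at `y`, with defect coming from
    -- the increments of `A` and `g`. These need to be small only for each fixed `k`.
    have h1 := tendsto_zero_of_green (f := 𝓝 y) (C := C) (ν := ν) (δ := 0)
      (R := (B + B) * W + (e + e)) le_rfl (by simp) (u := fun k y' => w k y' - w k y)
      (η := fun k y' => ‖A k y' - A k y‖ * W + ‖g k y' - g k y‖)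
      (Eventually.of_forall fun y' => ⟨fun k => A k y, H y, hG y, ⟨W + W, fun k =>
        (norm_sub_le _ _).trans (add_le_add (hb k y') (hb k y))⟩, fun k => ⟨?_, ?_⟩⟩)
      (fun k => ?_) k
    · exact tendsto_iff_norm_sub_tendsto_zero.2 (by simpa using h1.norm)
    · have : w (k + 1) y' - w (k + 1) y - A k y (w k y' - w k y) =
          (A k y' - A k y) (w k y') + (g k y' - g k y) := by
        simp only [hs, map_sub, sub_apply]; abel
      rw [this, zero_mul, zero_add]
      refine (norm_add_le _ _).trans (add_le_add_left ?_ _)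
      exact (ContinuousLinearMap.le_opNorm _ _).trans (by gcongr; exact hb k y')
    · gcongr
      · exact (norm_sub_le _ _).trans (add_le_add ((hA k).norm_le y') ((hA k).norm_le y))
      · exact (norm_sub_le _ _).trans (add_le_add ((hg k).norm_le y') ((hg k).norm_le y))
    · have h2 := (tendsto_iff_norm_sub_tendsto_zero.1
        ((hA k).1.continuous.tendsto y)).mul_const W
      have h3 := tendsto_iff_norm_sub_tendsto_zero.1 ((hg k).1.continuous.tendsto y)
      simpa using h2.add h3
  | succ s ih =>
    obtain ⟨K, hK, ih⟩ := ih
    refine ⟨K + K * (2 ^ s * B * K + 1), by positivity,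
      fun Y E _ _ _ _ _ A H g w e hG hA hg hw hs k => ?_⟩
    have he := (hg 0).nonneg
    have hwK := ih Y E A H g w e hG (fun k => (hA k).of_le (Nat.le_succ s))
      (fun k => (hg k).of_le (Nat.le_succ s)) hw hs
    have hA' := fun k => (HasCkBound.succ_iff.1 (hA k))
    have hg' := fun k => (HasCkBound.succ_iff.1 (hg k))
    set b : ℤ → Y → Y →L[ℝ] E := fun k y => (fderiv ℝ (A k) y).flip (w k y) + fderiv ℝ (g k) y
    have hb : ∀ k, HasCkBound s ((2 ^ s * B * K + 1) * e) (b k) := fun k =>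
      (((hA' k).2.2.flip_clm_apply (hwK k)).add (hg' k).2.2).mono (by linarith)
    -- Candidate for the derivative of `w`: the bounded solution of the formally differentiated
    -- equation, whose source `b` contains `w` undifferentiated. So `C^s` bounds on `w` give `C^s`
    -- bounds on `ξ`.
    set ξ : ℤ → Y → Y →L[ℝ] E := fun k y => ∑' l, postcompL Y E (H y k l) (b l y)
    have hξb : ∀ y k, ‖ξ k y‖ ≤ C * greenSum ν * ((2 ^ s * B * K + 1) * e) := fun y k =>
      ((hG y).postcomp Y).norm_tsum_apply_le k fun l => (hb l).norm_le y
    have hξs : ∀ k y, ξ (k + 1) y = postcompL Y E (A k y) (ξ k y) + b k y := fun k y =>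
      ((hG y).postcomp Y).tsum_solves (fun l => (hb l).norm_le y) k
    have hξK := ih Y (Y →L[ℝ] E) (fun k y => postcompL Y E (A k y))
      (fun y k l => postcompL Y E (H y k l)) b ξ _ (fun y => (hG y).postcomp Y)
      (fun k => ((hA k).of_le (Nat.le_succ s)).postcompL Y) hb (fun y => ⟨_, hξb y⟩) hξs
    have hder : ∀ k y, HasFDerivAt (w k) (ξ k y) y := by
      intro k y
      have hrem : ∀ k y', w (k + 1) y' - w (k + 1) y - A k y (w k y' - w k y) - b k y (y' - y) =
          (A k y' - A k y - fderiv ℝ (A k) y (y' - y)) (w k y') +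
          fderiv ℝ (A k) y (y' - y) (w k y' - w k y) +
          (g k y' - g k y - fderiv ℝ (g k) y (y' - y)) := by
        intro k y'
        simp only [b, hs, map_sub, add_apply, sub_apply, ContinuousLinearMap.flip_apply]
        abel
      have hAo : ∀ k, (fun y' => A k y' - A k y - fderiv ℝ (A k) y (y' - y)) =o[𝓝 y]
          fun y' => y' - y := fun k => ((hA' k).1 y).hasFDerivAt.isLittleO
      have hgo : ∀ k, (fun y' => g k y' - g k y - fderiv ℝ (g k) y (y' - y)) =o[𝓝 y]
          fun y' => y' - y := fun k => ((hg' k).1 y).hasFDerivAt.isLittleO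
      have hA1 : ∀ k y', ‖fderiv ℝ (A k) y (y' - y)‖ ≤ B * ‖y' - y‖ := fun k y' =>
        ContinuousLinearMap.le_of_opNorm_le _ ((hA' k).2.2.norm_le y) _
      have hg1 : ∀ k y', ‖fderiv ℝ (g k) y (y' - y)‖ ≤ e * ‖y' - y‖ := fun k y' =>
        ContinuousLinearMap.le_of_opNorm_le _ ((hg' k).2.2.norm_le y) _
      refine hasFDerivAt_of_green (hG y) (x := w) (y := y) (b := fun k => b k y) (B' := K * e + K * e)
        (c := (B + B) * (K * e) + B * (K * e + K * e) + (e + e)) (hξb y)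
        (fun k => hξs k y)
        (fun k y' => (norm_sub_le _ _).trans (add_le_add ((hwK k).norm_le _) ((hwK k).norm_le _)))
        (Eventually.of_forall fun y' k => ?_) (fun k => ?_) k
      · rw [hrem]
        have e1 : ‖(A k y' - A k y - fderiv ℝ (A k) y (y' - y)) (w k y')‖ ≤
            ((B + B) * ‖y' - y‖) * (K * e) := by
          refine (ContinuousLinearMap.le_opNorm _ _).trans
            (mul_le_mul ?_ ((hwK k).norm_le y') (norm_nonneg _) (by positivity))
          rw [add_mul]
          exact (norm_sub_le _ _).trans (add_le_add ((hA k).norm_sub_le y y') (hA1 k y'))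
        have e2 : ‖fderiv ℝ (A k) y (y' - y) (w k y' - w k y)‖ ≤
            (B * ‖y' - y‖) * (K * e + K * e) :=
          (ContinuousLinearMap.le_opNorm _ _).trans (mul_le_mul (hA1 k y')
            ((norm_sub_le _ _).trans (add_le_add ((hwK k).norm_le _) ((hwK k).norm_le _)))
            (norm_nonneg _) (by positivity))
        have e3 : ‖g k y' - g k y - fderiv ℝ (g k) y (y' - y)‖ ≤ (e + e) * ‖y' - y‖ := by
          rw [add_mul]
          exact (norm_sub_le _ _).trans (add_le_add ((hg k).norm_sub_le y y') (hg1 k y'))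
        refine (norm_add₃_le).trans ?_
        linarith
      · simp only [hrem]
        refine (Asymptotics.IsLittleO.add ?_ ?_).add (hgo k)
        · have h1 : (fun y' => w k y') =O[𝓝 y] fun _ => (1 : ℝ) :=
            Asymptotics.isBigO_of_le' (c := K * e) _ fun y' => by simpa using (hwK k).norm_le y'
          exact isLittleO_clm_apply_of_left (hAo k) h1
        · have h1 : (fun y' => w k y' - w k y) =o[𝓝 y] fun _ => (1 : ℝ) := by
            rw [Asymptotics.isLittleO_one_iff, tendsto_sub_nhds_zero_iff]
            exact (hwK k).1.continuous.tendsto y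
          have h2 : (fun y' => fderiv ℝ (A k) y (y' - y)) =O[𝓝 y] fun y' => y' - y :=
            Asymptotics.isBigO_of_le' _ (hA1 k)
          exact isLittleO_clm_apply_of_right h2 h1
    rw [HasCkBound.succ_iff]
    have hle : K * e ≤ (K + K * (2 ^ s * B * K + 1)) * e := by
      gcongr
      exact le_add_of_nonneg_right (by positivity)
    refine ⟨fun y => (hder k y).differentiableAt, fun y => ((hwK k).norm_le y).trans hle, ?_⟩
    rw [show fderiv ℝ (w k) = ξ k from funext fun y => (hder k y).fderiv]
    refine (hξK k).mono ?_
    have : 0 ≤ K * e := by positivity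
    linarith

end LinearRegularity

/-! ### Smooth dependence on parameters for nonlinear difference equations -/

section NonlinearRegularity

universe u

variable {X Y : Type u} [NormedAddCommGroup X] [NormedSpace ℝ X] [NormedAddCommGroup Y]
  [NormedSpace ℝ Y]

theorem fderiv_graph {x : Y → X} (hx : Differentiable ℝ x) (a : Y) :
    fderiv ℝ (fun y => (x y, y + a)) = fun y =>
      (ContinuousLinearMap.inl ℝ X Y).comp (fderiv ℝ x y) + ContinuousLinearMap.inr ℝ X Y := by
  funext y
  have h := (hx y).hasFDerivAt.prodMk ((hasFDerivAt_id y).add_const a)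
  refine h.fderiv.trans (ContinuousLinearMap.ext fun v => ?_)
  simp

theorem norm_inl_le : ‖ContinuousLinearMap.inl ℝ X Y‖ ≤ 1 :=
  ContinuousLinearMap.opNorm_le_bound _ zero_le_one fun v => by simp

theorem norm_inr_le : ‖ContinuousLinearMap.inr ℝ X Y‖ ≤ 1 :=
  ContinuousLinearMap.opNorm_le_bound _ zero_le_one fun v => by simp

namespace HasCkBound

variable {s : ℕ} {b : ℝ}

theorem inl_comp {W : Type u} [NormedAddCommGroup W] [NormedSpace ℝ W] {T : Y → W →L[ℝ] X}
    (hT : HasCkBound s b T) :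
    HasCkBound s b fun y => (ContinuousLinearMap.inl ℝ X Y).comp (T y) :=
  hT.clm_comp (ContinuousLinearMap.compL ℝ W X (X × Y) (ContinuousLinearMap.inl ℝ X Y))
    ((ContinuousLinearMap.le_of_opNorm_le _ (ContinuousLinearMap.norm_compL_le ℝ W X (X × Y))
      _).trans (by simpa using norm_inl_le))

theorem comp_inl {W : Type u} [NormedAddCommGroup W] [NormedSpace ℝ W] {T : Y → X × Y →L[ℝ] W}
    (hT : HasCkBound s b T) :
    HasCkBound s b fun y => (T y).comp (ContinuousLinearMap.inl ℝ X Y) := by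
  refine hT.clm_comp ((ContinuousLinearMap.compL ℝ X (X × Y) W).flip
    (ContinuousLinearMap.inl ℝ X Y)) ?_
  refine ContinuousLinearMap.opNorm_le_bound _ zero_le_one fun S => ?_
  rw [one_mul]
  exact (ContinuousLinearMap.opNorm_comp_le _ _).trans
    (mul_le_of_le_one_right (norm_nonneg _) norm_inl_le)

theorem fderiv_graph {x : Y → X} (hx : HasCkBound (s + 1) b x) (a : Y) :
    HasCkBound s (b + 1) (fderiv ℝ fun y => (x y, y + a)) := by
  obtain ⟨h1, -, h2⟩ := succ_iff.1 hx
  rw [_root_.fderiv_graph h1]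
  exact h2.inl_comp.add (HasCkBound.const s norm_inr_le)

theorem fderiv_graph_sub {x x₀ : Y → X} (hx : Differentiable ℝ x) (hx₀ : Differentiable ℝ x₀)
    (h : HasCkBound (s + 1) b fun y => x y - x₀ y) (a : Y) :
    HasCkBound s b fun y => fderiv ℝ (fun y => (x y, y + a)) y -
      fderiv ℝ (fun y => (x₀ y, y + a)) y := by
  obtain ⟨-, -, h2⟩ := succ_iff.1 h
  convert h2.inl_comp (Y := Y) using 2 with y
  rw [_root_.fderiv_graph hx, _root_.fderiv_graph hx₀, add_sub_add_right_eq_sub,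
    fderiv_fun_sub (hx y) (hx₀ y), ContinuousLinearMap.comp_sub]

end HasCkBound

/-- Differentiability in the parameter of bounded solutions of a nonlinear difference equation. -/
theorem hasFDerivAt_of_nonlinear [CompleteSpace X]
    {f : ℤ → X × Y → X} {x : ℤ → Y → X} {a : ℤ → Y} {H : ℤ → ℤ → X →L[ℝ] X} {C ν b L B : ℝ}
    {y : Y} (hs : ∀ k y, x (k + 1) y = f k (x k y, y + a k))
    (hf : ∀ k, DifferentiableAt ℝ (f k) (x k y, y + a k))
    (hb : ∀ k, ‖fderiv ℝ (f k) (x k y, y + a k)‖ ≤ b)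
    (hG : IsGreen (fun k => (fderiv ℝ (f k) (x k y, y + a k)).comp
      (ContinuousLinearMap.inl ℝ X Y)) H C ν)
    (hB : ∀ k y', ‖x k y' - x k y‖ ≤ B)
    (hL : ∀ᶠ y' in 𝓝 y, ∀ k, ‖x k y' - x k y‖ ≤ L * ‖y' - y‖) :
    (∀ k, DifferentiableAt ℝ (x k) y) ∧ ∀ k, ‖fderiv ℝ (x k) y‖ ≤ C * greenSum ν * b := by
  have hb0 : 0 ≤ b := (norm_nonneg _).trans (hb 0)
  have hbr : ∀ k, ‖(fderiv ℝ (f k) (x k y, y + a k)).comp (ContinuousLinearMap.inr ℝ X Y)‖ ≤ b :=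
    fun k => (ContinuousLinearMap.opNorm_comp_le _ _).trans
      ((mul_le_of_le_one_right (norm_nonneg _) norm_inr_le).trans (hb k))
  have hG' := hG.postcomp Y
  -- The defect of the linearized equation is exactly the first-order Taylor remainder of `f k`
  -- along the graph; the local Lipschitz bound on `x` makes it `o(‖y' - y‖)`.
  have hsplit : ∀ k y', x (k + 1) y' - x (k + 1) y -
      ((fderiv ℝ (f k) (x k y, y + a k)).comp (ContinuousLinearMap.inl ℝ X Y)) (x k y' - x k y) -
      ((fderiv ℝ (f k) (x k y, y + a k)).comp (ContinuousLinearMap.inr ℝ X Y)) (y' - y) =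
      f k (x k y', y' + a k) - f k (x k y, y + a k) - fderiv ℝ (f k) (x k y, y + a k)
        ((x k y', y' + a k) - (x k y, y + a k)) := by
    intro k y'
    rw [hs, hs, sub_sub _ (ContinuousLinearMap.comp _ _ _), ContinuousLinearMap.comp_apply,
      ContinuousLinearMap.comp_apply, ← map_add]
    simp
  have hder := hasFDerivAt_of_green hG
    (ξ := fun k => ∑' l, postcompL Y X (H k l) ((fderiv ℝ (f l) (x l y, y + a l)).comp
      (ContinuousLinearMap.inr ℝ X Y)))
    (fun k => hG'.norm_tsum_apply_le k hbr) (fun k => hG'.tsum_solves hbr k) hB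
    (c := L + b * (L + 1)) ?_ (fun k => ?_)
  · refine ⟨fun k => (hder k).differentiableAt, fun k => ?_⟩
    rw [(hder k).fderiv]
    exact hG'.norm_tsum_apply_le k hbr
  · filter_upwards [hL] with y' hy' k
    rw [hsplit, ← hs, ← hs]
    refine (norm_sub_le _ _).trans ?_
    rw [add_mul]
    refine add_le_add (hy' (k + 1)) ?_
    rw [mul_assoc]
    refine (ContinuousLinearMap.le_opNorm _ _).trans
      (mul_le_mul (hb k) ?_ (norm_nonneg _) hb0)
    have h1 := hy' k
    have h2 := norm_nonneg (x k y' - x k y)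
    have h3 := norm_nonneg (y' - y)
    rw [Prod.mk_sub_mk, add_sub_add_right_eq_sub, Prod.norm_mk]
    exact max_le (by linarith) (by linarith)
  · simp only [hsplit]
    have hO : (fun y' => (x k y', y' + a k) - (x k y, y + a k)) =O[𝓝 y] fun y' => y' - y := by
      refine Asymptotics.IsBigO.of_bound (|L| + 1) ?_
      filter_upwards [hL] with y' hy'
      have h1 := (hy' k).trans (mul_le_mul_of_nonneg_right (le_abs_self L) (norm_nonneg _))
      have h2 := norm_nonneg (x k y' - x k y)
      have h3 := norm_nonneg (y' - y)
      rw [Prod.mk_sub_mk, add_sub_add_right_eq_sub, Prod.norm_mk]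
      have h4 : 0 ≤ |L| * ‖y' - y‖ := by positivity
      exact max_le (by linarith) (by linarith)
    have ht : Tendsto (fun y' => (x k y', y' + a k)) (𝓝 y) (𝓝 (x k y, y + a k)) := by
      rw [← tendsto_sub_nhds_zero_iff]
      refine hO.trans_tendsto ?_
      rw [tendsto_sub_nhds_zero_iff]
      exact tendsto_id
    exact ((hf k).hasFDerivAt.isLittleO.comp_tendsto ht).trans_isBigO hO

/-- Smooth dependence on parameters for bounded solutions of nonlinear difference equations, in
the form of an estimate for the distance to a reference solution. -/
theorem exists_hasCkBound_of_nonlinear (r : ℕ) {B : ℝ} (hB : 0 ≤ B) (C ν : ℝ) :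
    ∃ K : ℝ, 0 ≤ K ∧ ∀ (X Y : Type u) [NormedAddCommGroup X] [NormedSpace ℝ X] [CompleteSpace X]
    [NormedAddCommGroup Y] [NormedSpace ℝ Y] (f f₀ : ℤ → X × Y → X) (x x₀ : ℤ → Y → X) (a : ℤ → Y)
    (H : Y → ℤ → ℤ → X →L[ℝ] X) (e : ℝ), e ≤ B →
    (∀ k y, x (k + 1) y = f k (x k y, y + a k)) →
    (∀ k y, x₀ (k + 1) y = f₀ k (x₀ k y, y + a k)) →
    (∀ k y, ContDiffAt ℝ r (f k) (x k y, y + a k)) →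
    (∀ k y, ContDiffAt ℝ r (f₀ k) (x₀ k y, y + a k)) →
    (∀ i ≤ r, ∀ k y, ‖iteratedFDeriv ℝ i (f k) (x k y, y + a k) -
      iteratedFDeriv ℝ i (f₀ k) (x₀ k y, y + a k)‖ ≤ e) →
    (∀ i ≤ r, ∀ k y, ‖iteratedFDeriv ℝ i (f₀ k) (x₀ k y, y + a k)‖ ≤ B) →
    (∀ k, HasCkBound r B (x₀ k)) → (∀ k y, ‖x k y - x₀ k y‖ ≤ e) →
    (∀ k, Continuous (x k)) → (1 ≤ r → ∀ k, Differentiable ℝ (x k)) →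
    (1 ≤ r → ∀ y, ∃ b, ∀ k, ‖fderiv ℝ (x k) y‖ ≤ b) →
    (1 ≤ r → ∀ y, IsGreen (fun k => (fderiv ℝ (f k) (x k y, y + a k)).comp
      (ContinuousLinearMap.inl ℝ X Y)) (H y) C ν) →
    ∀ k, HasCkBound r (K * e) fun y => x k y - x₀ k y := by
  induction r with
  | zero =>
    refine ⟨1, zero_le_one, fun X Y _ _ _ _ _ f f₀ x x₀ a H e _ _ _ _ _ _ _ hx₀ hxe hc _ _ _ k => ?_⟩
    rw [HasCkBound.zero_iff, one_mul]
    exact ⟨(hc k).sub (hx₀ k).1.continuous, hxe k⟩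
  | succ r ih =>
    obtain ⟨K, hK, ih⟩ := ih
    have hB2 : 0 ≤ K * B + B + 1 := by positivity
    obtain ⟨K1, hK1, hcs⟩ := exists_hasCkBound_comp_sub.{u} r hB2
    obtain ⟨K2, hK2, hc⟩ := exists_hasCkBound_comp.{u} r hB2
    obtain ⟨K3, hK3, hlin⟩ := exists_hasCkBound_of_linear.{u} r
      (B := K1 * (K + 1) * B + K2 * B) (by positivity) C ν
    refine ⟨1 + K3 * (2 ^ r * (K1 * (K + 1)) * (B + 1)), by positivity,
      fun X Y _ _ _ _ _ f f₀ x x₀ a H e heB hs hs₀ hf hf₀ hfe hfB hx₀ hxe hc' hd hdb hG k => ?_⟩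
    have he : 0 ≤ e := (norm_nonneg _).trans (hxe 0 0)
    replace hd := hd (by omega)
    replace hdb := hdb (by omega)
    replace hG := hG (by omega)
    have hd₀ : ∀ k, Differentiable ℝ (x₀ k) := fun k => (HasCkBound.succ_iff.1 (hx₀ k)).1
    -- Order `r` for the difference of solutions suffices to control the coefficients of the
    -- differentiated equation in `C^r`; solving that equation gains the missing order.
    have hsub := ih X Y f f₀ x x₀ a H e heB hs hs₀ (fun k y => (hf k y).of_le (by norm_cast; omega))
      (fun k y => (hf₀ k y).of_le (by norm_cast; omega)) (fun i hi => hfe i (by omega))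
      (fun i hi => hfB i (by omega)) (fun k => (hx₀ k).of_le (Nat.le_succ r)) hxe hc'
      (fun _ => hd) (fun _ => hdb) (fun _ => hG)
    have hx : ∀ k, HasCkBound r (K * B + B) (x k) := fun k => by
      have := ((hsub k).add ((hx₀ k).of_le (Nat.le_succ r))).mono (b' := K * B + B) (by gcongr)
      simpa using this
    set γ : ℤ → Y → X × Y := fun k y => (x k y, y + a k)
    set γ₀ : ℤ → Y → X × Y := fun k y => (x₀ k y, y + a k)
    have hγ : ∀ k, ContDiff ℝ r (γ k) := fun k => (hx k).1.prodMk (contDiff_id.add contDiff_const)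
    have hγ₀ : ∀ k, ContDiff ℝ r (γ₀ k) := fun k =>
      ((hx₀ k).of_le (Nat.le_succ r)).1.prodMk (contDiff_id.add contDiff_const)
    have hγd : ∀ k, Differentiable ℝ (γ k) := fun k =>
      (hd k).prodMk (differentiable_id.add_const _)
    have hγd₀ : ∀ k, Differentiable ℝ (γ₀ k) := fun k =>
      (hd₀ k).prodMk (differentiable_id.add_const _)
    have hγB : ∀ k, ∀ i < r, ∀ y, ‖iteratedFDeriv ℝ i (fderiv ℝ (γ k)) y‖ ≤ K * B + B + 1 := by
      intro k i hi y
      obtain ⟨t, rfl⟩ : ∃ t, r = t + 1 := ⟨r - 1, by omega⟩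
      exact ((hx k).fderiv_graph (a k)).2 i (by omega) y
    have hDγ₀ : ∀ k, HasCkBound r (B + 1) (fderiv ℝ (γ₀ k)) := fun k => (hx₀ k).fderiv_graph (a k)
    have hγB₀ : ∀ k, ∀ i < r, ∀ y, ‖iteratedFDeriv ℝ i (fderiv ℝ (γ₀ k)) y‖ ≤ K * B + B + 1 :=
      fun k i hi y => ((hDγ₀ k).2 i hi.le y).trans (by nlinarith)
    have hγe : ∀ k, ∀ i < r, ∀ y, ‖iteratedFDeriv ℝ i
        (fun y => fderiv ℝ (γ k) y - fderiv ℝ (γ₀ k) y) y‖ ≤ (K + 1) * e := by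
      intro k i hi y
      obtain ⟨t, rfl⟩ : ∃ t, r = t + 1 := ⟨r - 1, by omega⟩
      exact (((hsub k).fderiv_graph_sub (hd k) (hd₀ k) (a k)).2 i (by omega) y).trans
        (by nlinarith)
    have hDsub : ∀ k, HasCkBound r (K1 * ((K + 1) * e))
        fun y => fderiv ℝ (f k) (γ k y) - fderiv ℝ (f₀ k) (γ₀ k y) := fun k =>
      hcs Y (X × Y) (X × Y →L[ℝ] X) (fderiv ℝ (f k)) (fderiv ℝ (f₀ k)) (γ k) (γ₀ k) ((K + 1) * e)
        (fun y => (hf k y).fderiv_right (by norm_cast))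
        (fun y => (hf₀ k y).fderiv_right (by norm_cast))
        (fun i hi y => by
          rw [norm_iteratedFDeriv_fderiv_sub]
          exact (hfe (i + 1) (by omega) k y).trans (by nlinarith))
        (fun i hi y => by
          rw [norm_iteratedFDeriv_fderiv]
          exact (hfB (i + 1) (by omega) k y).trans (by nlinarith))
        (hγ k) (hγB k) (hγ₀ k) (hγB₀ k) (hγe k)
    have hD₀ : ∀ k, HasCkBound r (K2 * B) fun y => fderiv ℝ (f₀ k) (γ₀ k y) := fun k =>
      hc Y (X × Y) (X × Y →L[ℝ] X) (fderiv ℝ (f₀ k)) (γ₀ k) B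
        (fun y => (hf₀ k y).fderiv_right (by norm_cast))
        (fun i hi y => by
          rw [norm_iteratedFDeriv_fderiv]
          exact hfB (i + 1) (by omega) k y)
        (hγ₀ k) (hγB₀ k)
    have hD : ∀ k, HasCkBound r (K1 * (K + 1) * B + K2 * B) fun y => fderiv ℝ (f k) (γ k y) :=
      fun k => by
        have := ((hDsub k).add (hD₀ k)).mono (b' := K1 * (K + 1) * B + K2 * B) (by
          rw [mul_assoc]; gcongr)
        simpa using this
    -- `Dx - Dx₀` solves the equation linearized along `x`, with source `(Df(γ) - Df₀(γ₀)) Dγ₀`.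
    -- This source is `O(e)` in `C^r`.
    have hw := hlin Y (Y →L[ℝ] X)
      (fun k y => postcompL Y X ((fderiv ℝ (f k) (γ k y)).comp (ContinuousLinearMap.inl ℝ X Y)))
      (fun y k l => postcompL Y X (H y k l))
      (fun k y => (fderiv ℝ (f k) (γ k y) - fderiv ℝ (f₀ k) (γ₀ k y)).comp (fderiv ℝ (γ₀ k) y))
      (fun k y => fderiv ℝ (x k) y - fderiv ℝ (x₀ k) y) _ (fun y => (hG y).postcomp Y)
      (fun k => (hD k).comp_inl.postcompL Y) (fun k => (hDsub k).clm_clm_comp (hDγ₀ k))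
      (fun y => by
        obtain ⟨b, hb⟩ := hdb y
        exact ⟨b + B, fun k => (norm_sub_le _ _).trans (add_le_add (hb k)
          ((HasCkBound.succ_iff.1 (hx₀ k)).2.2.norm_le y))⟩)
      (fun k y => by
        have e1 : fderiv ℝ (x (k + 1)) y = (fderiv ℝ (f k) (γ k y)).comp (fderiv ℝ (γ k) y) := by
          rw [show x (k + 1) = fun y => f k (γ k y) from funext (hs k),
            fderiv_comp_eq (hγd k) fun y => (hf k y).differentiableAt (by simp)]
        have e2 : fderiv ℝ (x₀ (k + 1)) y =
            (fderiv ℝ (f₀ k) (γ₀ k y)).comp (fderiv ℝ (γ₀ k) y) := by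
          rw [show x₀ (k + 1) = fun y => f₀ k (γ₀ k y) from funext (hs₀ k),
            fderiv_comp_eq (hγd₀ k) fun y => (hf₀ k y).differentiableAt (by simp)]
        have e3 : fderiv ℝ (γ k) y = fderiv ℝ (γ₀ k) y +
            (ContinuousLinearMap.inl ℝ X Y).comp (fderiv ℝ (x k) y - fderiv ℝ (x₀ k) y) := by
          simp only [γ, γ₀, fderiv_graph (hd k), fderiv_graph (hd₀ k),
            ContinuousLinearMap.comp_sub]
          abel
        rw [e1, e2, e3, postcompL_apply, ContinuousLinearMap.comp_add,
          ContinuousLinearMap.sub_comp, ContinuousLinearMap.comp_assoc]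
        abel) k
    rw [HasCkBound.succ_iff]
    refine ⟨(hd k).sub (hd₀ k), fun y => (hxe k y).trans
      (le_mul_of_one_le_left he (le_add_of_nonneg_right (by positivity))), ?_⟩
    rw [show fderiv ℝ (fun y => x k y - x₀ k y) = fun y => fderiv ℝ (x k) y - fderiv ℝ (x₀ k) y
      from funext fun y => fderiv_fun_sub (hd k y) (hd₀ k y)]
    exact hw.mono (by nlinarith)

end NonlinearRegularity

/-! ### Mixed partial derivatives -/

section MixedPartial

universe u

set_option maxSynthPendingDepth 2 in
/-- Exchange of the order of differentiation. -/
theorem hasFDerivAt_partial_swap {X Y E : Type*} [NormedAddCommGroup X] [NormedSpace ℝ X]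
    [NormedAddCommGroup Y] [NormedSpace ℝ Y] [NormedAddCommGroup E] [NormedSpace ℝ E]
    {g : X → Y → E} {gz : X → Y → X →L[ℝ] E} {gy : X → Y → Y →L[ℝ] E}
    {gzy : X → Y → Y →L[ℝ] X →L[ℝ] E} {z₀ : X} {y₀ : Y}
    (hz : ∀ᶠ z in 𝓝 z₀, ∀ y, HasFDerivAt (fun z => g z y) (gz z y) z)
    (hy : ∀ᶠ z in 𝓝 z₀, ∀ y, HasFDerivAt (fun y => g z y) (gy z y) y)
    (hzy : ∀ᶠ z in 𝓝 z₀, ∀ y, HasFDerivAt (fun y => gz z y) (gzy z y) y)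
    (hc : ContinuousAt (fun p : X × Y => gzy p.1 p.2) (z₀, y₀)) :
    HasFDerivAt (fun z => gy z y₀) (gzy z₀ y₀).flip z₀ := by
  rw [hasFDerivAt_iff_isLittleO, Asymptotics.isLittleO_iff]
  intro ε hε
  obtain ⟨r₁, hr₁, hc1⟩ : ∃ r > 0, ∀ p : X × Y, dist p (z₀, y₀) < r →
      dist (gzy p.1 p.2) (gzy z₀ y₀) < ε / 2 :=
    Metric.eventually_nhds_iff.1 (Metric.tendsto_nhds.1 hc _ (half_pos hε))
  obtain ⟨r₂, hr₂, hall⟩ := Metric.eventually_nhds_iff_ball.1 (hz.and (hy.and hzy))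
  set r := min r₁ r₂
  have hr : 0 < r := lt_min hr₁ hr₂
  have hclose : ∀ z ∈ Metric.ball z₀ r, ∀ y ∈ Metric.ball y₀ r, ‖gzy z y - gzy z₀ y‖ ≤ ε := by
    intro z hzr y hyr
    have h1 := hc1 (z, y) (by
      rw [Prod.dist_eq]
      exact max_lt (lt_of_lt_of_le hzr (min_le_left _ _)) (lt_of_lt_of_le hyr (min_le_left _ _)))
    have h2 := hc1 (z₀, y) (by
      rw [Prod.dist_eq]
      exact max_lt (by simpa using hr₁) (lt_of_lt_of_le hyr (min_le_left _ _)))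
    rw [← dist_eq_norm]
    have := dist_triangle_right (gzy z y) (gzy z₀ y) (gzy z₀ y₀)
    linarith
  have hb2 : ∀ z ∈ Metric.ball z₀ r, z ∈ Metric.ball z₀ r₂ := fun z hz =>
    Metric.ball_subset_ball (min_le_right _ _) hz
  have hz0 : z₀ ∈ Metric.ball z₀ r := Metric.mem_ball_self hr
  have hy0 : y₀ ∈ Metric.ball y₀ r := Metric.mem_ball_self hr
  have hgz : ∀ z ∈ Metric.ball z₀ r, ∀ y ∈ Metric.ball y₀ r,
      ‖(gz z y - gz z y₀) - (gz z₀ y - gz z₀ y₀)‖ ≤ ε * ‖y - y₀‖ := by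
    intro z hzr y hyr
    have h1 := (convex_ball y₀ r).norm_image_sub_le_of_norm_hasFDerivWithin_le
      (f := fun y => gz z y - gz z₀ y) (f' := fun y => gzy z y - gzy z₀ y) (C := ε)
      (fun y _ => (((hall z (hb2 z hzr)).2.2 y).sub
        ((hall z₀ (hb2 z₀ hz0)).2.2 y)).hasFDerivWithinAt)
      (fun y hy => hclose z hzr y hy) hy0 hyr
    rwa [sub_sub_sub_comm]
  filter_upwards [Metric.ball_mem_nhds z₀ hr] with z hzr
  -- The derivative of `ψ` at `y₀` is the remainder to be estimated, so a Lipschitz bound for `ψ` at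
  -- `y₀` is enough. It follows from the mean value inequality in `z`, since `ψ y - ψ y₀` is a
  -- second difference minus its linear part.
  set ψ : Y → E := fun y => g z y - g z₀ y - gz z₀ y (z - z₀)
  have hψ : HasFDerivAt ψ (gy z y₀ - gy z₀ y₀ - (gzy z₀ y₀).flip (z - z₀)) y₀ := by
    refine (((hall z (hb2 z hzr)).2.1 y₀).sub ((hall z₀ (hb2 z₀ hz0)).2.1 y₀)).sub ?_
    have := ((hall z₀ (hb2 z₀ hz0)).2.2 y₀).clm_apply (hasFDerivAt_const (z - z₀) y₀)
    simpa using this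
  refine hψ.le_of_lip' (by positivity) ?_
  filter_upwards [Metric.ball_mem_nhds y₀ hr] with y hyr
  have h1 := (convex_ball z₀ r).norm_image_sub_le_of_norm_hasFDerivWithin_le'
    (f := fun z => g z y - g z y₀) (f' := fun z => gz z y - gz z y₀)
    (φ := gz z₀ y - gz z₀ y₀) (C := ε * ‖y - y₀‖)
    (fun z hz => (((hall z (hb2 z hz)).1 y).sub ((hall z (hb2 z hz)).1 y₀)).hasFDerivWithinAt)
    (fun z hz => hgz z hz y hyr) hz0 hzr
  calc ‖ψ y - ψ y₀‖ = ‖g z y - g z y₀ - (g z₀ y - g z₀ y₀) -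
        (gz z₀ y - gz z₀ y₀) (z - z₀)‖ := by
        congr 1
        simp only [ψ, sub_apply]
        abel
    _ ≤ ε * ‖y - y₀‖ * ‖z - z₀‖ := h1
    _ = ε * ‖z - z₀‖ * ‖y - y₀‖ := by ring

variable {X Y : Type u} [NormedAddCommGroup X] [NormedSpace ℝ X] [NormedAddCommGroup Y]
  [NormedSpace ℝ Y] {V : ℕ → ℕ → Type u} [∀ i j, NormedAddCommGroup (V i j)]
  [∀ i j, NormedSpace ℝ (V i j)]

/-- A doubly indexed family of functions on `U × Y` whose partial derivatives are again given by
members of the family, through fixed linear operators. -/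
structure MixedChain (L₁ : ∀ i j, V i (j + 1) →L[ℝ] (X →L[ℝ] V i j))
    (L₂ : ∀ i j, V (i + 1) j →L[ℝ] (Y →L[ℝ] V i j)) (U : Set X) (S : Set (ℕ × ℕ))
    (h : ∀ i j, X × Y → V i j) : Prop where
  cont : ∀ i j, (i, j) ∈ S → ContinuousOn (h i j) (U ×ˢ univ)
  hasFDerivAt_left : ∀ i j, (i, j + 1) ∈ S → ∀ z ∈ U, ∀ y,
    HasFDerivAt (fun z => h i j (z, y)) (L₁ i j (h i (j + 1) (z, y))) z
  hasFDerivAt_right : ∀ i j, (i + 1, j) ∈ S → ∀ z ∈ U, ∀ y,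
    HasFDerivAt (fun y => h i j (z, y)) (L₂ i j (h (i + 1) j (z, y))) y

namespace MixedChain

variable {L₁ : ∀ i j, V i (j + 1) →L[ℝ] (X →L[ℝ] V i j)}
  {L₂ : ∀ i j, V (i + 1) j →L[ℝ] (Y →L[ℝ] V i j)} {U : Set X} {S : Set (ℕ × ℕ)}
  {h g : ∀ i j, X × Y → V i j}

/-- Comparison with the zero family turns estimates for differences of two families into bounds for
one. -/
theorem zero (L₁ : ∀ i j, V i (j + 1) →L[ℝ] (X →L[ℝ] V i j))
    (L₂ : ∀ i j, V (i + 1) j →L[ℝ] (Y →L[ℝ] V i j)) (U : Set X) (S : Set (ℕ × ℕ)) :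
    MixedChain L₁ L₂ U S fun _ _ _ => 0 where
  cont _ _ _ := continuousOn_const
  hasFDerivAt_left i j _ z _ y := by simpa using hasFDerivAt_const (0 : V i j) z
  hasFDerivAt_right i j _ z _ y := by simpa using hasFDerivAt_const (0 : V i j) y

theorem continuousAt (hh : MixedChain L₁ L₂ U S h) (hU : IsOpen U) {i j : ℕ} (hij : (i, j) ∈ S)
    {p : X × Y} (hp : p.1 ∈ U) : ContinuousAt (h i j) p :=
  (hh.cont i j hij).continuousAt ((hU.prod isOpen_univ).mem_nhds ⟨hp, mem_univ _⟩)

/-- Both partial derivatives exist near `p` and are continuous at `p`, which gives joint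
differentiability. -/
theorem hasFDerivAt (hh : MixedChain L₁ L₂ U S h) (hU : IsOpen U) {i j : ℕ}
    (h₁ : (i, j + 1) ∈ S) (h₂ : (i + 1, j) ∈ S) {p : X × Y} (hp : p.1 ∈ U) :
    HasFDerivAt (h i j) ((L₁ i j (h i (j + 1) p)).comp (ContinuousLinearMap.fst ℝ X Y) +
      (L₂ i j (h (i + 1) j p)).comp (ContinuousLinearMap.snd ℝ X Y)) p := by
  have hev : ∀ᶠ q : X × Y in 𝓝 p, q.1 ∈ U := continuous_fst.continuousAt (hU.mem_nhds hp)
  have := hasStrictFDerivAt_uncurry_coprod (u := p) (f := fun z y => h i j (z, y))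
    (f₁ := fun z y => L₁ i j (h i (j + 1) (z, y))) (f₂ := fun z y => L₂ i j (h (i + 1) j (z, y)))
    (hev.mono fun q hq => hh.hasFDerivAt_left i j h₁ q.1 hq q.2)
    (hev.mono fun q hq => hh.hasFDerivAt_right i j h₂ q.1 hq q.2)
    ((L₁ i j).continuous.continuousAt.comp (hh.continuousAt hU h₁ hp))
    ((L₂ i j).continuous.continuousAt.comp (hh.continuousAt hU h₂ hp))
  convert this.hasFDerivAt using 1
  · rfl
  · ext v <;> simp [Function.HasUncurry.uncurry]

theorem fderiv_eventuallyEq (hh : MixedChain L₁ L₂ U S h) (hU : IsOpen U) {i j : ℕ}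
    (h₁ : (i, j + 1) ∈ S) (h₂ : (i + 1, j) ∈ S) {p : X × Y} (hp : p.1 ∈ U) :
    fderiv ℝ (h i j) =ᶠ[𝓝 p] fun q =>
      (ContinuousLinearMap.compL ℝ (X × Y) X (V i j)).flip (ContinuousLinearMap.fst ℝ X Y)
        (L₁ i j (h i (j + 1) q)) +
      (ContinuousLinearMap.compL ℝ (X × Y) Y (V i j)).flip (ContinuousLinearMap.snd ℝ X Y)
        (L₂ i j (h (i + 1) j q)) := by
  have hev : ∀ᶠ q : X × Y in 𝓝 p, q.1 ∈ U := continuous_fst.continuousAt (hU.mem_nhds hp)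
  filter_upwards [hev] with q hq
  exact (hh.hasFDerivAt hU h₁ h₂ hq).fderiv

/-- Members of the family are jointly smooth. -/
theorem contDiffAt (hh : MixedChain L₁ L₂ U S h) (hU : IsOpen U) (a i j : ℕ)
    (hS : ∀ i' j', i ≤ i' → j ≤ j' → i' + j' ≤ i + j + a → (i', j') ∈ S) {p : X × Y}
    (hp : p.1 ∈ U) : ContDiffAt ℝ a (h i j) p := by
  induction a generalizing i j p with
  | zero =>
    have hev : ∀ᶠ q : X × Y in 𝓝 p, q.1 ∈ U := continuous_fst.continuousAt (hU.mem_nhds hp)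
    refine contDiffAt_zero.2 ⟨U ×ˢ univ, (hU.prod isOpen_univ).mem_nhds ⟨hp, mem_univ _⟩,
      hh.cont i j (hS i j le_rfl le_rfl le_rfl)⟩
  | succ a ih =>
    have hev : ∀ᶠ q : X × Y in 𝓝 p, q.1 ∈ U := continuous_fst.continuousAt (hU.mem_nhds hp)
    have h₁ : (i, j + 1) ∈ S := hS _ _ le_rfl (by omega) (by omega)
    have h₂ : (i + 1, j) ∈ S := hS _ _ (by omega) le_rfl (by omega)
    push_cast
    refine contDiffAt_succ_iff_hasFDerivAt.2 ⟨fderiv ℝ (h i j), ?_, ?_⟩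
    · exact ⟨_, (hU.prod isOpen_univ).mem_nhds ⟨hp, mem_univ _⟩, fun q hq =>
        (hh.hasFDerivAt hU h₁ h₂ hq.1).differentiableAt.hasFDerivAt⟩
    · refine ContDiffAt.congr_of_eventuallyEq ?_ (hh.fderiv_eventuallyEq hU h₁ h₂ hp)
      refine ContDiffAt.add ?_ ?_
      · exact (ContinuousLinearMap.contDiff _).contDiffAt.comp p
          ((L₁ i j).contDiff.contDiffAt.comp p (ih i (j + 1) (fun i' j' h1 h2 h3 =>
            hS i' j' (by omega) (by omega) (by omega)) hp))
      · exact (ContinuousLinearMap.contDiff _).contDiffAt.comp p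
          ((L₂ i j).contDiff.contDiffAt.comp p (ih (i + 1) j (fun i' j' h1 h2 h3 =>
            hS i' j' (by omega) (by omega) (by omega)) hp))

end MixedChain

theorem norm_iteratedFDeriv_clm_comp_sub_le {Z E F : Type*} [NormedAddCommGroup Z]
    [NormedSpace ℝ Z] [NormedAddCommGroup E] [NormedSpace ℝ E] [NormedAddCommGroup F]
    [NormedSpace ℝ F] (L : E →L[ℝ] F) {h g : Z → E} {a : ℕ} {p q : Z} (hh : ContDiffAt ℝ a h p)
    (hg : ContDiffAt ℝ a g q) :
    ‖iteratedFDeriv ℝ a (fun z => L (h z)) p - iteratedFDeriv ℝ a (fun z => L (g z)) q‖ ≤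
      ‖L‖ * ‖iteratedFDeriv ℝ a h p - iteratedFDeriv ℝ a g q‖ := by
  have e1 := L.iteratedFDeriv_comp_left hh (i := a) le_rfl
  have e2 := L.iteratedFDeriv_comp_left hg (i := a) le_rfl
  change ‖iteratedFDeriv ℝ a (L ∘ h) p - iteratedFDeriv ℝ a (L ∘ g) q‖ ≤ _
  rw [e1, e2]
  have : L.compContinuousMultilinearMap (iteratedFDeriv ℝ a h p) -
      L.compContinuousMultilinearMap (iteratedFDeriv ℝ a g q) =
      L.compContinuousMultilinearMap (iteratedFDeriv ℝ a h p - iteratedFDeriv ℝ a g q) := by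
    ext v; simp
  rw [this]
  exact L.norm_compContinuousMultilinearMap_le _

/-- The joint derivatives of two families are controlled pointwise by the members. -/
theorem MixedChain.exists_norm_iteratedFDeriv_sub_le
    (L₁ : ∀ i j, V i (j + 1) →L[ℝ] (X →L[ℝ] V i j))
    (L₂ : ∀ i j, V (i + 1) j →L[ℝ] (Y →L[ℝ] V i j)) (a i j : ℕ) : ∃ K : ℝ, 0 ≤ K ∧
    ∀ (U : Set X) (S : Set (ℕ × ℕ)) (h g : ∀ i j, X × Y → V i j) (p q : X × Y) (η : ℝ),
      IsOpen U → MixedChain L₁ L₂ U S h → MixedChain L₁ L₂ U S g → p.1 ∈ U → q.1 ∈ U →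
      (∀ i' j', i ≤ i' → j ≤ j' → i' + j' ≤ i + j + a → (i', j') ∈ S) →
      (∀ i' j', i ≤ i' → j ≤ j' → i' + j' = i + j + a → ‖h i' j' p - g i' j' q‖ ≤ η) →
      ‖iteratedFDeriv ℝ a (h i j) p - iteratedFDeriv ℝ a (g i j) q‖ ≤ K * η := by
  induction a generalizing i j with
  | zero =>
    refine ⟨1, zero_le_one, fun U S h g p q η _ _ _ _ _ _ hη => ?_⟩
    rw [iteratedFDeriv_zero_eq_comp, iteratedFDeriv_zero_eq_comp, Function.comp_apply,
      Function.comp_apply, ← dist_eq_norm, LinearIsometryEquiv.dist_map, dist_eq_norm, one_mul]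
    exact hη i j le_rfl le_rfl rfl
  | succ a ih =>
    obtain ⟨K₁, hK₁, ih₁⟩ := ih i (j + 1)
    obtain ⟨K₂, hK₂, ih₂⟩ := ih (i + 1) j
    set P₁ : (X →L[ℝ] V i j) →L[ℝ] (X × Y →L[ℝ] V i j) :=
      (ContinuousLinearMap.compL ℝ (X × Y) X (V i j)).flip (ContinuousLinearMap.fst ℝ X Y)
    set P₂ : (Y →L[ℝ] V i j) →L[ℝ] (X × Y →L[ℝ] V i j) :=
      (ContinuousLinearMap.compL ℝ (X × Y) Y (V i j)).flip (ContinuousLinearMap.snd ℝ X Y)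
    refine ⟨‖P₁.comp (L₁ i j)‖ * K₁ + ‖P₂.comp (L₂ i j)‖ * K₂, by positivity,
      fun U S h g p q η hU hh hg hp hq hS hη => ?_⟩
    have h₁ : (i, j + 1) ∈ S := hS _ _ le_rfl (by omega) (by omega)
    have h₂ : (i + 1, j) ∈ S := hS _ _ (by omega) le_rfl (by omega)
    have hS₁ : ∀ i' j', i ≤ i' → j + 1 ≤ j' → i' + j' ≤ i + (j + 1) + a → (i', j') ∈ S :=
      fun i' j' h1 h2 h3 => hS i' j' (by omega) (by omega) (by omega)
    have hS₂ : ∀ i' j', i + 1 ≤ i' → j ≤ j' → i' + j' ≤ i + 1 + j + a → (i', j') ∈ S :=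
      fun i' j' h1 h2 h3 => hS i' j' (by omega) (by omega) (by omega)
    rw [← norm_iteratedFDeriv_fderiv_sub,
      ((hh.fderiv_eventuallyEq hU h₁ h₂ hp).iteratedFDeriv ℝ a).eq_of_nhds,
      ((hg.fderiv_eventuallyEq hU h₁ h₂ hq).iteratedFDeriv ℝ a).eq_of_nhds,
      fun_iteratedFDeriv_add_apply, fun_iteratedFDeriv_add_apply, add_sub_add_comm, add_mul]
    · refine (norm_add_le _ _).trans (add_le_add ?_ ?_)
      · refine (norm_iteratedFDeriv_clm_comp_sub_le (P₁.comp (L₁ i j))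
          (hh.contDiffAt hU a i (j + 1) hS₁ hp) (hg.contDiffAt hU a i (j + 1) hS₁ hq)).trans ?_
        rw [mul_assoc]
        gcongr
        exact ih₁ U S h g p q η hU hh hg hp hq hS₁ fun i' j' h1 h2 h3 =>
          hη i' j' (by omega) (by omega) (by omega)
      · refine (norm_iteratedFDeriv_clm_comp_sub_le (P₂.comp (L₂ i j))
          (hh.contDiffAt hU a (i + 1) j hS₂ hp) (hg.contDiffAt hU a (i + 1) j hS₂ hq)).trans ?_
        rw [mul_assoc]
        gcongr
        exact ih₂ U S h g p q η hU hh hg hp hq hS₂ fun i' j' h1 h2 h3 =>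
          hη i' j' (by omega) (by omega) (by omega)
    · exact (P₁.comp (L₁ i j)).contDiff.contDiffAt.comp q (hg.contDiffAt hU a i (j + 1) hS₁ hq)
    · exact (P₂.comp (L₂ i j)).contDiff.contDiffAt.comp q (hg.contDiffAt hU a (i + 1) j hS₂ hq)
    · exact (P₁.comp (L₁ i j)).contDiff.contDiffAt.comp p (hh.contDiffAt hU a i (j + 1) hS₁ hp)
    · exact (P₂.comp (L₂ i j)).contDiff.contDiffAt.comp p (hh.contDiffAt hU a (i + 1) j hS₂ hp)

end MixedPartial

/-! ### Iterated mixed derivatives as a mixed chain -/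

section MixedDerivatives

universe u

set_option maxSynthPendingDepth 2 in
-- Exchange of derivatives, transported through the currying isomorphisms `e₀` and `e₁`. The
-- operator `L'` is chosen before the functions, as a mixed chain requires.
theorem exists_swap_operator {X Y W₀ W₁ W₀' W₁' : Type u} [NormedAddCommGroup X] [NormedSpace ℝ X]
    [NormedAddCommGroup Y] [NormedSpace ℝ Y] [NormedAddCommGroup W₀] [NormedSpace ℝ W₀]
    [NormedAddCommGroup W₁] [NormedSpace ℝ W₁] [NormedAddCommGroup W₀'] [NormedSpace ℝ W₀']
    [NormedAddCommGroup W₁'] [NormedSpace ℝ W₁'] (e₀ : W₀' ≃L[ℝ] (Y →L[ℝ] W₀))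
    (e₁ : W₁' ≃L[ℝ] (Y →L[ℝ] W₁)) (L : W₁ →L[ℝ] (X →L[ℝ] W₀)) :
    ∃ L' : W₁' →L[ℝ] (X →L[ℝ] W₀'), ∀ (h₀ : X → Y → W₀) (h₁ : X → Y → W₁) (h₀' : X → Y → W₀')
      (h₁' : X → Y → W₁') (z₀ : X) (y₀ : Y),
      (∀ᶠ z in 𝓝 z₀, ∀ y, HasFDerivAt (fun z => h₀ z y) (L (h₁ z y)) z) →
      (∀ᶠ z in 𝓝 z₀, ∀ y, HasFDerivAt (fun y => h₀ z y) (e₀ (h₀' z y)) y) →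
      (∀ᶠ z in 𝓝 z₀, ∀ y, HasFDerivAt (fun y => h₁ z y) (e₁ (h₁' z y)) y) →
      ContinuousAt (fun p : X × Y => h₁' p.1 p.2) (z₀, y₀) →
      HasFDerivAt (fun z => h₀' z y₀) (L' (h₁' z₀ y₀)) z₀ := by
  set Q : (Y →L[ℝ] W₁) →L[ℝ] (Y →L[ℝ] (X →L[ℝ] W₀)) :=
    ContinuousLinearMap.compL ℝ Y W₁ (X →L[ℝ] W₀) L
  set R : (X →L[ℝ] (Y →L[ℝ] W₀)) →L[ℝ] (X →L[ℝ] W₀') :=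
    ContinuousLinearMap.compL ℝ X (Y →L[ℝ] W₀) W₀' e₀.symm.toContinuousLinearMap
  refine ⟨R.comp ((flipCLM Y X W₀).comp (Q.comp e₁.toContinuousLinearMap)),
    fun h₀ h₁ h₀' h₁' z₀ y₀ H₁ H₂ H₃ H₄ => ?_⟩
  have h := hasFDerivAt_partial_swap (g := h₀) (gz := fun z y => L (h₁ z y))
    (gy := fun z y => e₀ (h₀' z y)) (gzy := fun z y => Q (e₁ (h₁' z y))) (y₀ := y₀) H₁ H₂
    (H₃.mono fun z hz y => (L.hasFDerivAt.comp y (hz y)))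
    (Q.continuous.continuousAt.comp (e₁.continuous.continuousAt.comp H₄))
  have h' := e₀.symm.toContinuousLinearMap.hasFDerivAt.comp z₀ h
  have h'' : (fun z => h₀' z y₀) = fun z => e₀.symm (e₀ (h₀' z y₀)) := by simp
  rw [h'']
  exact h'

variable {X Y E : Type u} [NormedAddCommGroup X] [NormedSpace ℝ X] [NormedAddCommGroup Y]
  [NormedSpace ℝ Y] [NormedAddCommGroup E] [NormedSpace ℝ E]

/-- The mixed derivative `D_y^i D_z^j φ`. -/
noncomputable def mixedD (φ : X → Y → E) (i j : ℕ) (p : X × Y) : Y [×i]→L[ℝ] X [×j]→L[ℝ] E :=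
  iteratedFDeriv ℝ i (fun y => iteratedFDeriv ℝ j (fun w => φ w y) p.1) p.2

/-- The mixed derivatives of `φ` with indices in `S` exist and are continuous on `U × Y`. -/
def HasMixedD (U : Set X) (S : Set (ℕ × ℕ)) (φ : X → Y → E) : Prop :=
  ∀ p ∈ S, (∀ y, ContDiffOn ℝ p.2 (fun w => φ w y) U) ∧
    (∀ z ∈ U, ContDiff ℝ p.1 (fun y => iteratedFDeriv ℝ p.2 (fun w => φ w y) z)) ∧
    ContinuousOn (mixedD φ p.1 p.2) (U ×ˢ univ)

/-- Currying off the first argument. -/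
noncomputable def curryLeftCLM (Y E : Type u) [NormedAddCommGroup Y] [NormedSpace ℝ Y]
    [NormedAddCommGroup E] [NormedSpace ℝ E] (i : ℕ) :
    (Y [×(i + 1)]→L[ℝ] E) ≃L[ℝ] (Y →L[ℝ] Y [×i]→L[ℝ] E) :=
  (continuousMultilinearCurryLeftEquiv ℝ (fun _ : Fin (i + 1) => Y) E).toContinuousLinearEquiv

theorem hasFDerivAt_iteratedFDeriv {f : Y → E} {i : ℕ} {y : Y} (hf : ContDiffAt ℝ (i + 1 : ℕ) f y) :
    HasFDerivAt (iteratedFDeriv ℝ i f) (curryLeftCLM Y E i (iteratedFDeriv ℝ (i + 1) f y)) y :=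
  (hf.differentiableAt_iteratedFDeriv (by norm_cast; omega)).hasFDerivAt

theorem HasMixedD.hasFDerivAt_right {U : Set X} {S : Set (ℕ × ℕ)} {φ : X → Y → E}
    (h : HasMixedD U S φ) {i j : ℕ} (hij : (i + 1, j) ∈ S) {z : X} (hz : z ∈ U) (y : Y) :
    HasFDerivAt (fun y => mixedD φ i j (z, y))
      (curryLeftCLM Y (X [×j]→L[ℝ] E) i (mixedD φ (i + 1) j (z, y))) y :=
  hasFDerivAt_iteratedFDeriv ((h _ hij).2.1 z hz).contDiffAt

set_option maxSynthPendingDepth 2 in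
-- In `mixedD` the `z`-derivatives are taken first, so differentiating once more in `z` is immediate
-- only for `i = 0`. Each `θ`-derivative is passed by one exchange, and the lower-set condition
-- supplies the intermediate derivatives.
theorem exists_hasFDerivAt_left (X Y E : Type u) [NormedAddCommGroup X] [NormedSpace ℝ X]
    [NormedAddCommGroup Y] [NormedSpace ℝ Y] [NormedAddCommGroup E] [NormedSpace ℝ E] (i j : ℕ) :
    ∃ L : (Y [×i]→L[ℝ] X [×(j + 1)]→L[ℝ] E) →L[ℝ] (X →L[ℝ] (Y [×i]→L[ℝ] X [×j]→L[ℝ] E)),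
    ∀ (U : Set X) (S : Set (ℕ × ℕ)) (φ : X → Y → E), IsOpen U → IsLowerSet S → HasMixedD U S φ →
      (i, j + 1) ∈ S → ∀ z ∈ U, ∀ y,
        HasFDerivAt (fun z => mixedD φ i j (z, y)) (L (mixedD φ i (j + 1) (z, y))) z := by
  induction i with
  | zero =>
    set c₀ : (X [×j]→L[ℝ] E) →L[ℝ] (Y [×0]→L[ℝ] X [×j]→L[ℝ] E) :=
      (continuousMultilinearCurryFin0 ℝ Y (X [×j]→L[ℝ] E)).symm.toContinuousLinearEquiv.toContinuousLinearMap
    set c₁ : (Y [×0]→L[ℝ] X [×(j + 1)]→L[ℝ] E) →L[ℝ] (X [×(j + 1)]→L[ℝ] E) :=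
      (continuousMultilinearCurryFin0 ℝ Y (X [×(j + 1)]→L[ℝ] E)).toContinuousLinearEquiv.toContinuousLinearMap
    set R : (X →L[ℝ] (X [×j]→L[ℝ] E)) →L[ℝ] (X →L[ℝ] (Y [×0]→L[ℝ] X [×j]→L[ℝ] E)) :=
      ContinuousLinearMap.compL ℝ X _ _ c₀
    refine ⟨R.comp ((curryLeftCLM X E j).toContinuousLinearMap.comp c₁),
      fun U S φ hU hS h hj z hz y => ?_⟩
    have h1 : HasFDerivAt (iteratedFDeriv ℝ j fun w => φ w y)
        (curryLeftCLM X E j (iteratedFDeriv ℝ (j + 1) (fun w => φ w y) z)) z :=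
      hasFDerivAt_iteratedFDeriv (((h _ hj).1 y).contDiffAt (hU.mem_nhds hz))
    exact c₀.hasFDerivAt.comp z h1
  | succ i ih =>
    obtain ⟨L, hL⟩ := ih
    obtain ⟨L', hL'⟩ := exists_swap_operator (curryLeftCLM Y (X [×j]→L[ℝ] E) i)
      (curryLeftCLM Y (X [×(j + 1)]→L[ℝ] E) i) L
    refine ⟨L', fun U S φ hU hS h hj z hz y => ?_⟩
    have hev : ∀ᶠ z in 𝓝 z, z ∈ U := hU.mem_nhds hz
    have h1 : (i, j + 1) ∈ S := hS (show (i, j + 1) ≤ (i + 1, j + 1) from ⟨Nat.le_succ i, le_rfl⟩) hj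
    have h2 : (i + 1, j) ∈ S := hS (show (i + 1, j) ≤ (i + 1, j + 1) from ⟨le_rfl, Nat.le_succ j⟩) hj
    exact hL' (fun z y => mixedD φ i j (z, y)) (fun z y => mixedD φ i (j + 1) (z, y))
      (fun z y => mixedD φ (i + 1) j (z, y)) (fun z y => mixedD φ (i + 1) (j + 1) (z, y)) z y
      (hev.mono fun w hw y => hL U S φ hU hS h h1 w hw y)
      (hev.mono fun w hw y => h.hasFDerivAt_right h2 hw y)
      (hev.mono fun w hw y => h.hasFDerivAt_right hj hw y)
      ((h _ hj).2.2.continuousAt ((hU.prod isOpen_univ).mem_nhds ⟨hz, mem_univ _⟩))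

/-- Mixed derivatives form a family closed under partial differentiation. -/
theorem exists_mixedChain (X Y E : Type u) [NormedAddCommGroup X] [NormedSpace ℝ X]
    [NormedAddCommGroup Y] [NormedSpace ℝ Y] [NormedAddCommGroup E] [NormedSpace ℝ E] :
    ∃ (L₁ : ∀ i j, (Y [×i]→L[ℝ] X [×(j + 1)]→L[ℝ] E) →L[ℝ] (X →L[ℝ] (Y [×i]→L[ℝ] X [×j]→L[ℝ] E)))
      (L₂ : ∀ i j, (Y [×(i + 1)]→L[ℝ] X [×j]→L[ℝ] E) →L[ℝ] (Y →L[ℝ] (Y [×i]→L[ℝ] X [×j]→L[ℝ] E))),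
      ∀ (U : Set X) (S : Set (ℕ × ℕ)) (φ : X → Y → E), IsOpen U → IsLowerSet S →
        HasMixedD U S φ → MixedChain L₁ L₂ U S (mixedD φ) := by
  choose L hL using exists_hasFDerivAt_left X Y E
  exact ⟨L, fun i j => (curryLeftCLM Y (X [×j]→L[ℝ] E) i).toContinuousLinearMap,
    fun U S φ hU hS h => ⟨fun i j hij => (h _ hij).2.2,
      fun i j hij z hz y => hL i j U S φ hU hS h hij z hz y,
      fun i j hij z hz y => h.hasFDerivAt_right hij hz y⟩⟩

end MixedDerivatives

/-! ### Exponential dichotomies and Green kernels -/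

section Dichotomy

variable {E : Type*} [NormedAddCommGroup E] [NormedSpace ℝ E]

/-- The products `A (k + N - 1) ⋯ A k`. -/
noncomputable def fwdProd (A : ℤ → E →L[ℝ] E) : ℕ → ℤ → E →L[ℝ] E
  | 0, _ => 1
  | N + 1, k => fwdProd A N (k + 1) * A k

/-- The products `(A (k - N))⁻¹ ⋯ (A (k - 1))⁻¹`. -/
noncomputable def bwdProd (A : ℤ → E →L[ℝ] E) : ℕ → ℤ → E →L[ℝ] E
  | 0, _ => 1
  | N + 1, k => bwdProd A N (k - 1) * Ring.inverse (A (k - 1))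

theorem fwdProd_succ' (A : ℤ → E →L[ℝ] E) (N : ℕ) (k : ℤ) :
    fwdProd A (N + 1) k = A (k + N) * fwdProd A N k := by
  induction N generalizing k with
  | zero => simp [fwdProd]
  | succ N ih =>
    rw [fwdProd, ih (k + 1), fwdProd, mul_assoc]
    congr 2
    push_cast; ring

theorem bwdProd_succ (A : ℤ → E →L[ℝ] E) (N : ℕ) (k : ℤ) :
    bwdProd A (N + 1) k = bwdProd A N (k - 1) * Ring.inverse (A (k - 1)) := rfl

theorem bwdProd_succ' (A : ℤ → E →L[ℝ] E) (N : ℕ) (k : ℤ) :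
    bwdProd A (N + 1) k = Ring.inverse (A (k - N - 1)) * bwdProd A N k := by
  induction N generalizing k with
  | zero => simp [bwdProd]
  | succ N ih =>
    rw [bwdProd, ih (k - 1), bwdProd, mul_assoc]
    congr 3
    push_cast; ring

theorem int_cases_ge_lt (k j : ℤ) : (∃ N : ℕ, j = k + N) ∨ ∃ N : ℕ, j = k - N - 1 := by
  rcases le_or_gt k j with h | h
  · exact Or.inl ⟨(j - k).toNat, by omega⟩
  · exact Or.inr ⟨(k - j - 1).toNat, by omega⟩

/-- The Green kernel of an exponential dichotomy. -/
noncomputable def greenOfDichotomy (A PS PU : ℤ → E →L[ℝ] E) (k l : ℤ) : E →L[ℝ] E :=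
  if l < k then fwdProd A (k - l - 1).toNat (l + 1) * PS (l + 1)
  else -(bwdProd A (l + 1 - k).toNat (l + 1) * PU (l + 1))

theorem greenOfDichotomy_of_lt (A PS PU : ℤ → E →L[ℝ] E) (l : ℤ) (N : ℕ) :
    greenOfDichotomy A PS PU (l + 1 + N) l = fwdProd A N (l + 1) * PS (l + 1) := by
  rw [greenOfDichotomy, if_pos (by omega), show (l + 1 + N - l - 1).toNat = N by omega]

theorem greenOfDichotomy_of_le (A PS PU : ℤ → E →L[ℝ] E) (l : ℤ) (N : ℕ) :
    greenOfDichotomy A PS PU (l - N) l = -(bwdProd A (N + 1) (l + 1) * PU (l + 1)) := by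
  rw [greenOfDichotomy, if_neg (by omega), show (l + 1 - (l - N)).toNat = N + 1 by omega]

/-- An impulse at `l` is split at time `l + 1`: its stable part is propagated forward and its
unstable part backward with opposite sign, so the jump is `PS + PU = 1`. At time `l + 1 + N` only
`N` factors have acted, whence the division of the constant by the rate. -/
theorem isGreen_of_dichotomy {A PS PU : ℤ → E →L[ℝ] E} {C b lamS lamU : ℝ} (hC : 0 ≤ C)
    (hS0 : 0 < lamS) (hS1 : lamS < 1) (hU1 : 1 < lamU) (hA : ∀ k, IsUnit (A k))
    (hsum : ∀ k, PS k + PU k = 1) (hS : ∀ k, A k * PS k = PS (k + 1) * A k)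
    (hU : ∀ k, A k * PU k = PU (k + 1) * A k) (hbS : ∀ k, ‖PS k‖ ≤ b) (hbU : ∀ k, ‖PU k‖ ≤ b)
    (hfwd : ∀ k v N, ‖fwdProd A N k (PS k v)‖ ≤ C * lamS ^ N * ‖PS k v‖)
    (hbwd : ∀ k v N, ‖bwdProd A N k (PU k v)‖ ≤ C * (lamU ^ N)⁻¹ * ‖PU k v‖) :
    IsGreen A (greenOfDichotomy A PS PU) (C * b / max lamS lamU⁻¹) (max lamS lamU⁻¹) := by
  have hb : 0 ≤ b := (norm_nonneg _).trans (hbS 0)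
  set ν := max lamS lamU⁻¹
  have hν0 : 0 < ν := lt_max_of_lt_left hS0
  have hν1 : ν < 1 := max_lt hS1 (inv_lt_one_of_one_lt₀ hU1)
  have hC' : 0 ≤ C * b / ν := by positivity
  refine ⟨hν0, hν1, hC', fun k l => ?_, fun k l => ?_, fun k l => ?_⟩
  · rcases int_cases_ge_lt (l + 1) k with ⟨N, rfl⟩ | ⟨N, rfl⟩
    · rw [greenOfDichotomy_of_lt, show (l + 1 + N - l).natAbs = N + 1 by omega]
      refine ContinuousLinearMap.opNorm_le_bound _ (by positivity) fun v => (hfwd _ v N).trans ?_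
      calc C * lamS ^ N * ‖PS (l + 1) v‖ ≤ C * ν ^ N * (b * ‖v‖) := by
            gcongr
            · exact le_max_left _ _
            · exact ContinuousLinearMap.le_of_opNorm_le _ (hbS _) _
        _ = C * b / ν * ν ^ (N + 1) * ‖v‖ := by rw [pow_succ]; field_simp
    · rw [show l + 1 - N - 1 = l - N by ring, greenOfDichotomy_of_le,
        show (l - N - l).natAbs = N by omega, norm_neg]
      refine ContinuousLinearMap.opNorm_le_bound _ (by positivity) fun v =>
        (hbwd _ v (N + 1)).trans ?_
      calc C * (lamU ^ (N + 1))⁻¹ * ‖PU (l + 1) v‖ ≤ C * ν ^ (N + 1) * (b * ‖v‖) := by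
            rw [← inv_pow]
            gcongr
            · exact le_max_right _ _
            · exact ContinuousLinearMap.le_of_opNorm_le _ (hbU _) _
        _ ≤ C * (ν ^ N * ν⁻¹) * (b * ‖v‖) := by
            gcongr
            rw [pow_succ]
            gcongr
            exact hν1.le.trans ((one_le_inv₀ hν0).2 hν1.le)
        _ = C * b / ν * ν ^ N * ‖v‖ := by field_simp
  · rcases int_cases_ge_lt (l + 1) k with ⟨N, rfl⟩ | ⟨N, rfl⟩
    · rw [show l + 1 + N + 1 = l + 1 + ((N + 1 : ℕ) : ℤ) by push_cast; ring,
        greenOfDichotomy_of_lt, greenOfDichotomy_of_lt, fwdProd_succ', ← mul_assoc, sub_self,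
        if_neg (by omega)]
    · rw [show l + 1 - N - 1 = l - N by ring]
      rcases N with _ | N
      · rw [show l - ((0 : ℕ) : ℤ) + 1 = l + 1 + ((0 : ℕ) : ℤ) by simp, greenOfDichotomy_of_lt,
          greenOfDichotomy_of_le, if_pos (by simp)]
        simp only [fwdProd, bwdProd, Nat.cast_zero, sub_zero, add_sub_cancel_right, one_mul,
          mul_neg, sub_neg_eq_add]
        rw [← mul_assoc, Ring.mul_inverse_cancel _ (hA l), one_mul, hsum]
      · rw [show l - ((N + 1 : ℕ) : ℤ) + 1 = l - N by push_cast; ring, greenOfDichotomy_of_le,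
          greenOfDichotomy_of_le, if_neg (by omega), bwdProd_succ' _ (N + 1),
          show l + 1 - ((N + 1 : ℕ) : ℤ) - 1 = l - ((N + 1 : ℕ) : ℤ) by ring, mul_neg,
          ← mul_assoc, ← mul_assoc, Ring.mul_inverse_cancel _ (hA _), one_mul, sub_self]
  · rcases int_cases_ge_lt l k with ⟨N, rfl⟩ | ⟨N, rfl⟩
    · rw [show l + N = l - 1 + 1 + N by ring, greenOfDichotomy_of_lt, sub_add_cancel]
      rcases N with _ | N
      · rw [show l + ((0 : ℕ) : ℤ) = l - ((0 : ℕ) : ℤ) by simp, greenOfDichotomy_of_le,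
          if_pos (by simp)]
        simp only [fwdProd, bwdProd, add_sub_cancel_right, one_mul, neg_mul, sub_neg_eq_add]
        rw [mul_assoc, ← hU, ← mul_assoc, Ring.inverse_mul_cancel _ (hA l), one_mul, hsum]
      · rw [show l + ((N + 1 : ℕ) : ℤ) = l + 1 + N by push_cast; ring, greenOfDichotomy_of_lt,
          fwdProd, mul_assoc, mul_assoc, ← hS, sub_self, if_neg (by omega)]
    · rw [show l - N - 1 = l - ((N + 1 : ℕ) : ℤ) by push_cast; ring, greenOfDichotomy_of_le,
        show l - ((N + 1 : ℕ) : ℤ) = l - 1 - N by push_cast; ring, greenOfDichotomy_of_le,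
        sub_add_cancel, bwdProd_succ A (N + 1), add_sub_cancel_right, neg_mul, mul_assoc, mul_assoc,
        ← hU, ← mul_assoc (Ring.inverse _), Ring.inverse_mul_cancel _ (hA l), one_mul,
        sub_self, if_neg (by omega)]

namespace IsGreen

variable {A : ℤ → E →L[ℝ] E} {H : ℤ → ℤ → E →L[ℝ] E} {C ν : ℝ}

theorem left_of_ne (h : IsGreen A H C ν) {k l : ℤ} (hkl : k ≠ l) :
    H (k + 1) l = A k * H k l := by
  have := h.left k l
  rwa [if_neg hkl, sub_eq_zero] at this

theorem stable_mul (h : IsGreen A H C ν) (k : ℤ) :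
    A k * H k (k - 1) = H (k + 1) k * A k := by
  have h1 := h.right (k + 1) k
  rw [if_neg (by omega), sub_eq_zero] at h1
  rw [← h1, h.left_of_ne (by omega)]

/-- Past the impulse a kernel column is an orbit of `A`, so orbits starting in the range of `H k (k
- 1)` inherit the decay of the kernel. -/
theorem fwdProd_mul (h : IsGreen A H C ν) (N : ℕ) (k : ℤ) :
    fwdProd A N k * H k (k - 1) = H (k + N) (k - 1) := by
  induction N with
  | zero => simp [fwdProd]
  | succ N ih =>
    rw [fwdProd_succ', mul_assoc, ih, ← h.left_of_ne (by omega)]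
    congr 1
    push_cast; ring

/-- Here `1 - H k (k - 1)` is `-A (k - 1) * H (k - 1) (k - 1)` by the jump relation, so backward
orbits are columns before the impulse. -/
theorem bwdProd_mul (h : IsGreen A H C ν) (hA : ∀ k, IsUnit (A k)) (N : ℕ) (k : ℤ) :
    bwdProd A (N + 1) k * (1 - H k (k - 1)) = -H (k - N - 1) (k - 1) := by
  induction N with
  | zero =>
    have h1 := h.left (k - 1) (k - 1)
    rw [if_pos rfl, sub_add_cancel] at h1
    rw [← h1, sub_sub_cancel_left]
    simp only [bwdProd, one_mul, Nat.cast_zero, sub_zero]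
    rw [mul_neg, ← mul_assoc, Ring.inverse_mul_cancel _ (hA _), one_mul]
  | succ N ih =>
    rw [bwdProd_succ', mul_assoc, ih]
    have h1 := h.left_of_ne (k := k - N - 1 - 1) (l := k - 1) (by omega)
    rw [sub_add_cancel] at h1
    rw [h1, show k - ((N + 1 : ℕ) : ℤ) - 1 = k - N - 1 - 1 by push_cast; ring, mul_neg,
      ← mul_assoc, Ring.inverse_mul_cancel _ (hA _), one_mul]

variable [CompleteSpace E]

/-- The forward orbit of `v`, extended by zero to times before `k`, is a bounded solution with
impulse `v` at time `k - 1`. So is the column `H j (k - 1) v`, and bounded solutions are unique. -/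
theorem stable_apply_of_bounded (h : IsGreen A H C ν) {k : ℤ} {v : E} {B : ℝ}
    (hv : ∀ N, ‖fwdProd A N k v‖ ≤ B) : H k (k - 1) v = v := by
  have hB : 0 ≤ B := (norm_nonneg _).trans (hv 0)
  have key := h.eq_of_solves (u := fun j => H j (k - 1) v)
    (v := fun j => if k ≤ j then fwdProd A (j - k).toNat k v else 0)
    (g := fun j => if j = k - 1 then v else 0) (B := C * ‖v‖) (B' := B)
    (fun j => ContinuousLinearMap.le_of_opNorm_le _ (h.bound_const _ _) _)
    (fun j => by
      by_cases hj : k ≤ j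
      · simpa [hj] using hv _
      · simpa [hj] using hB)
    (fun j => by
      have h1 := congrArg (fun T => T v) (h.left j (k - 1))
      simp only [sub_apply, mul_apply_eq_comp, sub_eq_iff_eq_add'] at h1
      rw [h1]
      by_cases hj : j = k - 1 <;> simp [hj])
    (fun j => by
      rcases int_cases_ge_lt k j with ⟨N, rfl⟩ | ⟨N, rfl⟩
      · simp only [show k ≤ k + N by omega, show k ≤ k + N + 1 by omega, if_true,
          show (k + N - k).toNat = N by omega, show (k + N + 1 - k).toNat = N + 1 by omega,
          show ¬(k + N = k - 1) by omega, if_false, add_zero]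
        rw [fwdProd_succ']; rfl
      · rcases N with _ | N
        · simp [fwdProd]
        · simp only [show ¬(k ≤ k - ((N + 1 : ℕ) : ℤ) - 1) by omega,
            show ¬(k ≤ k - ((N + 1 : ℕ) : ℤ) - 1 + 1) by omega, if_false,
            show ¬(k - ((N + 1 : ℕ) : ℤ) - 1 = k - 1) by omega, map_zero, add_zero]) k
  simpa [fwdProd] using key

/-- Same comparison with minus the backward orbit, extended by zero from time `k` on; its value at
`k` is zero. -/
theorem stable_apply_eq_zero_of_bounded (h : IsGreen A H C ν) (hA : ∀ k, IsUnit (A k)) {k : ℤ}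
    {v : E} {B : ℝ} (hv : ∀ N, ‖bwdProd A N k v‖ ≤ B) : H k (k - 1) v = 0 := by
  have hB : 0 ≤ B := (norm_nonneg _).trans (hv 0)
  have key := h.eq_of_solves (u := fun j => H j (k - 1) v)
    (v := fun j => if k ≤ j then 0 else -bwdProd A (k - j).toNat k v)
    (g := fun j => if j = k - 1 then v else 0) (B := C * ‖v‖) (B' := B)
    (fun j => ContinuousLinearMap.le_of_opNorm_le _ (h.bound_const _ _) _)
    (fun j => by
      by_cases hj : k ≤ j
      · simpa [hj] using hB
      · simpa [hj] using hv _)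
    (fun j => by
      have h1 := congrArg (fun T => T v) (h.left j (k - 1))
      simp only [sub_apply, mul_apply_eq_comp, sub_eq_iff_eq_add'] at h1
      rw [h1]
      by_cases hj : j = k - 1 <;> simp [hj])
    (fun j => by
      have hcancel : ∀ (j : ℤ) (w : E), A j (Ring.inverse (A j) w) = w := fun j w => by
        rw [← mul_apply_eq_comp, Ring.mul_inverse_cancel _ (hA j), one_apply_eq_self]
      rcases int_cases_ge_lt k j with ⟨N, rfl⟩ | ⟨N, rfl⟩
      · simp only [show k ≤ k + N by omega, show k ≤ k + N + 1 by omega, if_true,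
          show ¬(k + N = k - 1) by omega, if_false, add_zero, map_zero]
      · have h2 : A (k - N - 1) (bwdProd A (N + 1) k v) = bwdProd A N k v := by
          rw [bwdProd_succ', mul_apply_eq_comp, hcancel]
        simp only [show ¬(k ≤ k - N - 1) by omega, if_false, map_neg,
          show (k - (k - N - 1)).toNat = N + 1 by omega, h2]
        rcases N with _ | N
        · simp [bwdProd]
        · simp only [show ¬(k ≤ k - ((N + 1 : ℕ) : ℤ) - 1 + 1) by omega, if_false,
            show ¬(k - ((N + 1 : ℕ) : ℤ) - 1 = k - 1) by omega, add_zero,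
            show (k - (k - ((N + 1 : ℕ) : ℤ) - 1 + 1)).toNat = N + 1 by omega]) k
  simpa using key

/-- Vectors `H k (k - 1) v` have bounded forward orbits and are therefore fixed. -/
theorem stable_idem (h : IsGreen A H C ν) (k : ℤ) :
    H k (k - 1) * H k (k - 1) = H k (k - 1) :=
  ContinuousLinearMap.ext fun v => h.stable_apply_of_bounded (v := H k (k - 1) v)
    (B := C * ‖v‖) fun N => by
    rw [← mul_apply_eq_comp, h.fwdProd_mul]
    exact ContinuousLinearMap.le_of_opNorm_le _ (h.bound_const _ _) _

/-- The range consists of fixed vectors, whose orbits are decaying columns; conversely boundedness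
already forces a vector to be fixed. The summand `1` keeps the constant positive even if `C = 0`. -/
theorem mem_range_stable_iff (h : IsGreen A H C ν) (k : ℤ) (v : E) :
    v ∈ range (H k (k - 1)) ↔ ∀ N, ‖fwdProd A N k v‖ ≤ (C / ν + 1) * ν ^ N * ‖v‖ := by
  have hν := h.nu_pos
  have hC := h.const_nonneg
  constructor
  · rintro ⟨w, rfl⟩ N
    have h1 := congrArg (fun T => T w) (h.stable_idem k)
    simp only [mul_apply_eq_comp] at h1
    set v := H k (k - 1) w
    rw [← h1, ← mul_apply_eq_comp, h.fwdProd_mul, h1]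
    refine ContinuousLinearMap.le_of_opNorm_le _ ((h.bound _ _).trans ?_) _
    rw [show (k + N - (k - 1)).natAbs = N + 1 by omega]
    calc C * ν ^ (N + 1) = C * (ν ^ N * ν) := by rw [pow_succ]
      _ ≤ C * (ν ^ N * ν⁻¹) := by
          gcongr
          exact h.nu_lt.le.trans ((one_le_inv₀ hν).2 h.nu_lt.le)
      _ = C / ν * ν ^ N := by rw [div_eq_mul_inv]; ring
      _ ≤ (C / ν + 1) * ν ^ N := by gcongr; linarith
  · intro hv
    refine ⟨v, h.stable_apply_of_bounded (B := (C / ν + 1) * ‖v‖) fun N => (hv N).trans ?_⟩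
    gcongr
    exact mul_le_of_le_one_right (by positivity) (pow_le_one₀ hν.le h.nu_lt.le)

/-- Mirror image under time reversal. The summand `1` in the constant also covers `N = 0`, where no
kernel entry is available. -/
theorem mem_range_unstable_iff (h : IsGreen A H C ν) (hA : ∀ k, IsUnit (A k)) (k : ℤ) (v : E) :
    v ∈ range ⇑(1 - H k (k - 1)) ↔
      ∀ N, ‖bwdProd A N k v‖ ≤ (C / ν + 1) * (ν⁻¹ ^ N)⁻¹ * ‖v‖ := by
  have hν := h.nu_pos
  have hC := h.const_nonneg
  simp only [inv_pow, inv_inv]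
  constructor
  · rintro ⟨w, rfl⟩ N
    have h1 : (1 - H k (k - 1)) ((1 - H k (k - 1)) w) = (1 - H k (k - 1)) w := by
      have := congrArg (fun T => T w) (h.stable_idem k)
      simp only [mul_apply_eq_comp] at this
      simp [this]
    set v := (1 - H k (k - 1)) w
    rcases N with _ | N
    · simp only [bwdProd, one_apply_eq_self, pow_zero, mul_one]
      exact le_mul_of_one_le_left (norm_nonneg _) (le_add_of_nonneg_left (by positivity))
    · rw [← h1, ← mul_apply_eq_comp, h.bwdProd_mul hA, h1]
      refine ContinuousLinearMap.le_of_opNorm_le _ ?_ _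
      rw [norm_neg]
      refine (h.bound _ _).trans ?_
      rw [show (k - N - 1 - (k - 1)).natAbs = N by omega]
      calc C * ν ^ N = C / ν * ν ^ (N + 1) := by rw [pow_succ]; field_simp
        _ ≤ (C / ν + 1) * ν ^ (N + 1) := by gcongr; linarith
  · intro hv
    have h1 := h.stable_apply_eq_zero_of_bounded hA (v := v) (k := k) (B := (C / ν + 1) * ‖v‖)
      fun N => (hv N).trans (by
        gcongr
        exact mul_le_of_le_one_right (by positivity) (pow_le_one₀ hν.le h.nu_lt.le))
    exact ⟨v, by simp [h1]⟩

/-- A sequence has at most one Green kernel. -/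
theorem kernel_unique (h : IsGreen A H C ν) {H' : ℤ → ℤ → E →L[ℝ] E} {C' ν' : ℝ}
    (h' : IsGreen A H' C' ν') (k l : ℤ) : H k l = H' k l := by
  ext v
  refine h.eq_of_solves (u := fun k => H k l v) (v := fun k => H' k l v) (B := C * ‖v‖)
    (B' := C' * ‖v‖) (g := fun k => (if k = l then (1 : E →L[ℝ] E) else 0) v)
    (fun j => ContinuousLinearMap.le_of_opNorm_le _ (h.bound_const _ _) _)
    (fun j => ContinuousLinearMap.le_of_opNorm_le _ (h'.bound_const _ _) _)
    (fun j => ?_) (fun j => ?_) k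
  · have := congrArg (fun T => T v) (h.left j l)
    simpa [sub_eq_iff_eq_add'] using this
  · have := congrArg (fun T => T v) (h'.left j l)
    simpa [sub_eq_iff_eq_add'] using this

omit [CompleteSpace E] in
theorem shift (h : IsGreen A H C ν) : IsGreen (fun k => A (k + 1))
    (fun k l => H (k + 1) (l + 1)) C ν where
  nu_pos := h.nu_pos
  nu_lt := h.nu_lt
  const_nonneg := h.const_nonneg
  bound k l := by simpa using h.bound (k + 1) (l + 1)
  left k l := by simpa using h.left (k + 1) (l + 1)
  right k l := by
    have := h.right (k + 1) (l + 1)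
    rw [add_sub_cancel_right] at this
    simpa using this

end IsGreen

end Dichotomy

/-! ### Functions on the torus and their periodic lifts -/

section TorusLift

variable {m : ℕ} {V : Type*} [NormedAddCommGroup V] [NormedSpace ℝ V]

theorem toTorus_add (x y : RVec m) : toTorus (x + y) = toTorus x + toTorus y := rfl

theorem toTorus_sub (x y : RVec m) : toTorus (x - y) = toTorus x - toTorus y := rfl

/-- The covering map as a homomorphism. -/
def toTorusHom (m : ℕ) : RVec m →+ Torus m where
  toFun := toTorus
  map_zero' := rfl
  map_add' := toTorus_add

theorem toTorus_zsmul (k : ℤ) (x : RVec m) : toTorus (k • x) = k • toTorus x :=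
  (toTorusHom m).map_zsmul k x

/-- Continuity on the torus can thus be tested on lifts, and images of neighbourhoods are
neighbourhoods. -/
theorem isOpenQuotientMap_toTorus : IsOpenQuotientMap (toTorus : RVec m → Torus m) := by
  have h1 : IsOpenQuotientMap (Pi.map fun (_ : Fin m) (x : ℝ) => (x : UnitAddCircle)) :=
    IsOpenQuotientMap.piMap fun _ => QuotientAddGroup.isOpenQuotientMap_mk
  have h2 := (EuclideanSpace.equiv (Fin m) ℝ).toHomeomorph.isOpenQuotientMap
  exact h1.comp h2

theorem continuous_toTorus : Continuous (toTorus : RVec m → Torus m) :=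
  isOpenQuotientMap_toTorus.continuous

theorem toTorus_surjective : Function.Surjective (toTorus : RVec m → Torus m) :=
  isOpenQuotientMap_toTorus.surjective

theorem IsCrTorus.continuous {r : ℕ} {κ : Torus m → V} (h : IsCrTorus r κ) : Continuous κ :=
  isOpenQuotientMap_toTorus.continuous_comp_iff.1 (ContDiff.continuous h)

omit [NormedSpace ℝ V] in
theorem exists_norm_le_of_continuous_torus {κ : Torus m → V} (h : Continuous κ) :
    ∃ B : ℝ, 0 ≤ B ∧ ∀ θ, ‖κ θ‖ ≤ B := by
  obtain ⟨B, hB⟩ := (isCompact_range h).isBounded.exists_norm_le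
  exact ⟨max B 0, le_max_right _ _, fun θ => (hB _ ⟨θ, rfl⟩).trans (le_max_left _ _)⟩

omit [NormedSpace ℝ V] in
theorem exists_norm_le_of_periodic {g : RVec m → V} (h : Continuous g)
    (hg : ∀ x x', toTorus x = toTorus x' → g x = g x') : ∃ B : ℝ, 0 ≤ B ∧ ∀ x, ‖g x‖ ≤ B := by
  choose s hs using (toTorus_surjective : Function.Surjective (toTorus : RVec m → Torus m))
  have e : g = fun x => g (s (toTorus x)) := funext fun x => (hg _ _ (hs _)).symm
  have hc : Continuous fun θ => g (s θ) :=
    isOpenQuotientMap_toTorus.continuous_comp_iff.1 (by rw [e] at h; exact h)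
  obtain ⟨B, hB0, hB⟩ := exists_norm_le_of_continuous_torus hc
  exact ⟨B, hB0, fun x => by rw [e]; exact hB _⟩

/-- The lift is invariant under translation by the period `x' - x`. Hence derivatives of lifts
descend to the compact torus, which bounds them when they are continuous. -/
theorem iteratedFDeriv_comp_toTorus_eq (κ : Torus m → V) (i : ℕ) {x x' : RVec m}
    (h : toTorus x = toTorus x') :
    iteratedFDeriv ℝ i (fun y => κ (toTorus y)) x = iteratedFDeriv ℝ i (fun y => κ (toTorus y)) x' := by
  have e : (fun y => κ (toTorus y)) = fun y : RVec m => κ (toTorus (y + (x' - x))) := by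
    funext y
    rw [toTorus_add, toTorus_sub, h, sub_self, add_zero]
  conv_lhs => rw [e]
  rw [iteratedFDeriv_comp_add_right (f := fun y => κ (toTorus y))]
  congr 1
  abel

end TorusLift

theorem IsCrTorus.exists_hasCkBound {m : ℕ} {V : Type} [NormedAddCommGroup V] [NormedSpace ℝ V]
    {r : ℕ} {κ : Torus m → V} (h : IsCrTorus r κ) :
    ∃ B : ℝ, 0 ≤ B ∧ HasCkBound r B fun y => κ (toTorus y) := by
  have h1 : ∀ i, ∃ B : ℝ, 0 ≤ B ∧
      (i ≤ r → ∀ x, ‖iteratedFDeriv ℝ i (fun y => κ (toTorus y)) x‖ ≤ B) := by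
    intro i
    by_cases hi : i ≤ r
    · obtain ⟨B, hB0, hB⟩ := exists_norm_le_of_periodic
        (ContDiff.continuous_iteratedFDeriv (m := i) (by exact_mod_cast hi) h)
        fun x x' hx => iteratedFDeriv_comp_toTorus_eq κ i hx
      exact ⟨B, hB0, fun _ => hB⟩
    · exact ⟨0, le_rfl, fun h => absurd h hi⟩
  choose B hB0 hB using h1
  refine ⟨∑ i ∈ Finset.range (r + 1), B i, Finset.sum_nonneg fun i _ => hB0 i, h, fun i hi y => ?_⟩
  exact (hB i hi y).trans (Finset.single_le_sum (f := B) (fun i _ => hB0 i)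
    (Finset.mem_range.2 (by omega)))

/-! ### Extended-real norms and pointwise bounds -/

section Norms

variable {n m : ℕ}

theorem crTorusNorm_le_ofReal_iff {V : Type*} [NormedAddCommGroup V] [NormedSpace ℝ V] {r : ℕ}
    {κ : Torus m → V} {b : ℝ} (hb : 0 ≤ b) : crTorusNorm r κ ≤ ENNReal.ofReal b ↔
      ∀ i ≤ r, ∀ x : RVec m, ‖iteratedFDeriv ℝ i (fun y => κ (toTorus y)) x‖ ≤ b := by
  simp only [crTorusNorm, iSup_le_iff, mem_Iic, ← ofReal_norm,
    ENNReal.ofReal_le_ofReal_iff hb]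

theorem norm_le_of_crTorusNorm_lt {κ : Torus m → RVec n} {b : ℝ}
    (h : crTorusNorm 0 κ < ENNReal.ofReal b) : ∃ b' < b, ∀ θ, ‖κ θ‖ ≤ b' := by
  have hb : 0 < b := ENNReal.ofReal_pos.1 (bot_le.trans_lt h)
  refine ⟨(crTorusNorm 0 κ).toReal, ?_, fun θ => ?_⟩
  · exact (ENNReal.lt_ofReal_iff_toReal_lt h.ne_top).1 h
  · obtain ⟨x, rfl⟩ := toTorus_surjective θ
    have := (crTorusNorm_le_ofReal_iff ENNReal.toReal_nonneg).1
      (ENNReal.ofReal_toReal h.ne_top).ge 0 le_rfl x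
    simpa using this

theorem cSigmaNorm_le_ofReal_iff {U : Set (RVec n)} {S : Set (ℕ × ℕ)}
    {f : RVec n → Torus m → RVec n} {b : ℝ} (hb : 0 ≤ b) : cSigmaNorm U S f ≤ ENNReal.ofReal b ↔
      ∀ i j, (i, j) ∈ S → ∀ z ∈ U, ∀ x : RVec m, ‖mixedDeriv i j f z x‖ ≤ b := by
  simp only [cSigmaNorm, iSup_le_iff, ← ofReal_norm,
    ENNReal.ofReal_le_ofReal_iff hb, Prod.forall]

theorem cSigmaNorm_lt_top {U : Set (RVec n)} {S : Set (ℕ × ℕ)}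
    {f : RVec n → Torus m → RVec n} (h : cSigmaNorm U S f < ∞) : ∃ b : ℝ, 0 ≤ b ∧
      ∀ i j, (i, j) ∈ S → ∀ z ∈ U, ∀ x : RVec m, ‖mixedDeriv i j f z x‖ ≤ b :=
  ⟨_, ENNReal.toReal_nonneg, (cSigmaNorm_le_ofReal_iff ENNReal.toReal_nonneg).1
    (ENNReal.ofReal_toReal h.ne).ge⟩

end Norms

/-! ### Consequences of bounded derivatives in the class `Σ_{r,1}` -/

section MixedBounds

universe u

variable {X Y E : Type u} [NormedAddCommGroup X] [NormedSpace ℝ X] [NormedAddCommGroup Y]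
  [NormedSpace ℝ Y] [NormedAddCommGroup E] [NormedSpace ℝ E]

theorem isLowerSet_sigmaRS (r s : ℕ) : IsLowerSet (sigmaRS r s) := by
  rintro ⟨i, j⟩ ⟨i', j'⟩ ⟨h1, h2⟩ ⟨h3, h4⟩
  simp only [sigmaRS, mem_ofPred_eq] at *
  omega

/-- The identification of `(0, 1)`-derivatives with linear maps. -/
noncomputable def evZeroOne (X Y E : Type u) [NormedAddCommGroup X] [NormedSpace ℝ X]
    [NormedAddCommGroup Y] [NormedSpace ℝ Y] [NormedAddCommGroup E] [NormedSpace ℝ E] :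
    (Y [×0]→L[ℝ] X [×1]→L[ℝ] E) ≃ₗᵢ[ℝ] (X →L[ℝ] E) :=
  (continuousMultilinearCurryFin0 ℝ Y (X [×1]→L[ℝ] E)).trans (continuousMultilinearCurryFin1 ℝ X E)

/-- The identification of `(0, 0)`-derivatives with values. -/
noncomputable def evZeroZero (X Y E : Type u) [NormedAddCommGroup X] [NormedSpace ℝ X]
    [NormedAddCommGroup Y] [NormedSpace ℝ Y] [NormedAddCommGroup E] [NormedSpace ℝ E] :
    (Y [×0]→L[ℝ] X [×0]→L[ℝ] E) ≃ₗᵢ[ℝ] E :=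
  (continuousMultilinearCurryFin0 ℝ Y (X [×0]→L[ℝ] E)).trans (continuousMultilinearCurryFin0 ℝ X E)

theorem evZeroOne_mixedD (φ : X → Y → E) (p : X × Y) :
    evZeroOne X Y E (mixedD φ 0 1 p) = fderiv ℝ (fun w => φ w p.2) p.1 := by
  ext v
  simp [evZeroOne, mixedD, iteratedFDeriv_one_apply]

theorem evZeroZero_mixedD (φ : X → Y → E) (p : X × Y) :
    evZeroZero X Y E (mixedD φ 0 0 p) = φ p.1 p.2 := by
  simp [evZeroZero, mixedD]

set_option maxSynthPendingDepth 2 in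
theorem norm_fderiv_sub_eq_mixedD (φ ψ : X → Y → E) (p q : X × Y) :
    ‖fderiv ℝ (fun w => φ w p.2) p.1 - fderiv ℝ (fun w => ψ w q.2) q.1‖ =
      ‖mixedD φ 0 1 p - mixedD ψ 0 1 q‖ := by
  rw [← evZeroOne_mixedD, ← evZeroOne_mixedD, ← map_sub, LinearIsometryEquiv.norm_map]

set_option maxSynthPendingDepth 2 in
theorem norm_sub_eq_mixedD (φ ψ : X → Y → E) (p q : X × Y) :
    ‖φ p.1 p.2 - ψ q.1 q.2‖ = ‖mixedD φ 0 0 p - mixedD ψ 0 0 q‖ := by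
  rw [← evZeroZero_mixedD φ, ← evZeroZero_mixedD ψ, ← map_sub, LinearIsometryEquiv.norm_map]

set_option maxSynthPendingDepth 2 in
theorem norm_fderiv_eq_mixedD (φ : X → Y → E) (p : X × Y) :
    ‖fderiv ℝ (fun w => φ w p.2) p.1‖ = ‖mixedD φ 0 1 p‖ := by
  rw [← evZeroOne_mixedD, LinearIsometryEquiv.norm_map]

theorem norm_eq_mixedD (φ : X → Y → E) (p : X × Y) : ‖φ p.1 p.2‖ = ‖mixedD φ 0 0 p‖ := by
  rw [← evZeroZero_mixedD φ, LinearIsometryEquiv.norm_map]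

theorem HasMixedD.mixedD_sub {U : Set X} {S : Set (ℕ × ℕ)} {φ ψ : X → Y → E} (hU : IsOpen U)
    (hφ : HasMixedD U S φ) (hψ : HasMixedD U S ψ) {i j : ℕ} (hij : (i, j) ∈ S) {p : X × Y}
    (hp : p.1 ∈ U) : mixedD (fun z y => φ z y - ψ z y) i j p = mixedD φ i j p - mixedD ψ i j p := by
  have h1 : (fun y => iteratedFDeriv ℝ j (fun w => φ w y - ψ w y) p.1) =
      (fun y => iteratedFDeriv ℝ j (fun w => φ w y) p.1) -
        fun y => iteratedFDeriv ℝ j (fun w => ψ w y) p.1 := by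
    funext y
    exact iteratedFDeriv_sub_apply (((hφ _ hij).1 y).contDiffAt (hU.mem_nhds hp))
      (((hψ _ hij).1 y).contDiffAt (hU.mem_nhds hp))
  rw [mixedD, h1]
  exact iteratedFDeriv_sub_apply ((hφ _ hij).2.1 _ hp).contDiffAt ((hψ _ hij).2.1 _ hp).contDiffAt

/-- The mixed derivatives of `φ` with indices in `Σ_{r,1}` exist, are continuous and are bounded
by `B`. -/
structure MixedBound (U : Set X) (r : ℕ) (B : ℝ) (φ : X → Y → E) : Prop where
  hasMixedD : HasMixedD U (sigmaRS r 1) φ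
  bound : ∀ i j, i ≤ r → i + j ≤ r + 1 → ∀ p : X × Y, p.1 ∈ U → ‖mixedD φ i j p‖ ≤ B

namespace MixedBound

variable {U : Set X} {r : ℕ} {B : ℝ} {φ : X → Y → E}

theorem mono {B' : ℝ} (h : MixedBound U r B φ) (hB : B ≤ B') : MixedBound U r B' φ :=
  ⟨h.hasMixedD, fun i j hi hij p hp => (h.bound i j hi hij p hp).trans hB⟩

theorem differentiableAt_left (h : MixedBound U r B φ) (hU : IsOpen U) {z : X} (hz : z ∈ U) (y : Y) :
    DifferentiableAt ℝ (fun w => φ w y) z :=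
  (((h.hasMixedD (0, 1) (by simp [sigmaRS])).1 y).contDiffAt (hU.mem_nhds hz)).differentiableAt
    (by simp)

theorem norm_fderiv_le (h : MixedBound U r B φ) {z : X} (hz : z ∈ U) (y : Y) :
    ‖fderiv ℝ (fun w => φ w y) z‖ ≤ B := by
  rw [norm_fderiv_eq_mixedD φ (z, y)]
  exact h.bound 0 1 (by omega) (by omega) (z, y) hz

theorem continuousOn_fderiv (h : MixedBound U r B φ) :
    ContinuousOn (fun p : X × Y => fderiv ℝ (fun w => φ w p.2) p.1) (U ×ˢ univ) := by
  simp only [← evZeroOne_mixedD]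
  exact (evZeroOne X Y E).continuous.comp_continuousOn (h.hasMixedD (0, 1) (by simp [sigmaRS])).2.2

theorem continuousOn (h : MixedBound U r B φ) :
    ContinuousOn (fun p : X × Y => φ p.1 p.2) (U ×ˢ univ) := by
  simp only [← evZeroZero_mixedD]
  exact (evZeroZero X Y E).continuous.comp_continuousOn
    (h.hasMixedD (0, 0) (by simp [sigmaRS])).2.2

end MixedBound

set_option maxSynthPendingDepth 2 in
-- The set `Σ_{r,1}` contains every index of order at most `r` from `(0, 0)` and from `(0, 1)`, so
-- the chain of mixed derivatives makes both `φ` and `D_z φ` jointly `C^r`. Differences at two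
-- points need only mixed derivatives with `i + j ≤ r`, the ones in which the perturbation is small.
theorem exists_contDiffAt_uncurry (X Y E : Type u) [NormedAddCommGroup X] [NormedSpace ℝ X]
    [NormedAddCommGroup Y] [NormedSpace ℝ Y] [NormedAddCommGroup E] [NormedSpace ℝ E] (r : ℕ) :
    ∃ K : ℝ, 0 ≤ K ∧ ∀ (U : Set X) (B : ℝ) (φ ψ : X → Y → E), IsOpen U → MixedBound U r B φ →
      MixedBound U r B ψ → ∀ p q : X × Y, p.1 ∈ U → q.1 ∈ U →
      ContDiffAt ℝ r (fun p : X × Y => φ p.1 p.2) p ∧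
      ContDiffAt ℝ r (fun p : X × Y => fderiv ℝ (fun w => φ w p.2) p.1) p ∧
      ∀ a ≤ r, ‖iteratedFDeriv ℝ a (fun p : X × Y => φ p.1 p.2) p‖ ≤ K * B ∧
        ‖iteratedFDeriv ℝ a (fun p : X × Y => fderiv ℝ (fun w => φ w p.2) p.1) p‖ ≤ K * B ∧
        ∀ η, (∀ i j, i + j ≤ r → ‖mixedD φ i j p - mixedD ψ i j q‖ ≤ η) →
          ‖iteratedFDeriv ℝ a (fun p : X × Y => φ p.1 p.2) p -
            iteratedFDeriv ℝ a (fun p : X × Y => ψ p.1 p.2) q‖ ≤ K * η := by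
  obtain ⟨L₁, L₂, hL⟩ := exists_mixedChain X Y E
  choose K hK0 hK using fun a i j =>
    MixedChain.exists_norm_iteratedFDeriv_sub_le (X := X) (Y := Y)
      (V := fun i j => Y [×i]→L[ℝ] X [×j]→L[ℝ] E) L₁ L₂ a i j
  have hle : ∀ a ≤ r, K a 0 0 ≤ ∑ a ∈ Finset.range (r + 1), (K a 0 0 + K a 0 1) ∧
      K a 0 1 ≤ ∑ a ∈ Finset.range (r + 1), (K a 0 0 + K a 0 1) := by
    intro a ha
    have := Finset.single_le_sum (f := fun a => K a 0 0 + K a 0 1)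
      (fun i _ => add_nonneg (hK0 i 0 0) (hK0 i 0 1)) (Finset.mem_range.2 (by omega : a < r + 1))
    constructor <;> linarith [hK0 a 0 0, hK0 a 0 1]
  refine ⟨∑ a ∈ Finset.range (r + 1), (K a 0 0 + K a 0 1),
    Finset.sum_nonneg fun i _ => add_nonneg (hK0 i 0 0) (hK0 i 0 1),
    fun U B φ ψ hU hφ hψ p q hp hq => ?_⟩
  have cφ := hL U _ φ hU (isLowerSet_sigmaRS r 1) hφ.hasMixedD
  have cψ := hL U _ ψ hU (isLowerSet_sigmaRS r 1) hψ.hasMixedD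
  have c0 := MixedChain.zero (X := X) (Y := Y)
    (V := fun i j => Y [×i]→L[ℝ] X [×j]→L[ℝ] E) L₁ L₂ U (sigmaRS r 1)
  have hB0 : 0 ≤ B := (norm_nonneg _).trans (hφ.bound 0 0 (by omega) (by omega) p hp)
  have e0 : ∀ φ : X → Y → E, (fun p : X × Y => φ p.1 p.2) =
      fun p => (evZeroZero X Y E).toContinuousLinearEquiv.toContinuousLinearMap (mixedD φ 0 0 p) :=
    fun φ => funext fun p => (evZeroZero_mixedD φ p).symm
  have e1 : (fun p : X × Y => fderiv ℝ (fun w => φ w p.2) p.1) =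
      fun p => (evZeroOne X Y E).toContinuousLinearEquiv.toContinuousLinearMap (mixedD φ 0 1 p) :=
    funext fun p => (evZeroOne_mixedD φ p).symm
  have n0 : ‖(evZeroZero X Y E).toContinuousLinearEquiv.toContinuousLinearMap‖ ≤ 1 :=
    ContinuousLinearMap.opNorm_le_bound _ zero_le_one fun x => by
      rw [one_mul]; exact ((evZeroZero X Y E).norm_map x).le
  have n1 : ‖(evZeroOne X Y E).toContinuousLinearEquiv.toContinuousLinearMap‖ ≤ 1 :=
    ContinuousLinearMap.opNorm_le_bound _ zero_le_one fun x => by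
      rw [one_mul]; exact ((evZeroOne X Y E).norm_map x).le
  have m0 : ∀ i' j' a, a ≤ r → 0 ≤ i' → 0 ≤ j' → i' + j' ≤ 0 + 0 + a → (i', j') ∈ sigmaRS r 1 := by
    intro i' j' a ha _ _ h
    simp only [sigmaRS, mem_ofPred_eq]; omega
  have m1 : ∀ i' j' a, a ≤ r → 0 ≤ i' → 1 ≤ j' → i' + j' ≤ 0 + 1 + a → (i', j') ∈ sigmaRS r 1 := by
    intro i' j' a ha _ _ h
    simp only [sigmaRS, mem_ofPred_eq]; omega
  have d0 : ∀ a ≤ r, ContDiffAt ℝ a (mixedD φ 0 0) p := fun a ha =>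
    cφ.contDiffAt hU a 0 0 (fun i' j' => m0 i' j' a ha) hp
  have d0' : ∀ a ≤ r, ContDiffAt ℝ a (mixedD ψ 0 0) q := fun a ha =>
    cψ.contDiffAt hU a 0 0 (fun i' j' => m0 i' j' a ha) hq
  have d1 : ∀ a ≤ r, ContDiffAt ℝ a (mixedD φ 0 1) p := fun a ha =>
    cφ.contDiffAt hU a 0 1 (fun i' j' => m1 i' j' a ha) hp
  refine ⟨?_, ?_, fun a ha => ⟨?_, ?_, fun η hη => ?_⟩⟩
  · rw [e0]
    exact (evZeroZero X Y E).toContinuousLinearEquiv.toContinuousLinearMap.contDiff.contDiffAt.comp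
      p (d0 r le_rfl)
  · rw [e1]
    exact (evZeroOne X Y E).toContinuousLinearEquiv.toContinuousLinearMap.contDiff.contDiffAt.comp
      p (d1 r le_rfl)
  · rw [e0]
    have h1 := norm_iteratedFDeriv_clm_comp_sub_le
      (evZeroZero X Y E).toContinuousLinearEquiv.toContinuousLinearMap
      (d0 a ha) (g := fun _ => 0) (q := p) contDiffAt_const
    have h2 := hK a 0 0 U _ _ _ p p B hU cφ c0 hp hp (fun i' j' => m0 i' j' a ha)
      fun i' j' _ _ h => by simpa using hφ.bound i' j' (by omega) (by omega) p hp
    simp only [map_zero] at h1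
    have hz : ∀ (W : Type u) [NormedAddCommGroup W] [NormedSpace ℝ W],
        iteratedFDeriv ℝ a (fun _ : X × Y => (0 : W)) p = 0 := fun W _ _ => by
      exact congrFun iteratedFDeriv_fun_zero p
    rw [hz, sub_zero, hz, sub_zero] at h1
    rw [hz, sub_zero] at h2
    calc _ ≤ 1 * (K a 0 0 * B) := h1.trans (mul_le_mul n0 h2 (norm_nonneg _) zero_le_one)
      _ ≤ _ := by rw [one_mul]; exact mul_le_mul_of_nonneg_right (hle a ha).1 hB0
  · rw [e1]
    have h1 := norm_iteratedFDeriv_clm_comp_sub_le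
      (evZeroOne X Y E).toContinuousLinearEquiv.toContinuousLinearMap
      (d1 a ha) (g := fun _ => 0) (q := p) contDiffAt_const
    have h2 := hK a 0 1 U _ _ _ p p B hU cφ c0 hp hp (fun i' j' => m1 i' j' a ha)
      fun i' j' _ _ h => by simpa using hφ.bound i' j' (by omega) (by omega) p hp
    simp only [map_zero] at h1
    have hz : ∀ (W : Type u) [NormedAddCommGroup W] [NormedSpace ℝ W],
        iteratedFDeriv ℝ a (fun _ : X × Y => (0 : W)) p = 0 := fun W _ _ => by
      exact congrFun iteratedFDeriv_fun_zero p
    rw [hz, sub_zero, hz, sub_zero] at h1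
    rw [hz, sub_zero] at h2
    calc _ ≤ 1 * (K a 0 1 * B) := h1.trans (mul_le_mul n1 h2 (norm_nonneg _) zero_le_one)
      _ ≤ _ := by rw [one_mul]; exact mul_le_mul_of_nonneg_right (hle a ha).2 hB0
  · rw [e0 φ, e0 ψ]
    have hη0 : 0 ≤ η := (norm_nonneg _).trans (hη 0 0 (by omega))
    have h1 := norm_iteratedFDeriv_clm_comp_sub_le
      (evZeroZero X Y E).toContinuousLinearEquiv.toContinuousLinearMap (d0 a ha) (d0' a ha)
    have h2 := hK a 0 0 U _ _ _ p q η hU cφ cψ hp hq (fun i' j' => m0 i' j' a ha)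
      fun i' j' _ _ h => hη i' j' (by omega)
    calc _ ≤ 1 * (K a 0 0 * η) := h1.trans (mul_le_mul n0 h2 (norm_nonneg _) zero_le_one)
      _ ≤ _ := by rw [one_mul]; exact mul_le_mul_of_nonneg_right (hle a ha).1 hη0

set_option maxSynthPendingDepth 2 in
-- Mean value inequality in the first variable. In `Σ_{r,1}` the index `(i, j + 1)` is available
-- whenever `i + j ≤ r`; this is the use of the extra `z`-derivative.
theorem MixedChain.exists_norm_sub_le {V : ℕ → ℕ → Type u} [∀ i j, NormedAddCommGroup (V i j)]
    [∀ i j, NormedSpace ℝ (V i j)] (L₁ : ∀ i j, V i (j + 1) →L[ℝ] (X →L[ℝ] V i j))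
    (L₂ : ∀ i j, V (i + 1) j →L[ℝ] (Y →L[ℝ] V i j)) (r : ℕ) :
    ∃ K : ℝ, 0 ≤ K ∧ ∀ (U : Set X) (S : Set (ℕ × ℕ)) (h : ∀ i j, X × Y → V i j) (B : ℝ),
      MixedChain L₁ L₂ U S h → ∀ i j, i + j ≤ r → (i, j + 1) ∈ S →
      (∀ p : X × Y, p.1 ∈ U → ‖h i (j + 1) p‖ ≤ B) → ∀ s : Set X, Convex ℝ s → s ⊆ U →
      ∀ z ∈ s, ∀ z' ∈ s, ∀ y, ‖h i j (z, y) - h i j (z', y)‖ ≤ K * B * ‖z - z'‖ := by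
  refine ⟨∑ i ∈ Finset.range (r + 1), ∑ j ∈ Finset.range (r + 1), ‖L₁ i j‖,
    Finset.sum_nonneg fun i _ => Finset.sum_nonneg fun j _ => norm_nonneg (L₁ i j),
    fun U S h B hh i j hij hS hB s hs hsU z hz z' hz' y => ?_⟩
  have hle : ‖L₁ i j‖ ≤ ∑ i ∈ Finset.range (r + 1), ∑ j ∈ Finset.range (r + 1), ‖L₁ i j‖ :=
    (Finset.single_le_sum (f := fun j => ‖L₁ i j‖) (fun j _ => norm_nonneg (L₁ i j))
      (Finset.mem_range.2 (by omega : j < r + 1))).trans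
    (Finset.single_le_sum (f := fun i => ∑ j ∈ Finset.range (r + 1), ‖L₁ i j‖)
      (fun i _ => Finset.sum_nonneg fun j _ => norm_nonneg (L₁ i j))
      (Finset.mem_range.2 (by omega : i < r + 1)))
  exact hs.norm_image_sub_le_of_norm_hasFDerivWithin_le (f := fun z => h i j (z, y))
    (f' := fun z => L₁ i j (h i (j + 1) (z, y)))
    (fun x hx => (hh.hasFDerivAt_left i j hS x (hsU hx) y).hasFDerivWithinAt)
    (fun x hx => ((L₁ i j).le_opNorm _).trans (mul_le_mul hle (hB (x, y) (hsU hx)) (norm_nonneg _)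
      ((norm_nonneg _).trans hle))) hz' hz

/-- Mixed derivatives of order at most `r` are Lipschitz in the first variable. -/
theorem exists_norm_mixedD_sub_le (X Y E : Type u) [NormedAddCommGroup X] [NormedSpace ℝ X]
    [NormedAddCommGroup Y] [NormedSpace ℝ Y] [NormedAddCommGroup E] [NormedSpace ℝ E] (r : ℕ) :
    ∃ K : ℝ, 0 ≤ K ∧ ∀ (U : Set X) (B : ℝ) (φ : X → Y → E), IsOpen U → MixedBound U r B φ →
      ∀ i j, i + j ≤ r → ∀ s : Set X, Convex ℝ s → s ⊆ U → ∀ z ∈ s, ∀ z' ∈ s, ∀ y,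
        ‖mixedD φ i j (z, y) - mixedD φ i j (z', y)‖ ≤ K * B * ‖z - z'‖ := by
  obtain ⟨L₁, L₂, hL⟩ := exists_mixedChain X Y E
  obtain ⟨K, hK, h⟩ := MixedChain.exists_norm_sub_le (X := X) (Y := Y)
    (V := fun i j => Y [×i]→L[ℝ] X [×j]→L[ℝ] E) L₁ L₂ r
  exact ⟨K, hK, fun U B φ hU hφ i j hij => h U _ _ B
    (hL U _ φ hU (isLowerSet_sigmaRS r 1) hφ.hasMixedD) i j hij
    (by simp only [sigmaRS, mem_ofPred_eq]; omega) (hφ.bound i (j + 1) (by omega) (by omega))⟩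

theorem fderiv_uncurry_comp_inl {φ : X → Y → E} {p : X × Y}
    (h : DifferentiableAt ℝ (fun p : X × Y => φ p.1 p.2) p) :
    (fderiv ℝ (fun p : X × Y => φ p.1 p.2) p).comp (ContinuousLinearMap.inl ℝ X Y) =
      fderiv ℝ (fun w => φ w p.2) p.1 := by
  have h1 : HasFDerivAt (fun w : X => (w, p.2)) (ContinuousLinearMap.inl ℝ X Y) p.1 :=
    hasFDerivAt_prodMk_left p.1 p.2
  exact (HasFDerivAt.comp (g := fun p : X × Y => φ p.1 p.2) p.1 h.hasFDerivAt h1).fderiv.symm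

theorem fderiv_uncurry_comp_inr {φ : X → Y → E} {p : X × Y}
    (h : DifferentiableAt ℝ (fun p : X × Y => φ p.1 p.2) p) :
    (fderiv ℝ (fun p : X × Y => φ p.1 p.2) p).comp (ContinuousLinearMap.inr ℝ X Y) =
      fderiv ℝ (fun w => φ p.1 w) p.2 := by
  have h1 : HasFDerivAt (fun w : Y => (p.1, w)) (ContinuousLinearMap.inr ℝ X Y) p.2 :=
    hasFDerivAt_prodMk_right p.1 p.2
  exact (HasFDerivAt.comp (g := fun p : X × Y => φ p.1 p.2) p.2 h.hasFDerivAt h1).fderiv.symm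

end MixedBounds

/-! ### Perturbations of a hyperbolic reference solution -/

section Tube

universe u

variable {X Y : Type u} [NormedAddCommGroup X] [NormedSpace ℝ X] [NormedAddCommGroup Y]
  [NormedSpace ℝ Y]

/-- A reference solution `x₀` of `x (k + 1) y = φ₀ (x k y) (y + a k)` whose linearization has Green
kernels, in a tube of radius `2ρ` on which the derivative of `φ₀` varies by at most `δ / 2`. -/
structure HyperbolicTube (U : Set X) (r : ℕ) (B : ℝ) (φ₀ : X → Y → X) (a : ℤ → Y) (x₀ : ℤ → Y → X)
    (G : Y → ℤ → ℤ → X →L[ℝ] X) (C ν δ ρ : ℝ) : Prop where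
  isOpen : IsOpen U
  mixedBound : MixedBound U r B φ₀
  hasCkBound : ∀ k, HasCkBound r B (x₀ k)
  equicontinuous : ∀ y, ∀ ε > 0, ∀ᶠ y' in 𝓝 y, ∀ k, ‖x₀ k y' - x₀ k y‖ ≤ ε
  solves : ∀ k y, x₀ (k + 1) y = φ₀ (x₀ k y) (y + a k)
  rho_pos : 0 < ρ
  closedBall_subset : ∀ k y, Metric.closedBall (x₀ k y) (2 * ρ) ⊆ U
  tube : ∀ k y, ∀ z ∈ Metric.closedBall (x₀ k y) (2 * ρ),
    ‖fderiv ℝ (fun w => φ₀ w (y + a k)) z - fderiv ℝ (fun w => φ₀ w (y + a k)) (x₀ k y)‖ ≤ δ / 2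
  isGreen : ∀ y, IsGreen (fun k => fderiv ℝ (fun w => φ₀ w (y + a k)) (x₀ k y)) (G y) C ν
  small : C * greenSum ν * δ ≤ 1 / 2

/-- `e`-closeness of `φ` to `φ₀` in the norm of `C^{Σ_r^+}`. -/
structure IsClosePerturbation (U : Set X) (r : ℕ) (B : ℝ) (φ₀ : X → Y → X) (φ : X → Y → X)
    (e : ℝ) : Prop where
  mixedBound : MixedBound U r B φ
  close : ∀ i j, i + j ≤ r → ∀ p : X × Y, p.1 ∈ U → ‖mixedD φ i j p - mixedD φ₀ i j p‖ ≤ e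
  -- Implied by `close` when `r ≥ 1`; for `r = 0` it supplies the closeness of `D_z φ` that makes
  -- the nonlinearity a contraction.
  close_fderiv : ∀ p : X × Y, p.1 ∈ U → ‖mixedD φ 0 1 p - mixedD φ₀ 0 1 p‖ ≤ e

variable {U : Set X} {r : ℕ} {B B' C ν δ ρ e : ℝ} {φ₀ : X → Y → X} {a : ℤ → Y} {x₀ : ℤ → Y → X}
  {G : Y → ℤ → ℤ → X →L[ℝ] X}

theorem IsClosePerturbation.nonneg {φ : X → Y → X} (h : IsClosePerturbation U r B' φ₀ φ e) {z : X}
    (hz : z ∈ U) : 0 ≤ e := by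
  have h1 := h.close 0 0 (by omega) (z, 0) hz
  rw [← norm_sub_eq_mixedD] at h1
  exact (norm_nonneg _).trans h1

namespace HyperbolicTube

theorem mem (T : HyperbolicTube U r B φ₀ a x₀ G C ν δ ρ) {k : ℤ} {y : Y} {z : X}
    (hz : ‖z - x₀ k y‖ ≤ 2 * ρ) : z ∈ U :=
  T.closedBall_subset k y (by rwa [mem_closedBall_iff_norm])

theorem bound_nonneg (T : HyperbolicTube U r B φ₀ a x₀ G C ν δ ρ) : 0 ≤ B :=
  (norm_nonneg _).trans ((T.hasCkBound 0).2 0 (by omega) 0)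

theorem delta_nonneg (T : HyperbolicTube U r B φ₀ a x₀ G C ν δ ρ) : 0 ≤ δ := by
  have := (norm_nonneg _).trans (T.tube 0 0 (x₀ 0 0)
    (Metric.mem_closedBall_self (by linarith [T.rho_pos])))
  linarith

/-- Half of `δ` pays for the oscillation of `D_z φ₀` in the tube, half for the distance between `D_z
φ` and `D_z φ₀`. -/
theorem norm_fderiv_sub_le (T : HyperbolicTube U r B φ₀ a x₀ G C ν δ ρ) {φ : X → Y → X}
    (hφ : IsClosePerturbation U r B' φ₀ φ e) (he : e ≤ δ / 2) (k : ℤ) (y : Y) {z : X}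
    (hz : ‖z - x₀ k y‖ ≤ 2 * ρ) :
    ‖fderiv ℝ (fun w => φ w (y + a k)) z - fderiv ℝ (fun w => φ₀ w (y + a k)) (x₀ k y)‖ ≤ δ := by
  have h1 := hφ.close_fderiv (z, y + a k) (T.mem hz)
  rw [← norm_fderiv_sub_eq_mixedD φ φ₀ (z, y + a k) (z, y + a k)] at h1
  have h2 := T.tube k y z (by rwa [mem_closedBall_iff_norm])
  have h3 := norm_sub_le_norm_sub_add_norm_sub (fderiv ℝ (fun w => φ w (y + a k)) z)
    (fderiv ℝ (fun w => φ₀ w (y + a k)) z) (fderiv ℝ (fun w => φ₀ w (y + a k)) (x₀ k y))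
  simp only at h1
  linarith

/-- Mean value inequality on the convex ball around the reference point: in the tube, `φ` minus the
reference linearization is `δ`-Lipschitz. -/
theorem norm_sub_sub_le (T : HyperbolicTube U r B φ₀ a x₀ G C ν δ ρ) {φ : X → Y → X}
    (hφ : IsClosePerturbation U r B' φ₀ φ e) (he : e ≤ δ / 2) (k : ℤ) (y : Y) {z z' : X}
    (hz : ‖z - x₀ k y‖ ≤ 2 * ρ) (hz' : ‖z' - x₀ k y‖ ≤ 2 * ρ) :
    ‖φ z (y + a k) - φ z' (y + a k) -
      fderiv ℝ (fun w => φ₀ w (y + a k)) (x₀ k y) (z - z')‖ ≤ δ * ‖z - z'‖ := by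
  rw [← mem_closedBall_iff_norm] at hz hz'
  refine (convex_closedBall (x₀ k y) (2 * ρ)).norm_image_sub_le_of_norm_hasFDerivWithin_le'
    (f := fun w => φ w (y + a k)) (f' := fun w => fderiv ℝ (fun w => φ w (y + a k)) w)
    (fun w hw => (hφ.mixedBound.differentiableAt_left T.isOpen (T.closedBall_subset k y hw)
      _).hasFDerivAt.hasFDerivWithinAt) (fun w hw => ?_) hz' hz
  exact T.norm_fderiv_sub_le hφ he k y (by rwa [mem_closedBall_iff_norm] at hw)

/-- The difference of two nearby orbits almost solves the linearized equation. -/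
theorem norm_defect_le (T : HyperbolicTube U r B φ₀ a x₀ G C ν δ ρ) {φ : ℤ → X → Y → X}
    (hφ : ∀ k, IsClosePerturbation U r B' φ₀ (φ k) e) (he : e ≤ δ / 2) {x : ℤ → Y → X}
    (hx : ∀ k y, x (k + 1) y = φ k (x k y) (y + a k)) (hxρ : ∀ k y, ‖x k y - x₀ k y‖ ≤ ρ)
    (y : Y) : ∀ᶠ y' in 𝓝 y, ∀ k, x k y ∈ U ∧
      ‖x (k + 1) y' - x (k + 1) y - fderiv ℝ (fun w => φ₀ w (y' + a k)) (x₀ k y') (x k y' - x k y)‖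
      ≤ δ * ‖x k y' - x k y‖ + ‖φ k (x k y) (y' + a k) - φ k (x k y) (y + a k)‖ := by
  have hr := T.rho_pos
  filter_upwards [T.equicontinuous y ρ hr] with y' hy' k
  -- The increment is compared with the linearization at the moving parameter `y'`. The factor `2`
  -- in the tube radius leaves room for `x k y`, by equicontinuity of the reference solution.
  have h0 : ‖x k y - x₀ k y'‖ ≤ 2 * ρ := by
    have := norm_sub_le_norm_sub_add_norm_sub (x k y) (x₀ k y) (x₀ k y')
    rw [norm_sub_rev (x₀ k y)] at this
    linarith [hxρ k y, hy' k]
  refine ⟨T.mem h0, ?_⟩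
  have h1 := T.norm_sub_sub_le (hφ k) he k y' (z := x k y') (z' := x k y)
    (by linarith [hxρ k y']) h0
  calc _ = ‖(φ k (x k y') (y' + a k) - φ k (x k y) (y' + a k) -
        fderiv ℝ (fun w => φ₀ w (y' + a k)) (x₀ k y') (x k y' - x k y)) +
        (φ k (x k y) (y' + a k) - φ k (x k y) (y + a k))‖ := by
        rw [hx k y', hx k y]; congr 1; abel
    _ ≤ _ := (norm_add_le _ _).trans (add_le_add h1 le_rfl)

theorem norm_sub_le_of_near (T : HyperbolicTube U r B φ₀ a x₀ G C ν δ ρ) {x : ℤ → Y → X}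
    (hxρ : ∀ k y, ‖x k y - x₀ k y‖ ≤ ρ) (k : ℤ) (y y' : Y) :
    ‖x k y' - x k y‖ ≤ 2 * (ρ + B) := by
  have h1 := norm_sub_le (x k y') (x k y)
  have h2 : ∀ y, ‖x k y‖ ≤ ρ + B := fun y => by
    have := norm_le_norm_sub_add (x k y) (x₀ k y)
    linarith [hxρ k y, (T.hasCkBound k).norm_le y]
  linarith [h2 y, h2 y']

variable [CompleteSpace X]

/-- The defect of `x - x₀` is `δ`-Lipschitz plus the value of `φ - φ₀` on the reference orbit, which
is at most `e`; the a priori estimate then gives the linear rate. -/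
theorem norm_sub_reference_le (T : HyperbolicTube U r B φ₀ a x₀ G C ν δ ρ) {φ : ℤ → X → Y → X}
    (hφ : ∀ k, IsClosePerturbation U r B' φ₀ (φ k) e) (he : e ≤ δ / 2) {y : Y} {x : ℤ → X}
    (hx : ∀ k, x (k + 1) = φ k (x k) (y + a k)) (hxρ : ∀ k, ‖x k - x₀ k y‖ ≤ 2 * ρ) (k : ℤ) :
    ‖x k - x₀ k y‖ ≤ 2 * (C * greenSum ν) * e := by
  have hr := T.rho_pos
  have he0 : 0 ≤ e := (hφ 0).nonneg (T.mem (k := 0) (y := 0) (z := x₀ 0 0) (by simpa using hr.le))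
  refine (T.isGreen y).norm_le_of_approx T.delta_nonneg T.small he0 (u := fun k => x k - x₀ k y)
    hxρ (fun k => ?_) k
  have h1 := T.norm_sub_sub_le (hφ k) he k y (hxρ k) (z' := x₀ k y) (by simpa using hr.le)
  have h2 := (hφ k).close 0 0 (by omega) (x₀ k y, y + a k) (T.mem (k := k) (y := y)
    (by simpa using hr.le))
  rw [← norm_sub_eq_mixedD (φ k) φ₀ (x₀ k y, y + a k) (x₀ k y, y + a k)] at h2
  simp only [hx, T.solves]
  calc _ = ‖(φ k (x k) (y + a k) - φ k (x₀ k y) (y + a k) -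
        fderiv ℝ (fun w => φ₀ w (y + a k)) (x₀ k y) (x k - x₀ k y)) +
        (φ k (x₀ k y) (y + a k) - φ₀ (x₀ k y) (y + a k))‖ := by congr 1; abel
    _ ≤ _ := (norm_add_le _ _).trans (add_le_add h1 h2)

theorem eq_of_solves (T : HyperbolicTube U r B φ₀ a x₀ G C ν δ ρ) {φ : ℤ → X → Y → X}
    (hφ : ∀ k, IsClosePerturbation U r B' φ₀ (φ k) e) (he : e ≤ δ / 2) {y : Y} {x x' : ℤ → X}
    (hx : ∀ k, x (k + 1) = φ k (x k) (y + a k)) (hxρ : ∀ k, ‖x k - x₀ k y‖ ≤ 2 * ρ)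
    (hx' : ∀ k, x' (k + 1) = φ k (x' k) (y + a k)) (hxρ' : ∀ k, ‖x' k - x₀ k y‖ ≤ 2 * ρ) (k : ℤ) :
    x k = x' k := by
  refine sub_eq_zero.1 ((T.isGreen y).eq_zero_of_approx T.delta_nonneg T.small
    (u := fun k => x k - x' k) (B := 2 * ρ + 2 * ρ) (fun k => ?_) (fun k => ?_) k)
  · rw [← sub_sub_sub_cancel_right (x k) (x' k) (x₀ k y)]
    exact (norm_sub_le _ _).trans (add_le_add (hxρ k) (hxρ' k))
  · simp only [hx, hx']
    exact T.norm_sub_sub_le (hφ k) he k y (hxρ k) (hxρ' k)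

/-- For fixed `k` the defect caused by moving the parameter tends to zero by continuity of `φ k`; it
is bounded by `2 B'` for all `k`. No uniformity in `k` of the convergence is needed. -/
theorem continuous (T : HyperbolicTube U r B φ₀ a x₀ G C ν δ ρ) {φ : ℤ → X → Y → X}
    (hφ : ∀ k, IsClosePerturbation U r B' φ₀ (φ k) e) (he : e ≤ δ / 2) {x : ℤ → Y → X}
    (hx : ∀ k y, x (k + 1) y = φ k (x k y) (y + a k)) (hxρ : ∀ k y, ‖x k y - x₀ k y‖ ≤ ρ) (k : ℤ) :
    Continuous (x k) := by
  have hr := T.rho_pos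
  rw [continuous_iff_continuousAt]
  intro y
  have hU : ∀ k, x k y ∈ U := fun k => T.mem (k := k) (y := y) (by linarith [hxρ k y])
  have hb : ∀ k y', ‖φ k (x k y) (y' + a k)‖ ≤ B' := fun k y' => by
    rw [norm_eq_mixedD (φ k) (x k y, y' + a k)]
    exact (hφ k).mixedBound.bound 0 0 (by omega) (by omega) (x k y, y' + a k) (hU k)
  rw [ContinuousAt, tendsto_iff_norm_sub_tendsto_zero, ← tendsto_zero_iff_norm_tendsto_zero]
  refine tendsto_zero_of_green T.delta_nonneg T.small (R := B' + B')
    (η := fun k y' => ‖φ k (x k y) (y' + a k) - φ k (x k y) (y + a k)‖)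
    (u := fun k y' => x k y' - x k y) ?_ (fun k => ?_) k
  · filter_upwards [T.norm_defect_le hφ he hx hxρ y] with y' hy'
    exact ⟨_, _, T.isGreen y', ⟨_, fun k => T.norm_sub_le_of_near hxρ k y y'⟩,
      fun k => ⟨(hy' k).2, (norm_sub_le _ _).trans (add_le_add (hb k y') (hb k y))⟩⟩
  · rw [← tendsto_zero_iff_norm_tendsto_zero, ← tendsto_sub_nhds_zero_iff]
    have h1 : ContinuousAt (fun p : X × Y => φ k p.1 p.2) (x k y, y + a k) :=
      (hφ k).mixedBound.continuousOn.continuousAt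
        ((T.isOpen.prod isOpen_univ).mem_nhds ⟨hU k, mem_univ _⟩)
    have h2 : Continuous fun y' : Y => (x k y, y' + a k) := by fun_prop
    have h3 := (ContinuousAt.comp (x := y) h1 h2.continuousAt).tendsto
    simpa [Function.comp_def] using h3.sub_const (φ k (x k y) (y + a k))

end HyperbolicTube

end Tube

/-! ### Regularity of solutions in the tube -/

section TubeRegularity

universe u

/-- The second variable enters in a Lipschitz way. -/
theorem exists_norm_sub_right_le (X Y E : Type u) [NormedAddCommGroup X] [NormedSpace ℝ X]
    [NormedAddCommGroup Y] [NormedSpace ℝ Y] [NormedAddCommGroup E] [NormedSpace ℝ E] {r : ℕ}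
    (hr : 1 ≤ r) : ∃ K : ℝ, 0 ≤ K ∧ ∀ (U : Set X) (B : ℝ) (φ : X → Y → E), IsOpen U →
      MixedBound U r B φ → ∀ z ∈ U, ∀ y y', ‖φ z y' - φ z y‖ ≤ K * B * ‖y' - y‖ := by
  obtain ⟨K, hK0, hK⟩ := exists_contDiffAt_uncurry X Y E r
  refine ⟨K, hK0, fun U B φ hU hφ z hz y y' => ?_⟩
  have hd : ∀ y, DifferentiableAt ℝ (fun p : X × Y => φ p.1 p.2) (z, y) := fun y =>
    (hK U B φ φ hU hφ hφ (z, y) (z, y) hz hz).1.differentiableAt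
      (by simp only [ne_eq, Nat.cast_eq_zero]; omega)
  refine convex_univ.norm_image_sub_le_of_norm_fderiv_le (𝕜 := ℝ) (f := fun y => φ z y)
    (fun y _ => ?_) (fun y _ => ?_) (mem_univ y) (mem_univ y')
  · exact DifferentiableAt.comp (g := fun p : X × Y => φ p.1 p.2) y (hd y)
      ((differentiableAt_const z).prodMk differentiableAt_id)
  · have h1 := fderiv_uncurry_comp_inr (hd y)
    simp only at h1
    rw [← h1]
    refine (ContinuousLinearMap.opNorm_comp_le _ _).trans
      ((mul_le_of_le_one_right (norm_nonneg _) norm_inr_le).trans ?_)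
    rw [← norm_iteratedFDeriv_one]
    exact ((hK U B φ φ hU hφ hφ (z, y) (z, y) hz hz).2.2 1 hr).1

set_option maxSynthPendingDepth 2 in
theorem norm_mixedD_sub_le_add {X Y E : Type u} [NormedAddCommGroup X] [NormedSpace ℝ X]
    [NormedAddCommGroup Y] [NormedSpace ℝ Y] [NormedAddCommGroup E] [NormedSpace ℝ E]
    (φ ψ χ : X → Y → E) {i j : ℕ} (p q s : X × Y) : ‖mixedD φ i j p - mixedD χ i j s‖ ≤
      ‖mixedD φ i j p - mixedD ψ i j q‖ + ‖mixedD ψ i j q - mixedD χ i j s‖ :=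
  norm_sub_le_norm_sub_add_norm_sub _ _ _

/-- Regularity of perturbed solutions in the tube, with estimates. -/
theorem exists_hasCkBound_of_perturbation (X Y : Type u) [NormedAddCommGroup X] [NormedSpace ℝ X]
    [CompleteSpace X] [NormedAddCommGroup Y] [NormedSpace ℝ Y] (r : ℕ) {B : ℝ} (hB : 0 ≤ B)
    (C ν C' ν' : ℝ) : ∃ K : ℝ, 0 ≤ K ∧ ∀ (U : Set X) (φ₀ : X → Y → X) (a : ℤ → Y) (x₀ : ℤ → Y → X)
      (G : Y → ℤ → ℤ → X →L[ℝ] X) (δ ρ e B' : ℝ) (φ : ℤ → X → Y → X) (x : ℤ → Y → X)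
      (H : Y → ℤ → ℤ → X →L[ℝ] X), HyperbolicTube U r B φ₀ a x₀ G C ν δ ρ →
      (∀ k, IsClosePerturbation U r B' φ₀ (φ k) e) → e ≤ δ / 2 → e ≤ 1 →
      (∀ k y, x (k + 1) y = φ k (x k y) (y + a k)) → (∀ k y, ‖x k y - x₀ k y‖ ≤ ρ) →
      (∀ y, IsGreen (fun k => fderiv ℝ (fun w => φ k w (y + a k)) (x k y)) (H y) C' ν') →
      (∀ k, HasCkBound r (K * e) fun y => x k y - x₀ k y) ∧
        ∃ K', ∀ k l, HasCkBound r K' fun y => H y k l := by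
  obtain ⟨K₀, hK₀0, hK₀⟩ := exists_contDiffAt_uncurry X Y X r
  obtain ⟨K₁, hK₁0, hK₁⟩ := exists_norm_mixedD_sub_le X Y X r
  set L : ℝ := |2 * (C * greenSum ν)|
  have hL0 : 0 ≤ L := abs_nonneg _
  -- Derivatives of `φ k` along `x` and of `φ₀` along `x₀` differ by `e` from the perturbation plus
  -- `K₁ * B * (L * e)` from moving the base point. The last summand `L` covers the `C^0` distance.
  set D : ℝ := K₀ * (1 + K₁ * B * L) + L
  have hD0 : 0 ≤ D := by positivity
  obtain ⟨K₂, hK₂0, hK₂⟩ := exists_hasCkBound_of_nonlinear.{u} r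
    (B := D + K₀ * B + B) (by positivity) C' ν'
  obtain ⟨K₄, hK₄0, hK₄⟩ := exists_hasCkBound_comp.{u} r (B := K₂ * D + B + 1) (by positivity)
  refine ⟨K₂ * D, by positivity, fun U φ₀ a x₀ G δ ρ e B' φ x H T hφ he he1 hx hxρ hH => ?_⟩
  have hρ := T.rho_pos
  have hU := T.isOpen
  have hx₀U : ∀ k y, x₀ k y ∈ U := fun k y => T.mem (k := k) (y := y) (by simpa using hρ.le)
  have hxU : ∀ k y, x k y ∈ U := fun k y => T.mem (k := k) (y := y) (by linarith [hxρ k y])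
  have he0 : 0 ≤ e := (hφ 0).nonneg (hx₀U 0 0)
  have h2 : ∀ k y, ‖x k y - x₀ k y‖ ≤ 2 * ρ := fun k y => by linarith [hxρ k y]
  have hxe : ∀ k y, ‖x k y - x₀ k y‖ ≤ L * e := fun k y =>
    (T.norm_sub_reference_le hφ he (fun k => hx k y) (fun k => h2 k y) k).trans
      (mul_le_mul_of_nonneg_right (le_abs_self _) he0)
  have hc : ∀ k, Continuous (x k) := T.continuous hφ he hx hxρ
  have hB' : 0 ≤ B' := ((norm_nonneg _).trans
    ((hφ 0).mixedBound.norm_fderiv_le (hx₀U 0 0) (0 : Y)))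
  have hcd : ∀ k y, ContDiffAt ℝ r (fun p : X × Y => φ k p.1 p.2) (x k y, y + a k) := fun k y =>
    (hK₀ U B' (φ k) (φ k) hU (hφ k).mixedBound (hφ k).mixedBound (x k y, y + a k)
      (x k y, y + a k) (hxU k y) (hxU k y)).1
  have hcd₀ : ∀ k y, ContDiffAt ℝ r (fun p : X × Y => φ₀ p.1 p.2) (x₀ k y, y + a k) := fun k y =>
    (hK₀ U B φ₀ φ₀ hU T.mixedBound T.mixedBound (x₀ k y, y + a k) (x₀ k y, y + a k)
      (hx₀U k y) (hx₀U k y)).1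
  have hdiff : 1 ≤ r → ∀ k y,
      DifferentiableAt ℝ (fun p : X × Y => φ k p.1 p.2) (x k y, y + a k) := fun hr k y =>
    (hcd k y).differentiableAt (by simp only [ne_eq, Nat.cast_eq_zero]; omega)
  have hinl : 1 ≤ r → ∀ y, (fun k => (fderiv ℝ (fun p : X × Y => φ k p.1 p.2) (x k y, y + a k)).comp
      (ContinuousLinearMap.inl ℝ X Y)) = fun k => fderiv ℝ (fun w => φ k w (y + a k)) (x k y) :=
    fun hr y => funext fun k => fderiv_uncurry_comp_inl (hdiff hr k y)
  -- The a priori estimate applied to increments in `y` gives a Lipschitz constant uniform in `k`,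
  -- the input for differentiability. Here `B'` enters only qualitatively and does not affect `K`.
  have hd : 1 ≤ r → ∀ y, (∀ k, DifferentiableAt ℝ (x k) y) ∧
      ∀ k, ‖fderiv ℝ (x k) y‖ ≤ C' * greenSum ν' * (K₀ * B') := by
    intro hr y
    obtain ⟨K₆, hK₆0, hK₆⟩ := exists_norm_sub_right_le X Y X hr
    refine hasFDerivAt_of_nonlinear (f := fun k (p : X × Y) => φ k p.1 p.2) (H := H y)
      (B := 2 * (ρ + B)) (L := 2 * (C * greenSum ν) * (K₆ * B')) hx (fun k => hdiff hr k y)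
      (fun k => ?_) (by rw [hinl hr y]; exact hH y)
      (fun k y' => T.norm_sub_le_of_near hxρ k y y') ?_
    · rw [← norm_iteratedFDeriv_one]
      exact ((hK₀ U B' (φ k) (φ k) hU (hφ k).mixedBound (hφ k).mixedBound (x k y, y + a k)
        (x k y, y + a k) (hxU k y) (hxU k y)).2.2 1 hr).1
    · filter_upwards [T.norm_defect_le hφ he hx hxρ y] with y' hy' k
      rw [mul_assoc]
      refine (T.isGreen y').norm_le_of_approx T.delta_nonneg T.small
        (u := fun k => x k y' - x k y) (by positivity)
        (fun k => T.norm_sub_le_of_near hxρ k y y') (fun k => (hy' k).2.trans ?_) k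
      gcongr
      simpa using hK₆ U B' (φ k) hU (hφ k).mixedBound (x k y) (hxU k y) (y + a k) (y' + a k)
  have hsub : ∀ k, HasCkBound r (K₂ * D * e) fun y => x k y - x₀ k y := by
    have := hK₂ X Y (fun k p => φ k p.1 p.2) (fun _ p => φ₀ p.1 p.2) x x₀ a H (D * e)
      (by nlinarith [mul_nonneg hK₀0 hB]) hx T.solves hcd hcd₀ (fun i hi k y => ?_)
      (fun i hi k y => ?_) (fun k => (T.hasCkBound k).mono (by nlinarith [mul_nonneg hK₀0 hB]))
      (fun k y => (hxe k y).trans (by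
        gcongr
        exact le_add_of_nonneg_left (by positivity))) hc (fun hr k y => (hd hr y).1 k)
      (fun hr y => ⟨_, (hd hr y).2⟩) (fun hr y => by rw [hinl hr y]; exact hH y)
    · intro k
      rw [mul_assoc]
      exact this k
    -- The comparison lemma wants one bound for both maps; its estimate of differences does not
    -- depend on that bound.
    · refine (((hK₀ U (max B B') (φ k) φ₀ hU
        ((hφ k).mixedBound.mono (le_max_right _ _)) (T.mixedBound.mono (le_max_left _ _)) (x k y, y + a k)
        (x₀ k y, y + a k) (hxU k y) (hx₀U k y)).2.2 i hi).2.2 ((1 + K₁ * B * L) * e)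
        fun i j hij => ?_).trans ?_
      · have h1 := (hφ k).close i j hij (x k y, y + a k) (hxU k y)
        have h2 := hK₁ U B φ₀ hU T.mixedBound i j hij (Metric.closedBall (x₀ k y) (2 * ρ))
          (convex_closedBall _ _) (T.closedBall_subset k y) (x k y)
          (by rw [mem_closedBall_iff_norm]; linarith [hxρ k y]) (x₀ k y)
          (Metric.mem_closedBall_self (by positivity)) (y + a k)
        have h3 := h2.trans (mul_le_mul_of_nonneg_left (hxe k y) (by positivity))
        refine (norm_mixedD_sub_le_add _ _ _ _ _ _).trans ((add_le_add h1 h3).trans (le_of_eq ?_))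
        ring
      · rw [← mul_assoc]
        gcongr
        exact le_add_of_nonneg_right hL0
    · exact (((hK₀ U B φ₀ φ₀ hU T.mixedBound T.mixedBound (x₀ k y, y + a k)
        (x₀ k y, y + a k) (hx₀U k y) (hx₀U k y)).2.2 i hi).1).trans (by linarith)
  have hxB : ∀ k, HasCkBound r (K₂ * D + B) (x k) := fun k => by
    have := ((hsub k).add (T.hasCkBound k)).mono (b' := K₂ * D + B)
      (add_le_add (mul_le_of_le_one_right (by positivity) he1) le_rfl)
    simpa using this
  have hA : ∀ k, HasCkBound r (K₄ * (K₀ * B'))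
      fun y => fderiv ℝ (fun w => φ k w (y + a k)) (x k y) := fun k =>
    hK₄ Y (X × Y) (X →L[ℝ] X) (fun p => fderiv ℝ (fun w => φ k w p.2) p.1)
      (fun y => (x k y, y + a k)) (K₀ * B')
      (fun y => (hK₀ U B' (φ k) (φ k) hU (hφ k).mixedBound (hφ k).mixedBound (x k y, y + a k)
        (x k y, y + a k) (hxU k y) (hxU k y)).2.1)
      (fun i hi y => ((hK₀ U B' (φ k) (φ k) hU (hφ k).mixedBound (hφ k).mixedBound (x k y, y + a k)
        (x k y, y + a k) (hxU k y) (hxU k y)).2.2 i hi).2.1)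
      ((hxB k).1.prodMk (contDiff_id.add contDiff_const))
      (fun i hi y => by
        obtain ⟨t, rfl⟩ : ∃ t, r = t + 1 := ⟨r - 1, by omega⟩
        exact ((hxB k).fderiv_graph (a k)).2 i (by omega) y)
  obtain ⟨K₅, hK₅0, hK₅⟩ := exists_hasCkBound_of_linear.{u} r (B := K₄ * (K₀ * B')) (by positivity)
    C' ν'
  refine ⟨hsub, K₅ * 1, fun k l => ?_⟩
  -- For fixed `l` the column `H y k l` solves a linear equation in `k` with `C^r` coefficients and
  -- constant impulse, so it is itself `C^r` in `y`.
  exact hK₅ Y (X →L[ℝ] X)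
    (fun k y => postcompL X X (fderiv ℝ (fun w => φ k w (y + a k)) (x k y)))
    (fun y k l => postcompL X X (H y k l)) (fun k _ => if k = l then 1 else 0)
    (fun k y => H y k l) 1 (fun y => (hH y).postcomp X) (fun k => (hA k).postcompL X)
    (fun k => HasCkBound.const r (by
      split_ifs
      · exact ContinuousLinearMap.norm_id_le
      · simp))
    (fun y => ⟨C', fun k => (hH y).bound_const k l⟩)
    (fun k y => by
      have := (hH y).left k l
      rw [sub_eq_iff_eq_add'] at this
      exact this) k

end TubeRegularity

/-! ### The tube around the deterministic torus -/

section ReferenceTorus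

variable {n m : ℕ}

theorem forwardCocycle_eq_fwdProd {Ω : Type*} [MeasurableSpace Ω] {Φ : Ω ≃ᵐ Ω} {α : RVec m}
    (M : Torus m → Ω → RVec n →L[ℝ] RVec n) {t : ℤ → Torus m} {w : ℤ → Ω}
    (ht : ∀ k, t (k + 1) = t k + toTorus α) (hw : ∀ k, w (k + 1) = Φ (w k)) (N : ℕ) (k : ℤ) :
    forwardCocycle Φ α M N (t k) (w k) = fwdProd (fun k => M (t k) (w k)) N k := by
  induction N generalizing k with
  | zero => rfl
  | succ N ih => rw [forwardCocycle, fwdProd, ← ih, ht, hw]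

theorem backwardCocycle_eq_bwdProd {Ω : Type*} [MeasurableSpace Ω] {Φ : Ω ≃ᵐ Ω} {α : RVec m}
    (M : Torus m → Ω → RVec n →L[ℝ] RVec n) {t : ℤ → Torus m} {w : ℤ → Ω}
    (ht : ∀ k, t (k + 1) = t k + toTorus α) (hw : ∀ k, w (k + 1) = Φ (w k)) (N : ℕ) (k : ℤ) :
    backwardCocycle Φ α M N (t k) (w k) = bwdProd (fun k => M (t k) (w k)) N k := by
  have ht' : ∀ k, t k - toTorus α = t (k - 1) := fun k => by
    rw [sub_eq_iff_eq_add, ← ht, sub_add_cancel]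
  have hw' : ∀ k, Φ.symm (w k) = w (k - 1) := fun k => by
    rw [MeasurableEquiv.symm_apply_eq, ← hw, sub_add_cancel]
  induction N generalizing k with
  | zero => rfl
  | succ N ih => rw [backwardCocycle, bwdProd, ← ih, ht', hw']

theorem continuous_fwdProd {T E : Type*} [TopologicalSpace T] [NormedAddCommGroup E]
    [NormedSpace ℝ E] {A : T → ℤ → E →L[ℝ] E} (hA : ∀ k, Continuous fun θ => A θ k) (N : ℕ) (k : ℤ) :
    Continuous fun θ => fwdProd (A θ) N k := by
  induction N generalizing k with
  | zero => exact continuous_const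
  | succ N ih => exact (ih (k + 1)).mul (hA k)

theorem continuous_bwdProd {T E : Type*} [TopologicalSpace T] [NormedAddCommGroup E]
    [NormedSpace ℝ E] [CompleteSpace E] {A : T → ℤ → E →L[ℝ] E}
    (hA : ∀ k, Continuous fun θ => A θ k) (hu : ∀ θ k, IsUnit (A θ k)) (N : ℕ) (k : ℤ) :
    Continuous fun θ => bwdProd (A θ) N k := by
  induction N generalizing k with
  | zero => exact continuous_const
  | succ N ih =>
    refine (ih (k - 1)).mul (continuous_iff_continuousAt.2 fun θ => ?_)
    obtain ⟨x, hx⟩ := hu θ (k - 1)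
    have h1 : ContinuousAt Ring.inverse (A θ (k - 1)) := hx ▸ NormedRing.inverse_continuousAt x
    exact h1.comp (f := fun θ => A θ (k - 1)) (hA (k - 1)).continuousAt

theorem continuous_greenOfDichotomy {T E : Type*} [TopologicalSpace T] [NormedAddCommGroup E]
    [NormedSpace ℝ E] [CompleteSpace E] {A PS PU : T → ℤ → E →L[ℝ] E}
    (hA : ∀ k, Continuous fun θ => A θ k) (hu : ∀ θ k, IsUnit (A θ k))
    (hS : ∀ k, Continuous fun θ => PS θ k) (hU : ∀ k, Continuous fun θ => PU θ k) (k l : ℤ) :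
    Continuous fun θ => greenOfDichotomy (A θ) (PS θ) (PU θ) k l := by
  unfold greenOfDichotomy
  split_ifs
  · exact (continuous_fwdProd hA _ _).mul (hS _)
  · exact ((continuous_bwdProd hA hu _ _).mul (hU _)).neg

/-- A hyperbolic torus has Green kernels that depend continuously on the angle. -/
theorem IsNormallyHyperbolicDet.exists_green {α : RVec m} {r : ℕ} {F₀ : RVec n → Torus m → RVec n}
    {K₀ : Torus m → RVec n} (h : IsNormallyHyperbolicDet α r F₀ K₀)
    (hM : Continuous fun θ => fderiv ℝ (fun z => F₀ z θ) (K₀ θ)) :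
    ∃ (C ν : ℝ) (G : Torus m → ℤ → ℤ → RVec n →L[ℝ] RVec n), (∀ k l, Measurable fun θ => G θ k l) ∧
      ∀ θ, IsGreen (fun k : ℤ => fderiv ℝ (fun z => F₀ z (θ + k • toTorus α))
        (K₀ (θ + k • toTorus α))) (G θ) C ν := by
  obtain ⟨PS, PU, C, lamS, lamU, -, -, -, -, -, h⟩ := h
  rw [ae_dirac_eq, eventually_pure] at h
  obtain ⟨hPS, hPU, hC, hS0, hS1, hU1, h⟩ := h
  have cPS := hPS.continuous
  have cPU := hPU.continuous
  obtain ⟨b₁, hb₁0, hb₁⟩ := exists_norm_le_of_continuous_torus cPS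
  obtain ⟨b₂, hb₂0, hb₂⟩ := exists_norm_le_of_continuous_torus cPU
  set t : Torus m → ℤ → Torus m := fun θ k => θ + k • toTorus α
  have ht : ∀ θ k, t θ (k + 1) = t θ k + toTorus α := fun θ k => by
    simp only [t]; rw [add_zsmul, one_zsmul, add_assoc]
  have ct : ∀ k, Continuous fun θ => t θ k := fun k => continuous_id.add continuous_const
  set A : Torus m → ℤ → RVec n →L[ℝ] RVec n := fun θ k =>
    fderiv ℝ (fun z => F₀ z (t θ k)) (K₀ (t θ k))
  have hu : ∀ θ k, IsUnit (A θ k) := fun θ k => (h (t θ k)).1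
  refine ⟨_, _, fun θ => greenOfDichotomy (A θ) (fun k => PS (t θ k) ()) (fun k => PU (t θ k) ()),
    fun k l => (continuous_greenOfDichotomy (A := A) (PS := fun θ k => PS (t θ k) ())
      (PU := fun θ k => PU (t θ k) ()) (fun k => hM.comp (ct k)) hu
      (fun k => cPS.comp (ct k)) (fun k => cPU.comp (ct k)) k l).measurable,
    fun θ => isGreen_of_dichotomy hC.le hS0 hS1 hU1 (hu θ) (fun k => (h (t θ k)).2.2.2.1)
      (fun k => ?_) (fun k => ?_) (fun k => (hb₁ _).trans (le_max_left b₁ b₂))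
      (fun k => (hb₂ _).trans (le_max_right b₁ b₂)) (fun k v N => ?_) (fun k v N => ?_)⟩
  · rw [ht]; exact (h (t θ k)).2.2.2.2.1
  · rw [ht]; exact (h (t θ k)).2.2.2.2.2.1
  · have := ((h (t θ k)).2.2.2.2.2.2.1 (PS (t θ k) () v)).1 ⟨v, rfl⟩ N
    rwa [forwardCocycle_eq_fwdProd (t := t θ) (w := fun _ => ()) _ (ht θ) (fun _ => rfl)] at this
  · have := ((h (t θ k)).2.2.2.2.2.2.2 (PU (t θ k) () v)).1 ⟨v, rfl⟩ N
    rwa [backwardCocycle_eq_bwdProd (t := t θ) (w := fun _ => ()) _ (ht θ) (fun _ => rfl)] at this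

theorem IsCSigma.mixedBound {U : Set (RVec n)} {r : ℕ} {f : RVec n → Torus m → RVec n} {B : ℝ}
    (h : IsCSigma U (sigmaRS r 1) f)
    (hB : ∀ i j, (i, j) ∈ sigmaRS r 1 → ∀ z ∈ U, ∀ x : RVec m, ‖mixedDeriv i j f z x‖ ≤ B) :
    MixedBound U r B fun z (y : RVec m) => f z (toTorus y) :=
  ⟨h, fun i j hi hij p hp => hB i j ⟨hi, hij⟩ p.1 hp p.2⟩

/-- The derivative `D_z F₀` along the torus is continuous. -/
theorem continuous_fderiv_section {U : Set (RVec n)} (hU : IsOpen U) {r : ℕ} {B : ℝ}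
    {F₀ : RVec n → Torus m → RVec n} (hF₀ : MixedBound U r B fun z (y : RVec m) => F₀ z (toTorus y))
    {K₀ : Torus m → RVec n} (hK₀U : ∀ θ, K₀ θ ∈ U) (hK₀ : Continuous K₀) :
    Continuous fun θ => fderiv ℝ (fun z => F₀ z θ) (K₀ θ) := by
  refine isOpenQuotientMap_toTorus.continuous_comp_iff.1 (continuous_iff_continuousAt.2 fun y => ?_)
  have h1 := hF₀.continuousOn_fderiv.continuousAt (x := (K₀ (toTorus y), y))
    ((hU.prod isOpen_univ).mem_nhds ⟨hK₀U _, mem_univ _⟩)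
  exact h1.comp (f := fun y : RVec m => (K₀ (toTorus y), y))
    ((hK₀.comp continuous_toTorus).prodMk continuous_id).continuousAt

/-- A tube of uniform size around the torus on which `D_z F₀` is almost constant. -/
theorem exists_tube_radius {U : Set (RVec n)} (hU : IsOpen U) {r : ℕ} {B : ℝ}
    {F₀ : RVec n → Torus m → RVec n} (hF₀ : MixedBound U r B fun z (y : RVec m) => F₀ z (toTorus y))
    {K₀ : Torus m → RVec n} (hK₀U : ∀ θ, K₀ θ ∈ U) (hK₀ : Continuous K₀) {δ : ℝ} (hδ : 0 < δ) :
    ∃ ρ > 0, ∀ θ, ∀ z ∈ Metric.closedBall (K₀ θ) (2 * ρ), z ∈ U ∧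
      ‖fderiv ℝ (fun w => F₀ w θ) z - fderiv ℝ (fun w => F₀ w θ) (K₀ θ)‖ ≤ δ / 2 := by
  suffices h : ∃ ρ > 0, ∀ θ ∈ (univ : Set (Torus m)), ∀ z ∈ Metric.closedBall (K₀ θ) (2 * ρ), z ∈ U ∧
      ‖fderiv ℝ (fun w => F₀ w θ) z - fderiv ℝ (fun w => F₀ w θ) (K₀ θ)‖ ≤ δ / 2 by simpa using h
  -- Having a uniform radius passes to subsets and finite unions, so it suffices to find one near
  -- each angle.
  refine isCompact_univ.induction_on (p := fun s => ∃ ρ > 0, ∀ θ ∈ s,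
      ∀ z ∈ Metric.closedBall (K₀ θ) (2 * ρ), z ∈ U ∧
      ‖fderiv ℝ (fun w => F₀ w θ) z - fderiv ℝ (fun w => F₀ w θ) (K₀ θ)‖ ≤ δ / 2)
    ⟨1, one_pos, by simp⟩ (fun s t hst ⟨ρ, hρ, h⟩ => ⟨ρ, hρ, fun θ hθ => h θ (hst hθ)⟩)
    (fun s t ⟨ρ, hρ, h⟩ ⟨ρ', hρ', h'⟩ => ⟨min ρ ρ', lt_min hρ hρ', ?_⟩) (fun θ _ => ?_)
  · rintro θ (hθ | hθ) z hz
    · exact h θ hθ z (Metric.closedBall_subset_closedBall (by gcongr; exact min_le_left _ _) hz)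
    · exact h' θ hθ z (Metric.closedBall_subset_closedBall (by gcongr; exact min_le_right _ _) hz)
  · obtain ⟨y, rfl⟩ := toTorus_surjective θ
    have hy : (K₀ (toTorus y), y) ∈ U ×ˢ (univ : Set (RVec m)) := ⟨hK₀U _, mem_univ _⟩
    have hn := (hU.prod isOpen_univ).mem_nhds hy
    have h1 := hF₀.continuousOn_fderiv.continuousAt hn
    have h2 := (h1.eventually (Metric.closedBall_mem_nhds _ (half_pos (half_pos hδ)))).and hn
    obtain ⟨d, hd, h2⟩ := Metric.eventually_nhds_iff.1 h2
    have cK := (hK₀.comp continuous_toTorus).continuousAt (x := y)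
    have h3 := (Metric.ball_mem_nhds y hd)
    have h4 := cK.eventually (Metric.ball_mem_nhds _ (half_pos hd))
    -- Radius `2 * (d / 8) = d / 4` around a centre within `d / 2` of `K₀ (toTorus y)` stays inside
    -- the `d`-ball, where the derivative varies by at most `δ / 4` from its central value.
    refine ⟨toTorus '' {y' | y' ∈ Metric.ball y d ∧ K₀ (toTorus y') ∈ Metric.ball (K₀ (toTorus y))
      (d / 2)}, mem_nhdsWithin_of_mem_nhds
        (isOpenQuotientMap_toTorus.isOpenMap.image_mem_nhds (Filter.inter_mem h3 h4)),
      d / 8, by positivity, ?_⟩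
    rintro _ ⟨y', ⟨hy1, hy2⟩, rfl⟩ z hz
    rw [Metric.mem_closedBall] at hz
    rw [Metric.mem_ball] at hy1 hy2
    have hz' : dist z (K₀ (toTorus y)) < d := by
      linarith [dist_triangle z (K₀ (toTorus y')) (K₀ (toTorus y))]
    have e1 := @h2 (z, y') (by rw [Prod.dist_eq]; exact max_lt hz' hy1)
    have e2 := @h2 (K₀ (toTorus y'), y') (by
      rw [Prod.dist_eq]; exact max_lt (hy2.trans (half_lt_self hd)) hy1)
    refine ⟨e1.2.1, ?_⟩
    have e3 := e1.1
    have e4 := e2.1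
    simp only at e3 e4
    rw [← dist_eq_norm]
    refine (dist_triangle_right _ _ _).trans ((add_le_add e3 e4).trans ?_)
    linarith

/-- Rotations are isometries of the torus and `K₀` is uniformly continuous, so one neighbourhood
serves all times `k`. -/
theorem eventually_forall_norm_sub_le {K₀ : Torus m → RVec n} (hK₀ : Continuous K₀) (α y : RVec m)
    {ε : ℝ} (hε : 0 < ε) :
    ∀ᶠ y' in 𝓝 y, ∀ k : ℤ, ‖K₀ (toTorus (y' + k • α)) - K₀ (toTorus (y + k • α))‖ ≤ ε := by
  obtain ⟨d, hd, h⟩ := Metric.uniformContinuous_iff.1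
    (CompactSpace.uniformContinuous_of_continuous hK₀) ε hε
  filter_upwards [continuous_toTorus.continuousAt.eventually
    (Metric.ball_mem_nhds (toTorus y) hd)] with y' hy' k
  rw [← dist_eq_norm]
  refine (h ?_).le
  rw [toTorus_add, toTorus_add, dist_add_right]
  exact hy'

/-- The deterministic torus is the core of a hyperbolic tube. -/
theorem exists_hyperbolicTube {U : Set (RVec n)} (hU : IsOpen U) {r : ℕ} {α : RVec m}
    {F₀ : RVec n → Torus m → RVec n} (hF₀ : IsCSigma U (sigmaRS r 1) F₀)
    (hF₀b : cSigmaNorm U (sigmaRS r 1) F₀ < ∞) {K₀ : Torus m → RVec n} (hK₀U : ∀ θ, K₀ θ ∈ U)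
    (hK₀ : IsCrTorus r K₀) (hinv : ∀ θ, F₀ (K₀ θ) θ = K₀ (θ + toTorus α))
    (hhyp : IsNormallyHyperbolicDet α r F₀ K₀) :
    ∃ (B C ν δ ρ : ℝ) (G : Torus m → ℤ → ℤ → RVec n →L[ℝ] RVec n), 0 < δ ∧
      (∀ k l, Measurable fun θ => G θ k l) ∧
      HyperbolicTube U r B (fun z (y : RVec m) => F₀ z (toTorus y)) (fun k => k • α)
        (fun k y => K₀ (toTorus (y + k • α))) (fun y => G (toTorus y)) C ν δ ρ := by
  obtain ⟨B₁, hB₁0, hB₁⟩ := cSigmaNorm_lt_top hF₀b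
  obtain ⟨B₂, hB₂0, hB₂⟩ := hK₀.exists_hasCkBound
  have hb := hF₀.mixedBound hB₁
  have cK := hK₀.continuous
  have cM := continuous_fderiv_section hU hb hK₀U cK
  obtain ⟨C, ν, G, hGm, hG⟩ := hhyp.exists_green cM
  have hCS := (hG 0).const_greenSum_nonneg
  -- Chosen so that `C * greenSum ν * δ ≤ 1 / 2`; the added `1` keeps the denominator positive.
  set δ : ℝ := 1 / (2 * (C * greenSum ν + 1))
  have hδ : 0 < δ := by positivity
  obtain ⟨ρ, hρ, hρU⟩ := exists_tube_radius hU hb hK₀U cK hδ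
  refine ⟨max B₁ B₂, C, ν, δ, ρ, G, hδ, hGm, hU, hb.mono (le_max_left _ _),
    fun k => ((hB₂.comp_add_right (k • α)).mono (le_max_right _ _)),
    fun y ε hε => eventually_forall_norm_sub_le cK α y hε, fun k y => ?_, hρ,
    fun k y z hz => (hρU _ z hz).1, fun k y z hz => (hρU _ z hz).2, fun y => ?_, ?_⟩
  · rw [hinv, ← toTorus_add, add_zsmul, one_zsmul, add_assoc]
  · have := hG (toTorus y)
    simp only [← toTorus_zsmul, ← toTorus_add] at this
    exact this
  · simp only [δ]
    rw [mul_one_div, div_le_div_iff₀ (by positivity) (by positivity)]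
    linarith

end ReferenceTorus

/-! ### Existence of the random torus for perturbations that are close for every `ω` -/

section Iterates

variable {Ω : Type*} [MeasurableSpace Ω]

/-- The integer iterates of an automorphism. -/
def iterZ (Φ : Ω ≃ᵐ Ω) (k : ℤ) : Ω → Ω := ((Φ.toEquiv : Equiv.Perm Ω) ^ k : Equiv.Perm Ω)

theorem iterZ_zero (Φ : Ω ≃ᵐ Ω) (ω : Ω) : iterZ Φ 0 ω = ω := by simp [iterZ]

theorem iterZ_add (Φ : Ω ≃ᵐ Ω) (k l : ℤ) (ω : Ω) :
    iterZ Φ (k + l) ω = iterZ Φ l (iterZ Φ k ω) := by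
  simp only [iterZ]
  rw [add_comm, zpow_add]
  rfl

theorem iterZ_one (Φ : Ω ≃ᵐ Ω) (ω : Ω) : iterZ Φ 1 ω = Φ ω := by
  simp only [iterZ, zpow_one]
  rfl

theorem iterZ_succ (Φ : Ω ≃ᵐ Ω) (k : ℤ) (ω : Ω) : iterZ Φ (k + 1) ω = Φ (iterZ Φ k ω) := by
  rw [iterZ_add, iterZ_one]

theorem iterZ_apply (Φ : Ω ≃ᵐ Ω) (k : ℤ) (ω : Ω) : iterZ Φ k (Φ ω) = iterZ Φ (k + 1) ω := by
  rw [add_comm, iterZ_add, iterZ_one]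

theorem iterZ_sub_one (Φ : Ω ≃ᵐ Ω) (k : ℤ) (ω : Ω) :
    iterZ Φ (k - 1) ω = Φ.symm (iterZ Φ k ω) := by
  rw [eq_comm, MeasurableEquiv.symm_apply_eq, ← iterZ_succ, sub_add_cancel]

theorem measurePreserving_iterZ {P : Measure Ω} {Φ : Ω ≃ᵐ Ω} (hΦ : MeasurePreserving Φ P P)
    (k : ℤ) : MeasurePreserving (iterZ Φ k) P P := by
  induction k using Int.induction_on with
  | zero =>
    convert MeasurePreserving.id P using 1
    exact funext fun ω => iterZ_zero Φ ω
  | succ k ih =>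
    convert hΦ.comp ih using 1
    exact funext fun ω => iterZ_succ Φ _ ω
  | pred k ih =>
    convert (hΦ.symm Φ).comp ih using 1
    exact funext fun ω => iterZ_sub_one Φ _ ω

theorem measurable_iterZ (Φ : Ω ≃ᵐ Ω) (k : ℤ) : Measurable (iterZ Φ k) := by
  induction k using Int.induction_on with
  | zero =>
    convert measurable_id using 1
    exact funext fun ω => iterZ_zero Φ ω
  | succ k ih =>
    convert Φ.measurable.comp ih using 1
    exact funext fun ω => iterZ_succ Φ _ ω
  | pred k ih =>
    convert Φ.symm.measurable.comp ih using 1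
    exact funext fun ω => iterZ_sub_one Φ _ ω

end Iterates

/-! ### Measurability of operator-valued maps and derivatives -/

section MeasurableOperators

variable {n : ℕ} {ι : Type*} [MeasurableSpace ι]

/-- The operator with given columns. -/
noncomputable def ofColumns (v : Fin n → RVec n) : RVec n →L[ℝ] RVec n :=
  ∑ i, (EuclideanSpace.proj i : RVec n →L[ℝ] ℝ).smulRight (v i)

theorem continuous_ofColumns : Continuous (ofColumns : (Fin n → RVec n) → RVec n →L[ℝ] RVec n) := by
  unfold ofColumns
  refine continuous_finsetSum _ fun i _ => ?_
  exact ((ContinuousLinearMap.smulRightL ℝ (RVec n) (RVec n)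
    (EuclideanSpace.proj i : RVec n →L[ℝ] ℝ)).continuous).comp (continuous_apply i)

theorem ofColumns_apply_single (A : RVec n →L[ℝ] RVec n) :
    ofColumns (fun i => A (EuclideanSpace.single i 1)) = A := by
  ext v j
  have h : v = ∑ i, v i • EuclideanSpace.single i (1 : ℝ) := by
    ext j
    simp [Pi.single_apply]
  conv_rhs => rw [h]
  simp [ofColumns]

theorem measurable_of_columns {A : ι → RVec n →L[ℝ] RVec n}
    (h : ∀ i, Measurable fun p => A p (EuclideanSpace.single i 1)) : Measurable A := by
  have : A = fun p => ofColumns fun i => A p (EuclideanSpace.single i 1) :=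
    funext fun p => (ofColumns_apply_single (A p)).symm
  rw [this]
  exact continuous_ofColumns.measurable.comp (measurable_pi_lambda _ h)

/-- Measurability of derivatives of a measurable family along a measurable section. -/
theorem measurable_fderiv_section {g : ι → RVec n → RVec n} {v : ι → RVec n} {ρ : ℝ} (hρ : 0 < ρ)
    (hd : ∀ p, DifferentiableAt ℝ (g p) (v p))
    (hm : ∀ h : RVec n, ‖h‖ ≤ ρ → Measurable fun p => g p (v p + h)) :
    Measurable fun p => fderiv ℝ (g p) (v p) := by
  refine measurable_of_columns fun i => ?_
  -- Difference quotients with steps `ρ / (j + 1)`: they never exceed `ρ`, so the base points stay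
  -- where measurability is assumed.
  have hlim : Tendsto (fun j : ℕ => ‖((j : ℝ) + 1) / ρ‖) atTop atTop := by
    have h1 : Tendsto (fun j : ℕ => ((j : ℝ) + 1) / ρ) atTop atTop :=
      (tendsto_atTop_add_const_right _ _ tendsto_natCast_atTop_atTop).atTop_div_const hρ
    exact tendsto_norm_atTop_atTop.comp h1
  refine measurable_of_tendsto_metrizable (fun j => ?_)
    (tendsto_pi_nhds.2 fun p => (hd p).hasFDerivAt.lim (EuclideanSpace.single i 1) hlim)
  have h0 := hm 0 (by simpa using hρ.le)
  simp only [add_zero] at h0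
  refine (Measurable.sub (hm _ ?_) h0).const_smul (((j : ℝ) + 1) / ρ)
  rw [norm_smul, PiLp.norm_single, norm_one, mul_one, norm_inv, Real.norm_of_nonneg
    (by positivity), inv_div]
  exact div_le_self hρ.le (by linarith [(Nat.cast_nonneg j : (0 : ℝ) ≤ j)])

end MeasurableOperators

/-! ### Construction of the random torus and its Green kernels -/

section RandomTorus

variable {n m : ℕ} {Ω : Type*} [MeasurableSpace Ω] {Φ : Ω ≃ᵐ Ω} {α : RVec m} {U : Set (RVec n)}
  {r : ℕ} {F₀ : RVec n → Torus m → RVec n} {K₀ : Torus m → RVec n} {B B' C ν δ ρ e : ℝ}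
  {G : Torus m → ℤ → ℤ → RVec n →L[ℝ] RVec n} {F : RVec n → Torus m → Ω → RVec n}

/-- A hyperbolic tube around a deterministic torus. -/
def IsTorusTube (U : Set (RVec n)) (r : ℕ) (B : ℝ) (F₀ : RVec n → Torus m → RVec n) (α : RVec m)
    (K₀ : Torus m → RVec n) (G : Torus m → ℤ → ℤ → RVec n →L[ℝ] RVec n) (C ν δ ρ : ℝ) : Prop :=
  HyperbolicTube U r B (fun z (y : RVec m) => F₀ z (toTorus y)) (fun k => k • α)
    (fun k y => K₀ (toTorus (y + k • α))) (fun y => G (toTorus y)) C ν δ ρ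

/-- Closeness of the lifted maps. -/
def IsCloseMap (U : Set (RVec n)) (r : ℕ) (B : ℝ) (F₀ F : RVec n → Torus m → RVec n) (e : ℝ) :
    Prop :=
  IsClosePerturbation U r B (fun z (y : RVec m) => F₀ z (toTorus y)) (fun z y => F z (toTorus y)) e

theorem IsTorusTube.mem (T : IsTorusTube U r B F₀ α K₀ G C ν δ ρ) {θ : Torus m} {z : RVec n}
    (hz : ‖z - K₀ θ‖ ≤ 2 * ρ) : z ∈ U := by
  obtain ⟨y, rfl⟩ := toTorus_surjective θ
  exact HyperbolicTube.mem T (k := 0) (y := y) (by simpa using hz)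

theorem IsTorusTube.isGreen (T : IsTorusTube U r B F₀ α K₀ G C ν δ ρ) (θ : Torus m) :
    IsGreen (fun k : ℤ => fderiv ℝ (fun z => F₀ z (θ + k • toTorus α)) (K₀ (θ + k • toTorus α)))
      (G θ) C ν := by
  obtain ⟨y, rfl⟩ := toTorus_surjective θ
  simpa only [toTorus_add, toTorus_zsmul] using HyperbolicTube.isGreen T y

theorem IsTorusTube.solves (T : IsTorusTube U r B F₀ α K₀ G C ν δ ρ) (θ : Torus m) :
    K₀ (θ + toTorus α) = F₀ (K₀ θ) θ := by
  obtain ⟨y, rfl⟩ := toTorus_surjective θ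
  simpa [toTorus_add] using HyperbolicTube.solves T 0 y

theorem IsTorusTube.continuous (T : IsTorusTube U r B F₀ α K₀ G C ν δ ρ) : Continuous K₀ := by
  refine isOpenQuotientMap_toTorus.continuous_comp_iff.1 ?_
  simpa [Function.comp_def] using (HyperbolicTube.hasCkBound T 0).1.continuous

theorem IsTorusTube.norm_fderiv_sub_le (T : IsTorusTube U r B F₀ α K₀ G C ν δ ρ)
    {f : RVec n → Torus m → RVec n} (hf : IsCloseMap U r B' F₀ f e) (he : e ≤ δ / 2) (θ : Torus m)
    {z : RVec n} (hz : ‖z - K₀ θ‖ ≤ 2 * ρ) :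
    ‖fderiv ℝ (fun w => f w θ) z - fderiv ℝ (fun w => F₀ w θ) (K₀ θ)‖ ≤ δ := by
  obtain ⟨y, rfl⟩ := toTorus_surjective θ
  simpa using HyperbolicTube.norm_fderiv_sub_le T hf he 0 y (z := z) (by simpa using hz)

theorem IsTorusTube.norm_sub_sub_le (T : IsTorusTube U r B F₀ α K₀ G C ν δ ρ)
    {f : RVec n → Torus m → RVec n} (hf : IsCloseMap U r B' F₀ f e) (he : e ≤ δ / 2) (θ : Torus m)
    {z z' : RVec n} (hz : ‖z - K₀ θ‖ ≤ 2 * ρ) (hz' : ‖z' - K₀ θ‖ ≤ 2 * ρ) :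
    ‖f z θ - f z' θ - fderiv ℝ (fun w => F₀ w θ) (K₀ θ) (z - z')‖ ≤ δ * ‖z - z'‖ := by
  obtain ⟨y, rfl⟩ := toTorus_surjective θ
  simpa using HyperbolicTube.norm_sub_sub_le T hf he 0 y (z := z) (z' := z') (by simpa using hz)
    (by simpa using hz')

theorem IsCloseMap.norm_sub_le {f : RVec n → Torus m → RVec n} (hf : IsCloseMap U r B' F₀ f e)
    {z : RVec n} (hz : z ∈ U) (θ : Torus m) : ‖f z θ - F₀ z θ‖ ≤ e := by
  obtain ⟨y, rfl⟩ := toTorus_surjective θ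
  have h := IsClosePerturbation.close hf 0 0 (by omega) (z, y) hz
  rwa [← norm_sub_eq_mixedD (fun z (y : RVec m) => f z (toTorus y))
    (fun z (y : RVec m) => F₀ z (toTorus y)) (z, y) (z, y)] at h

theorem IsCloseMap.differentiableAt {f : RVec n → Torus m → RVec n}
    (hf : IsCloseMap U r B' F₀ f e) (hU : IsOpen U) {z : RVec n} (hz : z ∈ U) (θ : Torus m) :
    DifferentiableAt ℝ (fun w => f w θ) z := by
  obtain ⟨y, rfl⟩ := toTorus_surjective θ
  exact (IsClosePerturbation.mixedBound hf).differentiableAt_left hU hz y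

/-- Orbits near the torus over a given orbit of the base are unique. -/
theorem IsTorusTube.eq_of_solves (T : IsTorusTube U r B F₀ α K₀ G C ν δ ρ)
    {f : ℤ → RVec n → Torus m → RVec n} (hf : ∀ k, IsCloseMap U r B' F₀ (f k) e) (he : e ≤ δ / 2)
    {θ : Torus m} {x x' : ℤ → RVec n} (hx : ∀ k, x (k + 1) = f k (x k) (θ + k • toTorus α))
    (hxρ : ∀ k : ℤ, ‖x k - K₀ (θ + k • toTorus α)‖ ≤ 2 * ρ)
    (hx' : ∀ k, x' (k + 1) = f k (x' k) (θ + k • toTorus α))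
    (hxρ' : ∀ k : ℤ, ‖x' k - K₀ (θ + k • toTorus α)‖ ≤ 2 * ρ) (k : ℤ) : x k = x' k := by
  obtain ⟨y, rfl⟩ := toTorus_surjective θ
  simp only [← toTorus_zsmul, ← toTorus_add] at hx hxρ hx' hxρ'
  exact HyperbolicTube.eq_of_solves T (φ := fun k z y => f k z (toTorus y)) hf he hx hxρ hx' hxρ' k

theorem IsTorusTube.continuous_fderiv (T : IsTorusTube U r B F₀ α K₀ G C ν δ ρ) :
    Continuous fun θ => fderiv ℝ (fun z => F₀ z θ) (K₀ θ) :=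
  continuous_fderiv_section (HyperbolicTube.isOpen T) (HyperbolicTube.mixedBound T)
    (fun θ => T.mem (θ := θ) (by simpa using (HyperbolicTube.rho_pos T).le)) T.continuous

theorem measurable_add_zsmul (α : RVec m) (k : ℤ) :
    Measurable fun p : Torus m × Ω => p.1 + k • toTorus α :=
  (continuous_id.add continuous_const).measurable.comp measurable_fst

theorem measurable_shift (Φ : Ω ≃ᵐ Ω) (α : RVec m) (k : ℤ) :
    Measurable fun p : Torus m × Ω => (p.1 + k • toTorus α, iterZ Φ k p.2) :=
  (measurable_add_zsmul α k).prodMk ((measurable_iterZ Φ k).comp measurable_snd)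

/-- Existence of the random torus. -/
theorem IsTorusTube.exists_section (T : IsTorusTube U r B F₀ α K₀ G C ν δ ρ)
    (hG : ∀ k l, Measurable fun θ => G θ k l)
    (hFm : Measurable fun q : U × Torus m × Ω => F q.1 q.2.1 q.2.2)
    (hF : ∀ ω, IsCloseMap U r B' F₀ (fun z θ => F z θ ω) e) (he : e ≤ δ / 2)
    (heρ : 2 * (C * greenSum ν) * e ≤ ρ) :
    ∃ K : Torus m → Ω → RVec n, Measurable (fun p : Torus m × Ω => K p.1 p.2) ∧
      (∀ θ ω, ‖K θ ω - K₀ θ‖ ≤ ρ) ∧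
      ∀ θ ω, F (K θ ω) θ ω = K (θ + toTorus α) (Φ ω) := by
  have hρ : 0 < ρ := HyperbolicTube.rho_pos T
  have hδ0 : 0 ≤ δ := HyperbolicTube.delta_nonneg T
  have hM : ∀ k : ℤ, Measurable fun p : Torus m × Ω =>
      fderiv ℝ (fun z => F₀ z (p.1 + k • toTorus α)) (K₀ (p.1 + k • toTorus α)) := fun k =>
    T.continuous_fderiv.measurable.comp (measurable_add_zsmul α k)
  have hK₀ : ∀ k : ℤ, Measurable fun p : Torus m × Ω => K₀ (p.1 + k • toTorus α) := fun k =>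
    T.continuous.measurable.comp (measurable_add_zsmul α k)
  have hsucc : ∀ (θ : Torus m) (k : ℤ), θ + (k + 1) • toTorus α = θ + k • toTorus α + toTorus α :=
    fun θ k => by rw [add_zsmul, one_zsmul, add_assoc]
  -- Nonlinear part of the equation for the deviation `v` from `K₀`, after removing the
  -- linearization along `K₀`. At `v = 0` it is the value of `F - F₀`, hence at most `e`.
  set N : Torus m × Ω → ℤ → RVec n → RVec n := fun p k v =>
    F (K₀ (p.1 + k • toTorus α) + v) (p.1 + k • toTorus α) (iterZ Φ k p.2) -
      K₀ (p.1 + (k + 1) • toTorus α) -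
      fderiv ℝ (fun z => F₀ z (p.1 + k • toTorus α)) (K₀ (p.1 + k • toTorus α)) v with hNdef
  have hN0 : ∀ p k, ‖N p k 0‖ ≤ e := by
    intro p k
    simp only [hNdef, add_zero, map_zero, sub_zero]
    rw [hsucc, T.solves]
    exact (hF (iterZ Φ k p.2)).norm_sub_le (T.mem (θ := p.1 + k • toTorus α)
      (by simpa using hρ.le)) _
  have hN : ∀ p k v w, ‖v‖ ≤ ρ → ‖w‖ ≤ ρ → ‖N p k v - N p k w‖ ≤ δ * ‖v - w‖ := by
    intro p k v w hv hw
    have h1 := T.norm_sub_sub_le (hF (iterZ Φ k p.2)) he (p.1 + k • toTorus α)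
      (z := K₀ (p.1 + k • toTorus α) + v) (z' := K₀ (p.1 + k • toTorus α) + w)
      (by rw [add_sub_cancel_left]; linarith) (by rw [add_sub_cancel_left]; linarith)
    rw [add_sub_add_left_eq_sub, map_sub] at h1
    refine (le_of_eq ?_).trans h1
    congr 1
    simp only [N]
    abel
  have hNm : ∀ k (v : Torus m × Ω → RVec n), Measurable v → (∀ p, ‖v p‖ ≤ ρ) →
      Measurable fun p => N p k (v p) := by
    intro k v hv hvρ
    have h1 : Measurable fun p : Torus m × Ω =>
        F (K₀ (p.1 + k • toTorus α) + v p) (p.1 + k • toTorus α) (iterZ Φ k p.2) :=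
      hFm.comp (f := fun p : Torus m × Ω => ((⟨K₀ (p.1 + k • toTorus α) + v p,
        T.mem (by rw [add_sub_cancel_left]; linarith [hvρ p])⟩ : U), p.1 + k • toTorus α,
          iterZ Φ k p.2)) ((((hK₀ k).add hv).subtype_mk).prodMk (measurable_shift Φ α k))
    exact (h1.sub (hK₀ (k + 1))).sub
      (isBoundedBilinearMap_apply.continuous.measurable2 (hM k) hv)
  obtain ⟨u, hum, hu⟩ := exists_measurable_bounded_solution (ι := Torus m × Ω)
    (M := fun p (k : ℤ) => fderiv ℝ (fun z => F₀ z (p.1 + k • toTorus α)) (K₀ (p.1 + k • toTorus α)))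
    (G := fun p => G p.1) (N := N) (fun p => T.isGreen p.1)
    (fun k l => (hG k l).comp measurable_fst) hδ0 (HyperbolicTube.small T) heρ hρ.le hN0 hN hNm
  have hsol : ∀ θ ω k, K₀ (θ + (k + 1) • toTorus α) + u (θ, ω) (k + 1) =
      F (K₀ (θ + k • toTorus α) + u (θ, ω) k) (θ + k • toTorus α) (iterZ Φ k ω) := by
    intro θ ω k
    rw [(hu (θ, ω)).2 k]
    simp only [N]
    abel
  refine ⟨fun θ ω => K₀ θ + u (θ, ω) 0, (T.continuous.measurable.comp measurable_fst).add (hum 0),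
    fun θ ω => by simpa using (hu (θ, ω)).1 0, fun θ ω => ?_⟩
  -- The solution over `(θ, ω)` advanced by one step and the solution over `(θ + α, Φ ω)` satisfy
  -- the same equation in the tube; equality at time zero is the invariance equation.
  have h1 := T.eq_of_solves (f := fun k z θ => F z θ (iterZ Φ (k + 1) ω)) (fun k => hF _) he
    (θ := θ + toTorus α)
    (x := fun k => K₀ (θ + (k + 1) • toTorus α) + u (θ, ω) (k + 1))
    (x' := fun k => K₀ (θ + toTorus α + k • toTorus α) + u (θ + toTorus α, Φ ω) k)
    (fun k => by
      rw [hsol, hsucc θ k, add_right_comm]) (fun k => ?_)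
    (fun k => by
      rw [hsol, iterZ_apply]) (fun k => ?_) 0
  · have h2 := hsol θ ω 0
    simp only [zero_add, one_zsmul, zero_zsmul, add_zero, iterZ_zero] at h1 h2
    exact h2.symm.trans h1
  · rw [hsucc θ k, add_right_comm, add_sub_cancel_left]
    exact ((hu (θ, ω)).1 (k + 1)).trans (by linarith)
  · rw [add_sub_cancel_left]
    exact ((hu (θ + toTorus α, Φ ω)).1 k).trans (by linarith)

theorem apply_iterate {K : Torus m → Ω → RVec n}
    (hK : ∀ θ ω, F (K θ ω) θ ω = K (θ + toTorus α) (Φ ω)) (θ : Torus m) (ω : Ω) (k : ℤ) :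
    K (θ + (k + 1) • toTorus α) (iterZ Φ (k + 1) ω) =
      F (K (θ + k • toTorus α) (iterZ Φ k ω)) (θ + k • toTorus α) (iterZ Φ k ω) := by
  rw [hK, iterZ_succ, add_zsmul, one_zsmul, add_assoc]

/-- Measurable Green kernels along the random torus. -/
theorem IsTorusTube.exists_random_green (T : IsTorusTube U r B F₀ α K₀ G C ν δ ρ)
    (hG : ∀ k l, Measurable fun θ => G θ k l)
    (hFm : Measurable fun q : U × Torus m × Ω => F q.1 q.2.1 q.2.2)
    (hF : ∀ ω, IsCloseMap U r B' F₀ (fun z θ => F z θ ω) e) (he : e ≤ δ / 2)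
    {K : Torus m → Ω → RVec n} (hKm : Measurable fun p : Torus m × Ω => K p.1 p.2)
    (hKρ : ∀ θ ω, ‖K θ ω - K₀ θ‖ ≤ ρ) :
    ∃ H : Torus m × Ω → ℤ → ℤ → RVec n →L[ℝ] RVec n, (∀ k l, Measurable fun p => H p k l) ∧
      ∀ θ ω, IsGreen (fun k : ℤ => transferMatrix F K (θ + k • toTorus α) (iterZ Φ k ω)) (H (θ, ω))
        (2 * (C * greenSum ν)) (√ν) := by
  have hρ : 0 < ρ := HyperbolicTube.rho_pos T
  -- `F` is measurable only on `U`, so every evaluation point has to be exhibited there; the room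
  -- between `ρ` and `2ρ` admits increments up to `ρ`.
  have hA : Measurable fun p : Torus m × Ω => transferMatrix F K p.1 p.2 := by
    refine measurable_fderiv_section (g := fun (p : Torus m × Ω) z => F z p.1 p.2)
      (v := fun p => K p.1 p.2) hρ (fun p => (hF p.2).differentiableAt (HyperbolicTube.isOpen T)
        (T.mem (θ := p.1) (by linarith [hKρ p.1 p.2])) p.1) fun h hh => ?_
    exact hFm.comp (f := fun p : Torus m × Ω => ((⟨K p.1 p.2 + h, T.mem (θ := p.1) (by
      rw [add_sub_right_comm]
      exact (norm_add_le _ _).trans (by linarith [hKρ p.1 p.2]))⟩ : U), p.1, p.2))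
      ((hKm.add measurable_const).subtype_mk.prodMk (measurable_fst.prodMk measurable_snd))
  obtain ⟨H, hHm, hH⟩ := exists_green_of_perturbation (ι := Torus m × Ω)
    (M := fun p (k : ℤ) => fderiv ℝ (fun z => F₀ z (p.1 + k • toTorus α)) (K₀ (p.1 + k • toTorus α)))
    (A := fun p (k : ℤ) => transferMatrix F K (p.1 + k • toTorus α) (iterZ Φ k p.2))
    (G := fun p => G p.1) (δ := δ) (fun p => T.isGreen p.1) (fun k l => (hG k l).comp measurable_fst)
    (fun k => T.continuous_fderiv.measurable.comp (measurable_add_zsmul α k))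
    (fun k => hA.comp (measurable_shift Φ α k)) (HyperbolicTube.delta_nonneg T)
    (HyperbolicTube.small T)
    (fun p k => T.norm_fderiv_sub_le (hF _) he _ ((hKρ _ _).trans (by linarith)))
  exact ⟨H, hHm, fun θ ω => hH (θ, ω)⟩

/-- Regularity of the random torus and of its Green kernels. -/
theorem IsTorusTube.exists_regularity (hB : 0 ≤ B) (r : ℕ) (C ν : ℝ) :
    ∃ Q : ℝ, 0 ≤ Q ∧ ∀ (α : RVec m) (U : Set (RVec n)) (F₀ : RVec n → Torus m → RVec n)
      (K₀ : Torus m → RVec n) (G : Torus m → ℤ → ℤ → RVec n →L[ℝ] RVec n) (δ ρ e B' : ℝ)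
      (F : RVec n → Torus m → Ω → RVec n) (K : Torus m → Ω → RVec n)
      (H : Torus m × Ω → ℤ → ℤ → RVec n →L[ℝ] RVec n), IsTorusTube U r B F₀ α K₀ G C ν δ ρ →
      (∀ ω, IsCloseMap U r B' F₀ (fun z θ => F z θ ω) e) → e ≤ δ / 2 → e ≤ 1 →
      (∀ θ ω, F (K θ ω) θ ω = K (θ + toTorus α) (Φ ω)) → (∀ θ ω, ‖K θ ω - K₀ θ‖ ≤ ρ) →
      (∀ θ ω, IsGreen (fun k : ℤ => transferMatrix F K (θ + k • toTorus α) (iterZ Φ k ω)) (H (θ, ω))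
        (2 * (C * greenSum ν)) (√ν)) →
      ∀ ω, HasCkBound r (Q * e) (fun y => K (toTorus y) ω - K₀ (toTorus y)) ∧
        ∀ k l, IsCrTorus r fun θ => H (θ, ω) k l := by
  obtain ⟨Q, hQ0, hQ⟩ := exists_hasCkBound_of_perturbation (RVec n) (RVec m) r hB C ν
    (2 * (C * greenSum ν)) (√ν)
  refine ⟨Q, hQ0, fun α U F₀ K₀ G δ ρ e B' F K H T hF he he1 hK hKρ hH ω => ?_⟩
  -- With `ω` frozen, `F` along the orbit of `ω` is a nonautonomous deterministic family with
  -- parameter `y`.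
  obtain ⟨h1, K', h2⟩ := hQ U _ _ _ _ δ ρ e B' (fun k z y => F z (toTorus y) (iterZ Φ k ω))
    (fun k y => K (toTorus (y + k • α)) (iterZ Φ k ω)) (fun y => H (toTorus y, ω)) T
    (fun k => hF _) he he1
    (fun k y => by
      simp only [toTorus_add, toTorus_zsmul]
      exact apply_iterate hK _ ω k)
    (fun k y => hKρ _ _)
    (fun y => by
      simp only [toTorus_add, toTorus_zsmul]
      exact hH _ ω)
  refine ⟨by simpa [iterZ_zero] using h1 0, fun k l => (h2 k l).1⟩

end RandomTorus

/-! ### Normal hyperbolicity and measurability of the random torus -/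

section RandomHyperbolicity

variable {n m : ℕ} {Ω : Type*} [MeasurableSpace Ω] {P : Measure Ω} {Φ : Ω ≃ᵐ Ω} {α : RVec m}

theorem isUnit_fderiv_of_isLocalDiffeomorphAt {f : RVec n → RVec n} {x : RVec n}
    (h : IsLocalDiffeomorphAt 𝓘(ℝ, RVec n) 𝓘(ℝ, RVec n) 1 f x) : IsUnit (fderiv ℝ f x) := by
  obtain ⟨e, he⟩ : ∃ e : RVec n ≃L[ℝ] RVec n, (e : RVec n →L[ℝ] RVec n) = fderiv ℝ f x :=
    ⟨h.mfderivToContinuousLinearEquiv one_ne_zero, by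
      rw [← mfderiv_eq_fderiv]
      exact h.mfderivToContinuousLinearEquiv_coe one_ne_zero⟩
  rw [← he]
  exact ⟨(ContinuousLinearEquiv.unitsEquiv ℝ (RVec n)).symm e, rfl⟩

/-- Normal hyperbolicity from Green kernels. -/
theorem isNormallyHyperbolic_of_green (hΦ : MeasurePreserving Φ P P) {r : ℕ}
    {M : Torus m → Ω → RVec n →L[ℝ] RVec n} {H : Torus m × Ω → ℤ → ℤ → RVec n →L[ℝ] RVec n}
    {C ν : ℝ} (hHm : Measurable fun p => H p 0 (-1))
    (hr : ∀ᵐ ω ∂P, IsCrTorus r fun θ => H (θ, ω) 0 (-1)) (hu : ∀ᵐ ω ∂P, ∀ θ, IsUnit (M θ ω))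
    (hG : ∀ᵐ ω ∂P, ∀ θ, IsGreen (fun k : ℤ => M (θ + k • toTorus α) (iterZ Φ k ω)) (H (θ, ω)) C ν) :
    IsNormallyHyperbolic P Φ α r M := by
  -- Kernel entry just after the impulse: the stable projection at time zero. Constant and rates do
  -- not depend on `ω`.
  refine ⟨fun θ ω => H (θ, ω) 0 (-1), fun θ ω => 1 - H (θ, ω) 0 (-1), fun _ => C / ν + 1,
    fun _ => ν, fun _ => ν⁻¹, hHm, measurable_const.sub hHm, measurable_const, measurable_const,
    measurable_const, ?_⟩
  -- Backward products involve the whole orbit of `ω`; countably many null sets are discarded using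
  -- invariance of `P`.
  have hu' : ∀ᵐ ω ∂P, ∀ (k : ℤ) θ, IsUnit (M θ (iterZ Φ k ω)) :=
    ae_all_iff.2 fun k => (measurePreserving_iterZ hΦ k).quasiMeasurePreserving.ae hu
  have hG' := hΦ.quasiMeasurePreserving.ae hG
  filter_upwards [hr, hu', hG, hG'] with ω h1 h2 h3 h4
  have hν := (h3 0).nu_pos
  have hC := (h3 0).const_nonneg
  refine ⟨h1, contDiff_const.sub h1, by positivity, hν, (h3 0).nu_lt,
    (one_lt_inv₀ hν).2 (h3 0).nu_lt, fun θ => ?_⟩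
  have h := h3 θ
  have hA : ∀ k : ℤ, IsUnit (M (θ + k • toTorus α) (iterZ Φ k ω)) := fun k => h2 k _
  have e0 : M (θ + (0 : ℤ) • toTorus α) (iterZ Φ 0 ω) = M θ ω := by
    rw [zero_zsmul, add_zero, iterZ_zero]
  have hidem : H (θ, ω) 0 (-1) * H (θ, ω) 0 (-1) = H (θ, ω) 0 (-1) := h.stable_idem 0
  -- Shifting the kernel of `(θ, ω)` gives a kernel of the sequence based at `(θ + α, Φ ω)`;
  -- uniqueness identifies the two and yields invariance of the splitting.
  have hshift : H (θ, ω) 1 0 = H (θ + toTorus α, Φ ω) 0 (-1) := by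
    have h5 : IsGreen (fun k : ℤ => M (θ + toTorus α + k • toTorus α) (iterZ Φ k (Φ ω)))
        (fun k l => H (θ, ω) (k + 1) (l + 1)) C ν := by
      have := h.shift
      convert this using 3 with k
      · rw [add_zsmul, one_zsmul, add_right_comm, add_assoc]
      · rw [iterZ_apply]
    exact h5.kernel_unique (h4 (θ + toTorus α)) 0 (-1)
  have hinv : M θ ω * H (θ, ω) 0 (-1) = H (θ + toTorus α, Φ ω) 0 (-1) * M θ ω := by
    have := h.stable_mul 0
    simp only [e0, zero_add, zero_sub] at this
    rw [this, hshift]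
  have ht : ∀ k : ℤ, θ + (k + 1) • toTorus α = θ + k • toTorus α + toTorus α := fun k => by
    rw [add_zsmul, one_zsmul, add_assoc]
  have hf : ∀ N, forwardCocycle Φ α M N θ ω =
      fwdProd (fun k : ℤ => M (θ + k • toTorus α) (iterZ Φ k ω)) N 0 := fun N => by
    rw [← forwardCocycle_eq_fwdProd (Φ := Φ) (α := α) (t := fun k : ℤ => θ + k • toTorus α)
      (w := fun k => iterZ Φ k ω) M ht (fun k => iterZ_succ Φ k ω), zero_zsmul, add_zero, iterZ_zero]
  have hb : ∀ N, backwardCocycle Φ α M N θ ω =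
      bwdProd (fun k : ℤ => M (θ + k • toTorus α) (iterZ Φ k ω)) N 0 := fun N => by
    rw [← backwardCocycle_eq_bwdProd (Φ := Φ) (α := α) (t := fun k : ℤ => θ + k • toTorus α)
      (w := fun k => iterZ Φ k ω) M ht (fun k => iterZ_succ Φ k ω), zero_zsmul, add_zero, iterZ_zero]
  refine ⟨e0 ▸ hA 0, hidem, ?_, add_sub_cancel _ _, hinv, ?_, fun v => ?_, fun v => ?_⟩
  · rw [mul_sub, mul_one, sub_mul, one_mul, hidem, sub_self, sub_zero]
  · rw [mul_sub, mul_one, sub_mul, one_mul, hinv]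
  · simp only [hf]
    exact h.mem_range_stable_iff 0 v
  · simp only [hb]
    exact h.mem_range_unstable_iff hA 0 v

/-- The graph of a continuous measurable section is a random set. -/
theorem isRandomSet_torusGraph {K : Torus m → Ω → RVec n}
    (hK : Measurable fun p : Torus m × Ω => K p.1 p.2) (hc : ∀ ω, Continuous fun θ => K θ ω) :
    IsRandomSet (torusGraph K) := by
  have hg : ∀ ω, Continuous fun θ : Torus m => (K θ ω, θ) := fun ω => (hc ω).prodMk continuous_id
  refine ⟨fun ω => ⟨range_nonempty _, (isCompact_range (hg ω)).isClosed⟩, fun x => ?_⟩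
  refine measurable_of_Iio fun c => ?_
  -- Since the section is continuous in `θ`, an open condition met by some angle is met by one of a
  -- countable dense set of angles.
  have h1 : (fun ω => Metric.infDist x (torusGraph K ω)) ⁻¹' Iio c =
      ⋃ j : ℕ, {ω | dist x (K (TopologicalSpace.denseSeq (Torus m) j) ω,
        TopologicalSpace.denseSeq (Torus m) j) < c} := by
    ext ω
    simp only [mem_preimage, mem_Iio, mem_iUnion, mem_ofPred_eq]
    rw [torusGraph, Metric.infDist_lt_iff (range_nonempty _)]
    constructor
    · rintro ⟨_, ⟨θ, rfl⟩, hθ⟩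
      exact (TopologicalSpace.denseRange_denseSeq (Torus m)).exists_mem_open
        (isOpen_lt (continuous_const.dist (hg ω)) continuous_const) ⟨θ, hθ⟩
    · rintro ⟨j, hj⟩
      exact ⟨_, ⟨_, rfl⟩, hj⟩
  rw [h1]
  refine MeasurableSet.iUnion fun j => ?_
  have h2 : Measurable fun ω => K (TopologicalSpace.denseSeq (Torus m) j) ω :=
    hK.comp (measurable_const.prodMk measurable_id)
  exact measurableSet_lt (measurable_const.dist (h2.prodMk measurable_const)) measurable_const

theorem measurable_deterministic {U : Set (RVec n)} {r : ℕ} {B : ℝ}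
    {F₀ : RVec n → Torus m → RVec n}
    (h : MixedBound U r B fun z (y : RVec m) => F₀ z (toTorus y)) :
    Measurable fun q : U × Torus m × Ω => F₀ q.1 q.2.1 := by
  have hq : IsOpenQuotientMap (Prod.map id toTorus : U × RVec m → U × Torus m) :=
    IsOpenQuotientMap.id.prodMap isOpenQuotientMap_toTorus
  have hc : Continuous fun q : U × Torus m => F₀ q.1 q.2 := by
    refine hq.continuous_comp_iff.1 ?_
    exact h.continuousOn.comp_continuous (f := fun q : U × RVec m => ((q.1 : RVec n), q.2))
      (by fun_prop) fun q => ⟨q.1.2, mem_univ _⟩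
  exact hc.measurable.comp (measurable_fst.prodMk (measurable_fst.comp measurable_snd))

theorem ae_norm_le_of_linfCrNorm_lt {K : Torus m → Ω → RVec n} {b : ℝ}
    (h : linfCrNorm P 0 K < ENNReal.ofReal b) : ∀ᵐ ω ∂P, ∀ θ, ‖K θ ω‖ ≤ b := by
  filter_upwards [ENNReal.ae_le_essSup fun ω => crTorusNorm 0 fun θ => K θ ω] with ω hω θ
  obtain ⟨b', hb', h'⟩ := norm_le_of_crTorusNorm_lt (hω.trans_lt h)
  exact (h' θ).trans hb'.le

theorem linfCrNorm_le_of_forall {K : Torus m → Ω → RVec n} {r : ℕ} {b : ℝ}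
    (h : ∀ ω, HasCkBound r b fun y => K (toTorus y) ω) : linfCrNorm P r K ≤ ENNReal.ofReal b :=
  essSup_le_of_ae_le _ (Eventually.of_forall fun ω =>
    (crTorusNorm_le_ofReal_iff (h ω).nonneg).2 (h ω).2)

end RandomHyperbolicity

/-! ### From closeness in essential supremum to closeness for every `ω` -/

section Closeness

variable {n m : ℕ} {U : Set (RVec n)} {r : ℕ} {F₀ f : RVec n → Torus m → RVec n}

theorem isCloseMap_of_bounds (hU : IsOpen U) {B e : ℝ} (hF₀ : IsCSigma U (sigmaRS r 1) F₀)
    (hf : IsCSigma U (sigmaRS r 1) f)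
    (hB : ∀ i j, (i, j) ∈ sigmaRS r 1 → ∀ z ∈ U, ∀ x : RVec m, ‖mixedDeriv i j f z x‖ ≤ B)
    (he : ∀ i j, (i, j) ∈ sigmaJoint r ∪ {(0, 1)} → ∀ z ∈ U, ∀ x : RVec m,
      ‖mixedDeriv i j (fun z θ => f z θ - F₀ z θ) z x‖ ≤ e) : IsCloseMap U r B F₀ f e := by
  have key : ∀ i j, (i, j) ∈ sigmaRS r 1 → (i, j) ∈ sigmaJoint r ∪ {(0, 1)} →
      ∀ p : RVec n × RVec m, p.1 ∈ U →
      ‖mixedD (fun z (y : RVec m) => f z (toTorus y)) i j p -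
        mixedD (fun z (y : RVec m) => F₀ z (toTorus y)) i j p‖ ≤ e := fun i j h1 h2 p hp => by
    rw [← HasMixedD.mixedD_sub (φ := fun z (y : RVec m) => f z (toTorus y))
      (ψ := fun z (y : RVec m) => F₀ z (toTorus y)) hU hf hF₀ h1 hp]
    exact he i j h2 p.1 hp p.2
  exact ⟨hf.mixedBound hB,
    fun i j hij => key i j ⟨by simp only; omega, by simp only; omega⟩ (Or.inl hij),
    key 0 1 ⟨by simp, by simp⟩ (Or.inr rfl)⟩

set_option maxSynthPendingDepth 2 in
theorem isCloseMap_self {B e : ℝ}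
    (h : MixedBound U r B fun z (y : RVec m) => F₀ z (toTorus y)) (he : 0 ≤ e) :
    IsCloseMap U r B F₀ F₀ e :=
  ⟨h, fun i j _ p _ => by rw [sub_self]; simpa using he,
    fun p _ => by rw [sub_self]; simpa using he⟩

theorem IsCloseMap.mono {B B' e : ℝ} (h : IsCloseMap U r B F₀ f e) (hB : B ≤ B') :
    IsCloseMap U r B' F₀ f e :=
  ⟨h.mixedBound.mono hB, h.close, h.close_fderiv⟩

variable {Ω : Type*} [MeasurableSpace Ω] {P : Measure Ω} {F : RVec n → Torus m → Ω → RVec n}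

/-- A random map that is close to `F₀` is, for almost every `ω`, close to `F₀`. -/
theorem exists_ae_isCloseMap (hU : IsOpen U) {e : ℝ} (he : 0 ≤ e)
    (hF₀ : IsCSigma U (sigmaRS r 1) F₀) (hF : MemLinfCSigma P U (sigmaRS r 1) F)
    (h : linfCSigmaNorm P U (sigmaJoint r ∪ {(0, 1)}) (fun z θ ω => F z θ ω - F₀ z θ)
      ≤ ENNReal.ofReal e) :
    ∃ B, ∀ᵐ ω ∂P, IsCloseMap U r B F₀ (fun z θ => F z θ ω) e := by
  obtain ⟨-, h1, h2⟩ := hF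
  refine ⟨(linfCSigmaNorm P U (sigmaRS r 1) F).toReal, ?_⟩
  filter_upwards [h1, ENNReal.ae_le_essSup fun ω => cSigmaNorm U (sigmaRS r 1) fun z θ => F z θ ω,
    ENNReal.ae_le_essSup fun ω =>
      cSigmaNorm U (sigmaJoint r ∪ {(0, 1)}) fun z θ => F z θ ω - F₀ z θ] with ω h3 h4 h5
  refine isCloseMap_of_bounds hU hF₀ h3 ((cSigmaNorm_le_ofReal_iff ENNReal.toReal_nonneg).1 ?_)
    ((cSigmaNorm_le_ofReal_iff he).1 (h5.trans h))
  rw [ENNReal.ofReal_toReal h2.ne]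
  exact h4

/-- Redefining a random map on a null set, we may assume that it is close to `F₀` everywhere. -/
theorem exists_everywhere_isCloseMap (hU : IsOpen U) {e B₀ : ℝ} (he : 0 ≤ e)
    (hF₀ : IsCSigma U (sigmaRS r 1) F₀)
    (hF₀' : MixedBound U r B₀ fun z (y : RVec m) => F₀ z (toTorus y))
    (hF : MemLinfCSigma P U (sigmaRS r 1) F)
    (h : linfCSigmaNorm P U (sigmaJoint r ∪ {(0, 1)}) (fun z θ ω => F z θ ω - F₀ z θ)
      ≤ ENNReal.ofReal e) :
    ∃ (B : ℝ) (F' : RVec n → Torus m → Ω → RVec n),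
      Measurable (fun q : U × Torus m × Ω => F' q.1 q.2.1 q.2.2) ∧
      (∀ ω, IsCloseMap U r B F₀ (fun z θ => F' z θ ω) e) ∧
      ∀ᵐ ω ∂P, ∀ z θ, F' z θ ω = F z θ ω := by
  classical
  obtain ⟨B, hB⟩ := exists_ae_isCloseMap hU he hF₀ hF h
  -- The exceptional set need not be measurable, so it is enlarged to a measurable null set before
  -- `F` is replaced there by `F₀`.
  set s : Set Ω := toMeasurable P {ω | ¬ IsCloseMap U r B F₀ (fun z θ => F z θ ω) e}
  have hs : MeasurableSet s := measurableSet_toMeasurable _ _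
  have hs0 : P s = 0 := by rw [measure_toMeasurable]; exact hB
  have hsc : ∀ ω, ω ∉ s → IsCloseMap U r B F₀ (fun z θ => F z θ ω) e := fun ω hω => by
    by_contra h
    exact hω (subset_toMeasurable _ _ h)
  refine ⟨max B B₀, fun z θ ω => if ω ∈ s then F₀ z θ else F z θ ω, ?_, fun ω => ?_, ?_⟩
  · exact Measurable.ite (measurable_snd.comp measurable_snd hs) (measurable_deterministic hF₀') hF.1
  · by_cases hω : ω ∈ s
    · simp only [hω, if_true]
      exact (isCloseMap_self hF₀' he).mono (le_max_right _ _)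
    · simp only [hω, if_false]
      exact (hsc ω hω).mono (le_max_left _ _)
  · filter_upwards [measure_eq_zero_iff_ae_notMem.1 hs0] with ω hω z θ
    simp only [hω, if_false]

end Closeness

/-! ### Assembly of the main theorem -/

theorem mainTheorem4 {n m : ℕ} (r : ℕ)
    {Ω : Type*} [MeasurableSpace Ω] (P : Measure Ω) [IsProbabilityMeasure P]
    (Φ : Ω ≃ᵐ Ω) (hΦ : MeasurePreserving Φ P P)
    (α : RVec m) (U : Set (RVec n)) (hU : IsOpen U)
    -- the deterministic skew-product and its normally hyperbolic invariant torus
    (F₀ : RVec n → Torus m → RVec n)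
    (hF₀ : IsCSigma U (sigmaRS r 1) F₀) (hF₀b : cSigmaNorm U (sigmaRS r 1) F₀ < ∞)
    (K₀ : Torus m → RVec n) (hK₀U : ∀ θ, K₀ θ ∈ U) (hK₀ : IsCrTorus r K₀)
    (hinv : ∀ θ, F₀ (K₀ θ) θ = K₀ (θ + toTorus α))
    (hhyp : IsNormallyHyperbolicDet α r F₀ K₀)
    -- the constant in the `O(ε)` closeness of `F` to `F₀`
    (c : ℝ) (hc : 0 < c) :
    ∃ ε₀ > 0, ∃ C > 0, ∃ ρ > 0, ∀ ε : ℝ, 0 < ε → ε < ε₀ →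
      ∀ F : RVec n → Torus m → Ω → RVec n,
        MemLinfCSigma P U (sigmaRS r 1) F →
        (∀ᵐ ω ∂P, ∀ θ, IsLocalDiffeomorphOn 𝓘(ℝ, RVec n) 𝓘(ℝ, RVec n) 1
          (fun z => F z θ ω) U) →
        -- for `r ≥ 1` the pair `(0, 1)` already belongs to `sigmaJoint r`
        linfCSigmaNorm P U (sigmaJoint r ∪ {(0, 1)}) (fun z θ ω => F z θ ω - F₀ z θ)
          ≤ ENNReal.ofReal (c * ε) →
        ∃ K : Torus m → Ω → RVec n,
          (∀ θ ω, K θ ω ∈ U) ∧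
          MemLinfCr P r K ∧
          IsRandomSet (torusGraph K) ∧
          SolvesInvariance P Φ α F K ∧
          IsNormallyHyperbolic P Φ α r (transferMatrix F K) ∧
          linfCrNorm P r (fun θ ω => K θ ω - K₀ θ) ≤ ENNReal.ofReal (C * ε) ∧
          linfCrNorm P 0 (fun θ ω => K θ ω - K₀ θ) < ENNReal.ofReal ρ ∧
          ∀ K' : Torus m → Ω → RVec n,
            (∀ᵐ ω ∂P, ∀ θ, K' θ ω ∈ U) →
            MemLinfCr P 0 K' →
            SolvesInvariance P Φ α F K' →
            linfCrNorm P 0 (fun θ ω => K' θ ω - K₀ θ) < ENNReal.ofReal ρ →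
            ∀ᵐ ω ∂P, ∀ θ, K' θ ω = K θ ω := by
  obtain ⟨B, A, ν, δ, ρ, G, hδ, hGm, T⟩ := exists_hyperbolicTube hU hF₀ hF₀b hK₀U hK₀ hinv hhyp
  change IsTorusTube U r B F₀ α K₀ G A ν δ ρ at T
  have hρ : 0 < ρ := HyperbolicTube.rho_pos T
  have hB : 0 ≤ B := HyperbolicTube.bound_nonneg T
  have hA : 0 ≤ A * greenSum ν := (T.isGreen 0).const_greenSum_nonneg
  obtain ⟨Q, hQ0, hQ⟩ := IsTorusTube.exists_regularity (Φ := Φ) (n := n) (m := m) hB r A ν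
  -- The three thresholds give contraction in the tube, perturbation size at most one in the
  -- regularity estimate, and invariance of the `ρ`-ball under Picard iteration.
  set e₀ : ℝ := min (min (δ / 2) 1) (ρ / (2 * (A * greenSum ν) + 1))
  have he₀ : 0 < e₀ := lt_min (lt_min (half_pos hδ) one_pos) (by positivity)
  -- The `1` in `Q * c + 1` only ensures positivity. The uniqueness radius is the full tube radius
  -- `2 * ρ`, while the torus found lies within `ρ`; this makes the distance bound strict.
  refine ⟨e₀ / c, by positivity, Q * c + 1, by positivity, 2 * ρ, by positivity,
    fun ε hε hεε F hF hdiff hFe => ?_⟩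
  have hce : c * ε ≤ e₀ := by
    rw [lt_div_iff₀ hc] at hεε
    linarith
  have he0 : 0 ≤ c * ε := by positivity
  have he1 : c * ε ≤ δ / 2 := hce.trans ((min_le_left _ _).trans (min_le_left _ _))
  have he2 : c * ε ≤ 1 := hce.trans ((min_le_left _ _).trans (min_le_right _ _))
  have he3 : 2 * (A * greenSum ν) * (c * ε) ≤ ρ := by
    have h1 : c * ε ≤ ρ / (2 * (A * greenSum ν) + 1) := hce.trans (min_le_right _ _)
    rw [le_div_iff₀ (by positivity)] at h1
    nlinarith
  obtain ⟨B', F', hF'm, hF', hFF'⟩ :=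
    exists_everywhere_isCloseMap hU he0 hF₀ (HyperbolicTube.mixedBound T) hF hFe
  obtain ⟨K, hKm, hKρ, hK⟩ := T.exists_section (Φ := Φ) hGm hF'm hF' he1 he3
  obtain ⟨H, hHm, hH⟩ := T.exists_random_green (Φ := Φ) hGm hF'm hF' he1 hKm hKρ
  have hreg := hQ α U F₀ K₀ G δ ρ (c * ε) B' F' K H T hF' he1 he2 hK hKρ hH
  have hKU : ∀ θ ω, K θ ω ∈ U := fun θ ω => T.mem (θ := θ) (by linarith [hKρ θ ω])
  have hKK₀ : ∀ ω, IsCrTorus r fun θ => K θ ω := fun ω => by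
    have : ContDiff ℝ r fun y : RVec m => (K (toTorus y) ω - K₀ (toTorus y)) + K₀ (toTorus y) :=
      (hreg ω).1.1.add hK₀
    simpa [IsCrTorus] using this
  obtain ⟨B₀, hB₀0, hB₀⟩ := hK₀.exists_hasCkBound
  -- The modified map agrees with `F` along the entire orbit of almost every `ω`, so cocycle and
  -- orbit statements transfer.
  have hFF'k : ∀ᵐ ω ∂P, ∀ (k : ℤ) z θ, F' z θ (iterZ Φ k ω) = F z θ (iterZ Φ k ω) :=
    ae_all_iff.2 fun k => (measurePreserving_iterZ hΦ k).quasiMeasurePreserving.ae hFF'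
  have hM : ∀ᵐ ω ∂P, ∀ (k : ℤ) θ,
      transferMatrix F K θ (iterZ Φ k ω) = transferMatrix F' K θ (iterZ Φ k ω) := by
    filter_upwards [hFF'k] with ω hω k θ
    simp only [transferMatrix, hω]
  refine ⟨K, hKU, ⟨hKm, Eventually.of_forall hKK₀, ?_⟩,
    isRandomSet_torusGraph hKm fun ω => (hKK₀ ω).continuous, ?_, ?_, ?_, ?_,
    fun K' hK'U hK'mem hK'inv hK'ρ => ?_⟩
  · refine (linfCrNorm_le_of_forall (b := Q * (c * ε) + B₀) fun ω => ?_).trans_lt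
      ENNReal.ofReal_lt_top
    simpa using (hreg ω).1.add hB₀
  · filter_upwards [hFF'] with ω hω θ
    rw [← hω, hK]
  · refine isNormallyHyperbolic_of_green hΦ (H := H) (C := 2 * (A * greenSum ν)) (ν := √ν) (hHm 0 (-1))
      (Eventually.of_forall fun ω => (hreg ω).2 0 (-1)) ?_ ?_
    · filter_upwards [hdiff] with ω hω θ
      exact isUnit_fderiv_of_isLocalDiffeomorphAt (hω θ ⟨K θ ω, hKU θ ω⟩)
    · filter_upwards [hM] with ω hω θ
      simp only [hω]
      exact hH θ ω
  · refine (linfCrNorm_le_of_forall fun ω => (hreg ω).1).trans (ENNReal.ofReal_le_ofReal ?_)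
    nlinarith
  · refine (linfCrNorm_le_of_forall (b := ρ) fun ω => ?_).trans_lt
      ((ENNReal.ofReal_lt_ofReal_iff (by positivity)).2 (by linarith))
    rw [HasCkBound.zero_iff]
    exact ⟨(hreg ω).1.1.continuous, fun y => hKρ _ _⟩
  · have h1 : ∀ᵐ ω ∂P, ∀ (k : ℤ) θ, ‖K' θ (iterZ Φ k ω) - K₀ θ‖ ≤ 2 * ρ :=
      ae_all_iff.2 fun k => (measurePreserving_iterZ hΦ k).quasiMeasurePreserving.ae
        (ae_norm_le_of_linfCrNorm_lt hK'ρ)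
    have h2 : ∀ᵐ ω ∂P, ∀ (k : ℤ) θ, F (K' θ (iterZ Φ k ω)) θ (iterZ Φ k ω) =
        K' (θ + toTorus α) (Φ (iterZ Φ k ω)) :=
      ae_all_iff.2 fun k => (measurePreserving_iterZ hΦ k).quasiMeasurePreserving.ae hK'inv
    filter_upwards [h1, h2, hFF'k] with ω h1 h2 h3 θ
    -- Both tori, read along the base orbit of `(θ, ω)`, are solutions in the tube. The full-measure
    -- set of `ω` is chosen before `θ`.
    have h4 := T.eq_of_solves (f := fun k z θ => F' z θ (iterZ Φ k ω)) (fun k => hF' _) he1 (θ := θ)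
      (x := fun k => K' (θ + k • toTorus α) (iterZ Φ k ω))
      (x' := fun k => K (θ + k • toTorus α) (iterZ Φ k ω))
      (fun k => by
        rw [h3, h2, iterZ_succ, add_zsmul, one_zsmul, add_assoc])
      (fun k => h1 k _) (fun k => apply_iterate hK θ ω k)
      (fun k => (hKρ _ _).trans (by linarith)) 0
    simpa [iterZ_zero] using h4
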